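/- Let $\ell^2=\ell^2(\mathbb Z;\mathbb R)$ with orthonormal basis $(e_i)_{i\in\mathbb Z}$, and let $\nu,\lambda>0$. Define bounded operators on $\ell^2$ by $(Au)_i=-\nu(u_{i-1}-2u_i+u_{i+1})$, $A_\lambda=A+\lambda\,\mathrm{id}$, and $S_\lambda(t)=e^{-tA_\lambda}$. Let $\tfrac12<\beta<\beta'<H<1$ and $1-\beta'<\alpha<\beta$. Let $f_i\in C^1(\mathbb R,\mathbb R)$ and $h_i\in C^2(\mathbb R,\mathbb R)$, $i\in\mathbb Z$, satisfy $\sum_i f_i(0)^2<\infty$, $\sum_i h_i(0)^2<\infty$, $|f_i'|\le D_f$, $|h_i'|\le D_h$ and $|h_i''|\le M_h$ on $\mathbb R$ for all $i$, with constants independent of $i$. For $u,v\in\ell^2$ put $f(u)=(f_i(u_i))_i\in\ell^2$ and $h(u)v=(h_i(u_i)v_i)_i$. For real functions $Z,\omega$ and $s<t$ put, for $s<r<t$, $$D^\alpha_{s+}Z[r]=\frac1{\Gamma(1-\alpha)}\Big(\frac{Z(r)}{(r-s)^\alpha}+\alpha\int_s^r\frac{Z(r)-Z(q)}{(r-q)^{1+\alpha}}\,dq\Big),$$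 $$D^{1-\alpha}_{t-}\omega_{t-}[r]=\frac{(-1)^{1-\alpha}}{\Gamma(\alpha)}\Big(\frac{\omega(r)-\omega(t-)}{(t-r)^{1-\alpha}}+(1-\alpha)\int_r^t\frac{\omega(r)-\omega(q)}{(q-r)^{2-\alpha}}\,dq\Big),$$ and $\int_s^tZ\,d\omega=(-1)^\alpha\int_s^tD^\alpha_{s+}Z[r]\,D^{1-\alpha}_{t-}\omega_{t-}[r]\,dr$, where $(-1)^\alpha(-1)^{1-\alpha}=-1$. For an operator-valued $Z$ and an $\ell^2$-valued $\omega$ put $\int_s^tZ\,d\omega=\sum_j\big(\sum_i\int_s^t\langle e_j,Ze_i\rangle\,d\langle e_i,\omega\rangle\big)e_j$; integrals over $[t,t]$ are $0$. Let $\sigma=(\sigma_i)_i\in\ell^2$ and let $B^H=(B^H(t))_{t\in\mathbb R}$ be an $\ell^2$-valued fractional Brownian motion with continuous paths, $B^H(0)=0$, Hurst parameter $H$ and covariance operator $Qe_i=\sigma_i^2e_i$; that is, the coordinate processes are independent centered Gaussian processes, the $i$-th one having covariance $\tfrac12\sigma_i^2(|s|^{2H}+|t|^{2H}-|t-s|^{2H})$.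 Let $C_0^{\beta'}(\mathbb R;\ell^2)$ be the set of paths $\mathbb R\to\ell^2$ that vanish at $0$ and are $\beta'$-Hölder continuous on every compact interval. Then almost every path of $B^H$ belongs to $C_0^{\beta'}(\mathbb R;\ell^2)$. Moreover, for every $\omega\in C_0^{\beta'}(\mathbb R;\ell^2)$, every $T>0$ and every $x\in\ell^2$, both integrals in the mild equation $$u(t)=S_\lambda(t)x+\int_0^tS_\lambda(t-r)f(u(r))\,dr+\int_0^tS_\lambda(t-r)h(u(r))\,d\omega(r),\qquad t\in[0,T],$$ are well defined for every $u\in C^\beta([0,T];\ell^2)$, and this equation has a unique solution $u\in C^\beta([0,T];\ell^2)$. -/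

import Mathlib

open MeasureTheory ProbabilityTheory Set
open scoped NNReal ENNReal

noncomputable section

namespace LatticeSDE

/-! ### The space of square summable two-sided sequences -/

/-- The real Hilbert space of square summable sequences indexed by the integers. -/
abbrev L2Z : Type := lp (fun _ : ℤ => ℝ) 2

/-- The vector with entry one at position `i` and zero elsewhere. -/
def basisVec (i : ℤ) : L2Z := lp.single 2 i (1 : ℝ)

theorem memlp_iff {a : ℤ → ℝ} : Memℓp a 2 ↔ Summable fun i => a i ^ 2 := by
  rw [memℓp_gen_iff (by norm_num)]
  simp

theorem norm_sq_eq (u : L2Z) : ‖u‖ ^ 2 = ∑' i, u i ^ 2 := by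
  have h := lp.norm_rpow_eq_tsum (p := 2) (by norm_num) u
  simpa using h

theorem summable_sq (u : L2Z) : Summable fun i => u i ^ 2 :=
  memlp_iff.1 (lp.memℓp u)

theorem norm_coord_le (u : L2Z) (i : ℤ) : |u i| ≤ ‖u‖ :=
  lp.norm_apply_le_norm (by norm_num) u i

theorem norm_le_of_sq_le {u v : L2Z} {c : ℝ} (hc : 0 ≤ c)
    (h : ∑' i, u i ^ 2 ≤ c ^ 2 * ∑' i, v i ^ 2) : ‖u‖ ≤ c * ‖v‖ := by
  apply le_of_sq_le_sq _ (by positivity)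
  rw [mul_pow, norm_sq_eq, norm_sq_eq]
  exact h

/-! ### The discrete Laplacian, the operator `A_lam` and its semigroup -/

/-- The translation `(shift k u)_i = u_(i+k)`, a bounded operator. -/
def shift (k : ℤ) : L2Z →L[ℝ] L2Z :=
  LinearMap.mkContinuous
    { toFun := fun u =>
        ⟨fun i => u (i + k), memlp_iff.2 ((Equiv.addRight k).summable_iff.2 (summable_sq u))⟩
      map_add' := fun _ _ => rfl
      map_smul' := fun _ _ => rfl }
    1 (fun u => norm_le_of_sq_le zero_le_one (by
        rw [one_pow, one_mul]
        exact ((Equiv.addRight k).tsum_eq (fun i => u i ^ 2)).le))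

@[simp]
theorem shift_apply (k : ℤ) (u : L2Z) (i : ℤ) : shift k u i = u (i + k) := rfl

/-- The bounded operator `(A u)_i = -ν (u_(i-1) - 2 u_i + u_(i+1))`. -/
def opA (ν : ℝ) : L2Z →L[ℝ] L2Z :=
  (-ν) • (shift (-1) - (2 : ℝ) • ContinuousLinearMap.id ℝ L2Z + shift 1)

theorem opA_apply (ν : ℝ) (u : L2Z) (i : ℤ) :
    opA ν u i = -ν * (u (i - 1) - 2 * u i + u (i + 1)) := rfl

/-- `A_lam u = A u + lam u`. -/
def opALam (ν lam : ℝ) : L2Z →L[ℝ] L2Z := opA ν + lam • ContinuousLinearMap.id ℝ L2Z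

/-- The semigroup `S_lam(t) = exp(-t A_lam)`, an exponential series of bounded operators. -/
def semigroup (ν lam t : ℝ) : L2Z →L[ℝ] L2Z := NormedSpace.exp ((-t) • opALam ν lam)

/-! ### The nonlinearities -/

/-- The assumption on the drift: each `f i` is continuously differentiable, the sequence of values
at zero is square summable, and the derivatives are bounded uniformly in `i`. -/
structure DriftAssumption (f : ℤ → ℝ → ℝ) : Prop where
  contDiff : ∀ i, ContDiff ℝ 1 (f i)
  summable_zero : Summable fun i => f i 0 ^ 2
  deriv_bdd : ∃ D : ℝ, 0 ≤ D ∧ ∀ i z, |deriv (f i) z| ≤ D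

/-- The assumption on the diffusion coefficients: each `h i` is twice continuously differentiable,
the sequence of values at zero is square summable, and the first and second derivatives are bounded
uniformly in `i`. -/
structure DiffusionAssumption (h : ℤ → ℝ → ℝ) : Prop where
  contDiff : ∀ i, ContDiff ℝ 2 (h i)
  summable_zero : Summable fun i => h i 0 ^ 2
  deriv_bdd : ∃ D : ℝ, 0 ≤ D ∧ ∀ i z, |deriv (h i) z| ≤ D
  deriv2_bdd : ∃ M : ℝ, 0 ≤ M ∧ ∀ i z, |deriv (deriv (h i)) z| ≤ M

theorem DiffusionAssumption.toDrift {h : ℤ → ℝ → ℝ} (hh : DiffusionAssumption h) :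
    DriftAssumption h :=
  ⟨fun i => (hh.contDiff i).of_le (by norm_num), hh.summable_zero, hh.deriv_bdd⟩

theorem DriftAssumption.memlp {f : ℤ → ℝ → ℝ} (hf : DriftAssumption f) (u : L2Z) :
    Memℓp (fun i => f i (u i)) 2 := by
  obtain ⟨D, hD, hfD⟩ := hf.deriv_bdd
  rw [memlp_iff]
  refine Summable.of_nonneg_of_le (fun i => sq_nonneg _) (fun i => ?_)
    ((hf.summable_zero.mul_left 2).add ((summable_sq u).mul_left (2 * D ^ 2)))
  have h1 : ‖f i (u i) - f i 0‖ ≤ D * ‖u i - 0‖ :=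
    Convex.norm_image_sub_le_of_norm_deriv_le (s := univ)
      (fun x _ => ((hf.contDiff i).differentiable (by norm_num)).differentiableAt)
      (fun x _ => hfD i x) convex_univ (mem_univ _) (mem_univ _)
  rw [sub_zero, Real.norm_eq_abs, Real.norm_eq_abs] at h1
  have h2 : (f i (u i) - f i 0) ^ 2 ≤ D ^ 2 * u i ^ 2 := by
    rw [← sq_abs, ← sq_abs (u i), ← mul_pow]
    exact pow_le_pow_left₀ (abs_nonneg _) h1 2
  nlinarith [sq_nonneg (f i (u i) - f i 0 - f i 0)]

/-- The operator `f(u) = (f_i(u_i))_i` on square summable sequences. -/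
def superposition {f : ℤ → ℝ → ℝ} (hf : DriftAssumption f) (u : L2Z) : L2Z :=
  ⟨fun i => f i (u i), hf.memlp u⟩

theorem superposition_apply {f : ℤ → ℝ → ℝ} (hf : DriftAssumption f) (u : L2Z) (i : ℤ) :
    superposition hf u i = f i (u i) := rfl

theorem mul_sq_le (a v : L2Z) (i : ℤ) : (a i * v i) ^ 2 ≤ ‖a‖ ^ 2 * v i ^ 2 := by
  rw [mul_pow]
  refine mul_le_mul_of_nonneg_right ?_ (sq_nonneg _)
  rw [← sq_abs]
  exact pow_le_pow_left₀ (abs_nonneg _) (norm_coord_le a i) 2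

theorem mul_summable (a v : L2Z) : Summable fun i => (a i * v i) ^ 2 :=
  Summable.of_nonneg_of_le (fun _ => sq_nonneg _) (mul_sq_le a v)
    ((summable_sq v).mul_left (‖a‖ ^ 2))

/-- The diagonal operator `v ↦ (a_i v_i)_i`. -/
def diagOp (a : L2Z) : L2Z →L[ℝ] L2Z :=
  LinearMap.mkContinuous
    { toFun := fun v => ⟨fun i => a i * v i, memlp_iff.2 (mul_summable a v)⟩
      map_add' := fun v w => by
        ext i
        exact mul_add (a i) (v i) (w i)
      map_smul' := fun c v => by
        ext i
        exact mul_left_comm (a i) c (v i) }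
    ‖a‖ (fun v => norm_le_of_sq_le (norm_nonneg a) (by
        rw [← tsum_mul_left]
        exact (mul_summable a v).tsum_le_tsum (mul_sq_le a v)
          ((summable_sq v).mul_left (‖a‖ ^ 2))))

theorem diagOp_apply (a v : L2Z) (i : ℤ) : diagOp a v i = a i * v i := rfl

/-- The operator valued map `h(u) v = (h_i(u_i) v_i)_i`. -/
def diffusionOp {h : ℤ → ℝ → ℝ} (hh : DiffusionAssumption h) (u : L2Z) : L2Z →L[ℝ] L2Z :=
  diagOp (superposition hh.toDrift u)

theorem diffusionOp_apply {h : ℤ → ℝ → ℝ} (hh : DiffusionAssumption h) (u v : L2Z) (i : ℤ) :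
    diffusionOp hh u v i = h i (u i) * v i := rfl

/-! ### The fractional integral of Zähle

The right-sided Weyl derivative carries the phase `(-1)^(1-α)` and the integral the phase `(-1)^α`.
Only the product of the two, which is `-1`, enters the integral; both phases are therefore left out
of the derivatives, and the integral carries the factor `-1`. -/

/-- The left-sided Weyl derivative of order `α` on the interval starting at `s`, at the point `r`.
-/
def weylLeft (α s : ℝ) (Z : ℝ → ℝ) (r : ℝ) : ℝ :=
  1 / Real.Gamma (1 - α) *
    (Z r / (r - s) ^ α + α * ∫ q in s..r, (Z r - Z q) / (r - q) ^ (1 + α))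

/-- The right-sided Weyl derivative of order `1 - α` (without phase) of `ω - ω(t-)` on the interval
ending at `t`, at the point `r`. -/
def weylRight (α t : ℝ) (ω : ℝ → ℝ) (r : ℝ) : ℝ :=
  1 / Real.Gamma α *
    ((ω r - Function.leftLim ω t) / (t - r) ^ (1 - α)
      + (1 - α) * ∫ q in r..t, (ω r - ω q) / (q - r) ^ (2 - α))

/-- The scalar fractional integral of `Z` against `ω` over `[s, t]`. -/
def scalarIntegral (α s t : ℝ) (Z ω : ℝ → ℝ) : ℝ :=
  -∫ r in s..t, weylLeft α s Z r * weylRight α t ω r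

/-- The scalar fractional integral is well defined: both fractional derivatives exist on the open
interval, as does the left limit of the integrator, and their product is Lebesgue integrable. -/
structure ScalarIntegrable (α s t : ℝ) (Z ω : ℝ → ℝ) : Prop where
  left : ∀ r ∈ Ioo s t,
    IntervalIntegrable (fun q => (Z r - Z q) / (r - q) ^ (1 + α)) volume s r
  right : ∀ r ∈ Ioo s t,
    IntervalIntegrable (fun q => (ω r - ω q) / (q - r) ^ (2 - α)) volume r t
  leftLim : Filter.Tendsto ω (nhdsWithin t (Iio t)) (nhds (Function.leftLim ω t))
  prod : IntervalIntegrable (fun r => weylLeft α s Z r * weylRight α t ω r) volume s t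

/-- The `j`-th coordinate of the fractional integral of the operator valued function `Z` against the
sequence valued function `ω`; `Z r (basisVec i) j` is the matrix entry `⟨e_j, Z(r) e_i⟩`. -/
def integralCoord (α s t : ℝ) (Z : ℝ → L2Z →L[ℝ] L2Z) (ω : ℝ → L2Z) (j : ℤ) : ℝ :=
  ∑' i : ℤ, scalarIntegral α s t (fun r => Z r (basisVec i) j) (fun r => ω r i)

/-- The fractional integral of `Z` against `ω` over `[s, t]`, with values in the sequence space. -/
def fracIntegral (α s t : ℝ) (Z : ℝ → L2Z →L[ℝ] L2Z) (ω : ℝ → L2Z) : L2Z :=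
  ∑' j : ℤ, integralCoord α s t Z ω j • basisVec j

/-- The fractional integral is well defined: all scalar integrals are, and both series converge. -/
structure FracIntegrable (α s t : ℝ) (Z : ℝ → L2Z →L[ℝ] L2Z) (ω : ℝ → L2Z) : Prop where
  scalar : ∀ i j : ℤ, ScalarIntegrable α s t (fun r => Z r (basisVec i) j) (fun r => ω r i)
  inner_summable : ∀ j : ℤ, Summable fun i : ℤ =>
    scalarIntegral α s t (fun r => Z r (basisVec i) j) (fun r => ω r i)
  outer_summable : Summable fun j : ℤ => integralCoord α s t Z ω j • basisVec j

/-! ### Hölder paths and fractional Brownian motion -/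

/-- `u` restricts to an element of the Hölder space of exponent `β` on `[a, b]`. -/
def IsHolderOn (β : ℝ≥0) (a b : ℝ) (u : ℝ → L2Z) : Prop :=
  ∃ C : ℝ≥0, HolderOnWith C β u (Icc a b)

/-- The paths that vanish at zero and are Hölder continuous of exponent `β` on every compact
interval. -/
def holderPaths (β : ℝ≥0) : Set (ℝ → L2Z) :=
  {ω | ω 0 = 0 ∧ ∀ a b : ℝ, IsHolderOn β a b ω}

/-- `B` is a continuous fractional Brownian motion in the space of square summable sequences, with
Hurst parameter `H` and diagonal covariance operator `Q e_i = σ_i^2 e_i`: its coordinates are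
independent centered Gaussian processes, the `i`-th one distributed as `σ_i` times a real two-sided
fractional Brownian motion. -/
structure IsFBM {Ω : Type*} [MeasurableSpace Ω] (H : ℝ) (σ : L2Z) (B : ℝ → Ω → L2Z)
    (P : Measure Ω) : Prop where
  measurable : ∀ t i, Measurable fun w => B t w i
  gaussian : ∀ i, IsGaussianProcess (fun t w => B t w i) P
  centered : ∀ t i, ∫ w, B t w i ∂P = 0
  covariance : ∀ s t i, cov[fun w => B s w i, fun w => B t w i; P] =
    σ i ^ 2 * ((|s| ^ (2 * H) + |t| ^ (2 * H) - |t - s| ^ (2 * H)) / 2)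
  indep : iIndepFun (fun (i : ℤ) (w : Ω) (t : ℝ) => B t w i) P
  continuous : ∀ w, Continuous fun t => B t w
  zero : ∀ w, B 0 w = 0

/-! ### Mild solutions -/

/-- The integrand of the drift integral at time `t`. -/
def driftIntegrand (ν lam : ℝ) {f : ℤ → ℝ → ℝ} (hf : DriftAssumption f) (u : ℝ → L2Z)
    (t r : ℝ) : L2Z :=
  semigroup ν lam (t - r) (superposition hf (u r))

/-- The operator valued integrand of the noise integral at time `t`. -/
def noiseIntegrand (ν lam : ℝ) {h : ℤ → ℝ → ℝ} (hh : DiffusionAssumption h) (u : ℝ → L2Z)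
    (t r : ℝ) : L2Z →L[ℝ] L2Z :=
  (semigroup ν lam (t - r)).comp (diffusionOp hh (u r))

/-- The two integrals in the mild equation are well defined for `u` at every time in `[0, T]`. -/
def MildIntegrable (ν lam α T : ℝ) {f h : ℤ → ℝ → ℝ} (hf : DriftAssumption f)
    (hh : DiffusionAssumption h) (ω u : ℝ → L2Z) : Prop :=
  ∀ t ∈ Icc 0 T, IntervalIntegrable (driftIntegrand ν lam hf u t) volume 0 t ∧
    FracIntegrable α 0 t (noiseIntegrand ν lam hh u t) ω

/-- The mild equation for `u` on `[0, T]` with initial value `x` and driving path `ω`. -/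
def MildEquation (ν lam α T : ℝ) {f h : ℤ → ℝ → ℝ} (hf : DriftAssumption f)
    (hh : DiffusionAssumption h) (ω : ℝ → L2Z) (x : L2Z) (u : ℝ → L2Z) : Prop :=
  ∀ t ∈ Icc 0 T, u t = semigroup ν lam t x + (∫ r in (0 : ℝ)..t, driftIntegrand ν lam hf u t r)
    + fracIntegral α 0 t (noiseIntegrand ν lam hh u t) ω

end LatticeSDE

end

noncomputable section

namespace LatticeSDE

variable {E F : Type*} [NormedAddCommGroup E] [NormedSpace ℝ E]
  [NormedAddCommGroup F] [NormedSpace ℝ F]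

/-! ### Interval integrals of power functions -/

/-! The two claims have separate proofs; write `γ` for the exponent `β'` of the driving path.

Mild equation. The coordinatewise integral is identified with one Bochner integral, `vecIntegral`,
of the operator valued left derivative applied to the vector valued right derivative. The double
series converges because flipping signs of coordinates preserves the norm of a vector, so the
absolute row sums of `A` against `v` are at most `‖A‖ ‖v‖` (`sum_abs_entry_mul_le`,
`hasSum_scalarIntegral`). Since `A_lam` is bounded, its semigroup is a group, Lipschitz on compact
intervals; thus `S(t - r) = S(t) S(-r)`, and `S(t)` comes out of both integrals, leaving integrands
that do not depend on `t`.

The main estimate is `norm_vecIntegral_sub_le`: in the `β`-Hölder norm weighted by `exp (ρ t)`, the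
fractional integral gains a factor `ρ ^ (-(γ - β))`. The surplus regularity `γ - β` of the path pays
for it, through `exp (-x) ≤ x ^ (-δ)`. The nonlinearities grow at most linearly in the weighted
norm, so a first weight `ρ₀` gives an invariant ball (`exists_weightedHolder_mildMap`). Differences
of diffusion coefficients need a second order bound, whose constant grows with the unweighted radius
(`weightedHolder_superposition_sub`); hence the contraction is obtained on that ball only, with a
second, larger weight (`exists_weightedHolder_mildMap_sub`). Picard iteration gives existence, and
the same contraction on a ball containing two given solutions gives uniqueness.

Path regularity. This is the Kolmogorov–Chentsov argument. Gaussian moments in each coordinate and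
Minkowski's inequality for the sum of squares bound the moment of order `2p` of an increment by a
multiple of `|t - s| ^ (2pH)` (`IsFBM.lintegral_enorm_sub_le`). For `p = 1 / (H - γ)` the weighted
sum of all dyadic increments has finite expectation, and chaining (`exists_holder_of_dyadic`) turns
its almost sure finiteness into Hölder continuity. -/

theorem intervalIntegrable_of_norm_le_Ioo {G : Type*} [NormedAddCommGroup G] {f : ℝ → G}
    {g : ℝ → ℝ} {a b : ℝ} (hab : a ≤ b) (hf : AEStronglyMeasurable f (volume.restrict (Ioo a b)))
    (hg : IntervalIntegrable g volume a b) (h : ∀ x ∈ Ioo a b, ‖f x‖ ≤ g x) :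
    IntervalIntegrable f volume a b := by
  rw [intervalIntegrable_iff_integrableOn_Ioo_of_le hab] at hg ⊢
  exact Integrable.mono' hg hf ((ae_restrict_iff' measurableSet_Ioo).2 (.of_forall h))

/-- Domination is asked on the open interval only: at the end points the kernels contain negative
powers of zero, which have junk values. -/
theorem norm_integral_le_of_norm_le_Ioo {f : ℝ → E} {g : ℝ → ℝ} {a b : ℝ} (hab : a ≤ b)
    (hg : IntervalIntegrable g volume a b) (h : ∀ x ∈ Ioo a b, ‖f x‖ ≤ g x) :
    ‖∫ x in a..b, f x‖ ≤ ∫ x in a..b, g x := by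
  rw [intervalIntegral.integral_of_le hab, intervalIntegral.integral_of_le hab,
    integral_Ioc_eq_integral_Ioo, integral_Ioc_eq_integral_Ioo]
  rw [intervalIntegrable_iff_integrableOn_Ioo_of_le hab] at hg
  exact norm_integral_le_of_norm_le hg ((ae_restrict_iff' measurableSet_Ioo).2 (.of_forall h))

theorem intervalIntegral_congr_Ioo {f g : ℝ → E} {a b : ℝ} (hab : a ≤ b)
    (h : ∀ x ∈ Ioo a b, f x = g x) : ∫ x in a..b, f x = ∫ x in a..b, g x := by
  rw [intervalIntegral.integral_of_le hab, intervalIntegral.integral_of_le hab,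
    integral_Ioc_eq_integral_Ioo, integral_Ioc_eq_integral_Ioo]
  exact setIntegral_congr_fun measurableSet_Ioo h

theorem intervalIntegrable_rpow_sub_left {p : ℝ} (hp : -1 < p) (a c d : ℝ) :
    IntervalIntegrable (fun q : ℝ => (q - a) ^ p) volume c d := by
  have := (intervalIntegral.intervalIntegrable_rpow' (a := c - a) (b := d - a) hp).comp_sub_right a
  simpa using this

theorem intervalIntegrable_rpow_sub_right {p : ℝ} (hp : -1 < p) (b c d : ℝ) :
    IntervalIntegrable (fun q : ℝ => (b - q) ^ p) volume c d := by
  have := (intervalIntegral.intervalIntegrable_rpow' (a := b - c) (b := b - d) hp).comp_sub_left b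
  simpa using this

theorem integral_rpow_sub_left {p : ℝ} (hp : -1 < p) (a b : ℝ) :
    ∫ q in a..b, (q - a) ^ p = (b - a) ^ (p + 1) / (p + 1) := by
  rw [intervalIntegral.integral_comp_sub_right (fun x => x ^ p) a, integral_rpow (Or.inl hp),
    sub_self, Real.zero_rpow (by linarith), sub_zero]

theorem integral_rpow_sub_right {p : ℝ} (hp : -1 < p) (a b : ℝ) :
    ∫ q in a..b, (b - q) ^ p = (b - a) ^ (p + 1) / (p + 1) := by
  rw [intervalIntegral.integral_comp_sub_left (fun x => x ^ p) b, integral_rpow (Or.inl hp),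
    sub_self, Real.zero_rpow (by linarith), sub_zero]

/-- The constant bounding the beta type integral `∫ (r - s)^(-α) (t - r)^(α - 1)`. -/
def betaBound (α : ℝ) : ℝ :=
  (2 : ℝ) ^ (1 - α) / (1 - α) + (2 : ℝ) ^ α / α

theorem betaBound_nonneg {α : ℝ} (h0 : 0 < α) (h1 : α < 1) : 0 ≤ betaBound α := by
  have : 0 < 1 - α := by linarith
  unfold betaBound; positivity

/-- Every point of the interval is at distance at least half the length from one of the two
singularities, so one of the factors can be frozen there. -/
theorem beta_integrand_le {α s t r : ℝ} (h0 : 0 < α) (h1 : α < 1) (hr : r ∈ Ioo s t) :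
    (r - s) ^ (-α) * (t - r) ^ (α - 1) ≤
      ((t - s) / 2) ^ (α - 1) * (r - s) ^ (-α) + ((t - s) / 2) ^ (-α) * (t - r) ^ (α - 1) := by
  have hs : 0 < r - s := sub_pos.2 hr.1
  have ht : 0 < t - r := sub_pos.2 hr.2
  have hm : 0 < (t - s) / 2 := by linarith
  have p1 := Real.rpow_nonneg hs.le (-α)
  have p2 := Real.rpow_nonneg ht.le (α - 1)
  have p3 := Real.rpow_nonneg hm.le (-α)
  have p4 := Real.rpow_nonneg hm.le (α - 1)
  rcases le_total (r - s) (t - r) with h | h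
  · have : (t - r) ^ (α - 1) ≤ ((t - s) / 2) ^ (α - 1) :=
      Real.rpow_le_rpow_of_nonpos hm (by linarith) (by linarith)
    nlinarith [mul_le_mul_of_nonneg_left this p1, mul_nonneg p3 p2]
  · have : (r - s) ^ (-α) ≤ ((t - s) / 2) ^ (-α) :=
      Real.rpow_le_rpow_of_nonpos hm (by linarith) (by linarith)
    nlinarith [mul_le_mul_of_nonneg_right this p2, mul_nonneg p4 p1]

theorem intervalIntegrable_beta {α : ℝ} (h0 : 0 < α) (h1 : α < 1) {s t : ℝ} (hst : s ≤ t) :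
    IntervalIntegrable (fun r => (r - s) ^ (-α) * (t - r) ^ (α - 1)) volume s t := by
  refine intervalIntegrable_of_norm_le_Ioo hst ?_
    (((intervalIntegrable_rpow_sub_left (p := -α) (by linarith) s s t).const_mul
      (((t - s) / 2) ^ (α - 1))).add
      ((intervalIntegrable_rpow_sub_right (p := α - 1) (by linarith) t s t).const_mul
        (((t - s) / 2) ^ (-α)))) (fun r hr => ?_)
  · exact (Measurable.aestronglyMeasurable (by fun_prop))
  · have hs : 0 < r - s := sub_pos.2 hr.1
    have ht : 0 < t - r := sub_pos.2 hr.2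
    rw [Real.norm_of_nonneg (by positivity)]
    exact beta_integrand_le h0 h1 hr

/-- The exponents `-α` and `α - 1` add up to `-1`, so all powers of `t - s` cancel and the bound is
uniform over intervals. -/
theorem integral_beta_le {α : ℝ} (h0 : 0 < α) (h1 : α < 1) {s t : ℝ} (hst : s ≤ t) :
    ∫ r in s..t, (r - s) ^ (-α) * (t - r) ^ (α - 1) ≤ betaBound α := by
  rcases hst.eq_or_lt with rfl | hlt
  · simpa using betaBound_nonneg h0 h1
  have i1 := (intervalIntegrable_rpow_sub_left (p := -α) (by linarith) s s t).const_mul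
    (((t - s) / 2) ^ (α - 1))
  have i2 := (intervalIntegrable_rpow_sub_right (p := α - 1) (by linarith) t s t).const_mul
    (((t - s) / 2) ^ (-α))
  have h := norm_integral_le_of_norm_le_Ioo (f := fun r => (r - s) ^ (-α) * (t - r) ^ (α - 1))
    hst (i1.add i2) (fun r hr => by
      have hs : 0 < r - s := sub_pos.2 hr.1
      have ht : 0 < t - r := sub_pos.2 hr.2
      rw [Real.norm_of_nonneg (by positivity)]
      exact beta_integrand_le h0 h1 hr)
  refine (le_abs_self _).trans (h.trans (le_of_eq ?_))
  have hp : 0 < t - s := sub_pos.2 hlt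
  rw [intervalIntegral.integral_add i1 i2, intervalIntegral.integral_const_mul,
    intervalIntegral.integral_const_mul, integral_rpow_sub_left (by linarith),
    integral_rpow_sub_right (by linarith), betaBound, Real.div_rpow hp.le (by norm_num),
    Real.div_rpow hp.le (by norm_num)]
  have e1 : (t - s) ^ (α - 1) * (t - s) ^ (-α + 1) = 1 := by
    rw [← Real.rpow_add hp]; ring_nf; exact Real.rpow_zero _
  have e2 : (t - s) ^ (-α) * (t - s) ^ (α - 1 + 1) = 1 := by
    rw [← Real.rpow_add hp]; ring_nf; exact Real.rpow_zero _
  have e3 : (2 : ℝ) ^ (1 - α) = ((2 : ℝ) ^ (α - 1))⁻¹ := by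
    rw [← Real.rpow_neg (by norm_num)]; ring_nf
  have e4 : (2 : ℝ) ^ α = ((2 : ℝ) ^ (-α))⁻¹ := by
    rw [← Real.rpow_neg (by norm_num)]; ring_nf
  have e5 : -α + 1 = 1 - α := by ring
  have e6 : α - 1 + 1 = α := by ring
  rw [e3, e4]
  rw [e5] at e1 ⊢
  rw [e6] at e2 ⊢
  calc _ = ((t - s) ^ (α - 1) * (t - s) ^ (1 - α)) * ((2 : ℝ) ^ (α - 1))⁻¹ / (1 - α)
        + ((t - s) ^ (-α) * (t - s) ^ α) * ((2 : ℝ) ^ (-α))⁻¹ / α := by ring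
    _ = _ := by rw [e1, e2]; ring

/-! ### Vector valued fractional derivatives -/

/-- The left-sided fractional derivative of order `α` on the interval starting at zero. -/
def fracDerivLeft (α : ℝ) (Z : ℝ → E) (r : ℝ) : E :=
  (1 / Real.Gamma (1 - α)) •
    ((r ^ α)⁻¹ • Z r + α • ∫ q in (0 : ℝ)..r, ((r - q) ^ (1 + α))⁻¹ • (Z r - Z q))

/-- The right-sided fractional derivative of order `1 - α` of `ω - ω t` on the interval ending
at `t`. -/
def fracDerivRight (α t : ℝ) (ω : ℝ → E) (r : ℝ) : E :=
  (1 / Real.Gamma α) • (((t - r) ^ (1 - α))⁻¹ • (ω r - ω t)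
    + (1 - α) • ∫ q in r..t, ((q - r) ^ (2 - α))⁻¹ • (ω r - ω q))

/-- The fractional integral over `[0, t]` of an operator valued function against a vector valued
one. -/
def vecIntegral (α : ℝ) (Z : ℝ → E →L[ℝ] F) (ω : ℝ → E) (t : ℝ) : F :=
  -∫ r in (0 : ℝ)..t, fracDerivLeft α Z r (fracDerivRight α t ω r)

/-- Extending `Z` beyond `[0, T]` by its end values makes the integrand strongly measurable on the
triangle `0 < q ≤ r` of the plane, and integrating out one variable preserves strong measurability.
-/
theorem aestronglyMeasurable_integral_left {Z : ℝ → E} {T : ℝ} (k : ℝ → ℝ) (hk : Measurable k)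
    (hZ : ContinuousOn Z (Icc 0 T)) (hT : 0 ≤ T) :
    AEStronglyMeasurable (fun r => ∫ q in (0 : ℝ)..r, k (r - q) • (Z r - Z q))
      (volume.restrict (Ioo 0 T)) := by
  let Y : ℝ → E := fun r => Z (projIcc 0 T hT r)
  have hY : Continuous Y := hZ.comp_continuous
    (continuous_subtype_val.comp continuous_projIcc) (fun r => (projIcc 0 T hT r).2)
  have hYZ : ∀ r ∈ Icc 0 T, Y r = Z r := fun r hr => by
    simp only [Y, projIcc_of_mem hT hr]
  let G : ℝ × ℝ → E := {p : ℝ × ℝ | 0 < p.2 ∧ p.2 ≤ p.1}.indicator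
    (fun p => k (p.1 - p.2) • (Y p.1 - Y p.2))
  have hG : StronglyMeasurable G := by
    refine StronglyMeasurable.indicator ?_ ?_
    · refine (Measurable.stronglyMeasurable (by fun_prop)).smul ?_
      exact ((hY.comp continuous_fst).sub (hY.comp continuous_snd)).stronglyMeasurable
    · exact (measurableSet_lt measurable_const measurable_snd).inter
        (measurableSet_le measurable_snd measurable_fst)
  have h := hG.integral_prod_right' (ν := (volume : Measure ℝ))
  refine ⟨_, h, (ae_restrict_iff' measurableSet_Ioo).2 (.of_forall fun r hr => ?_)⟩
  beta_reduce
  rw [intervalIntegral.integral_of_le hr.1.le, ← integral_indicator measurableSet_Ioc]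
  congr 1
  ext q
  by_cases hq : q ∈ Ioc 0 r
  · have hq' : (r, q) ∈ {p : ℝ × ℝ | 0 < p.2 ∧ p.2 ≤ p.1} := hq
    simp only [G, indicator_of_mem hq, indicator_of_mem hq']
    rw [hYZ r ⟨hr.1.le, hr.2.le⟩, hYZ q ⟨hq.1.le, hq.2.trans hr.2.le⟩]
  · have hq' : (r, q) ∉ {p : ℝ × ℝ | 0 < p.2 ∧ p.2 ≤ p.1} := hq
    simp only [G, indicator_of_notMem hq, indicator_of_notMem hq']

theorem aestronglyMeasurable_integral_right {ω : ℝ → E} {t : ℝ} (k : ℝ → ℝ) (hk : Measurable k)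
    (hω : ContinuousOn ω (Icc 0 t)) (hT : 0 ≤ t) :
    AEStronglyMeasurable (fun r => ∫ q in r..t, k (q - r) • (ω r - ω q))
      (volume.restrict (Ioo 0 t)) := by
  let Y : ℝ → E := fun r => ω (projIcc 0 t hT r)
  have hY : Continuous Y := hω.comp_continuous
    (continuous_subtype_val.comp continuous_projIcc) (fun r => (projIcc 0 t hT r).2)
  have hYZ : ∀ r ∈ Icc 0 t, Y r = ω r := fun r hr => by
    simp only [Y, projIcc_of_mem hT hr]
  let G : ℝ × ℝ → E := {p : ℝ × ℝ | p.1 < p.2 ∧ p.2 ≤ t}.indicator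
    (fun p => k (p.2 - p.1) • (Y p.1 - Y p.2))
  have hG : StronglyMeasurable G := by
    refine StronglyMeasurable.indicator ?_ ?_
    · refine (Measurable.stronglyMeasurable (by fun_prop)).smul ?_
      exact ((hY.comp continuous_fst).sub (hY.comp continuous_snd)).stronglyMeasurable
    · exact (measurableSet_lt measurable_fst measurable_snd).inter
        (measurableSet_le measurable_snd measurable_const)
  have h := hG.integral_prod_right' (ν := (volume : Measure ℝ))
  refine ⟨_, h, (ae_restrict_iff' measurableSet_Ioo).2 (.of_forall fun r hr => ?_)⟩
  beta_reduce
  rw [intervalIntegral.integral_of_le hr.2.le, ← integral_indicator measurableSet_Ioc]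
  congr 1
  ext q
  by_cases hq : q ∈ Ioc r t
  · have hq' : (r, q) ∈ {p : ℝ × ℝ | p.1 < p.2 ∧ p.2 ≤ t} := hq
    simp only [G, indicator_of_mem hq, indicator_of_mem hq']
    rw [hYZ r ⟨hr.1.le, hr.2.le⟩, hYZ q ⟨(hr.1.trans hq.1).le, hq.2⟩]
  · have hq' : (r, q) ∉ {p : ℝ × ℝ | p.1 < p.2 ∧ p.2 ≤ t} := hq
    simp only [G, indicator_of_notMem hq, indicator_of_notMem hq']

theorem aestronglyMeasurable_fracDerivLeft {Z : ℝ → E} {α T : ℝ}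
    (hZ : ContinuousOn Z (Icc 0 T)) (hT : 0 ≤ T) :
    AEStronglyMeasurable (fracDerivLeft α Z) (volume.restrict (Ioo 0 T)) := by
  refine AEStronglyMeasurable.const_smul (AEStronglyMeasurable.add ?_ ?_) _
  · exact (Measurable.aestronglyMeasurable (by fun_prop)).smul
      ((hZ.mono Ioo_subset_Icc_self).aestronglyMeasurable measurableSet_Ioo)
  · exact (aestronglyMeasurable_integral_left (fun x => (x ^ (1 + α))⁻¹) (by fun_prop)
      hZ hT).const_smul _

theorem aestronglyMeasurable_fracDerivRight {ω : ℝ → E} {α t : ℝ}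
    (hω : ContinuousOn ω (Icc 0 t)) (ht : 0 ≤ t) :
    AEStronglyMeasurable (fracDerivRight α t ω) (volume.restrict (Ioo 0 t)) := by
  refine AEStronglyMeasurable.const_smul (AEStronglyMeasurable.add ?_ ?_) _
  · exact (Measurable.aestronglyMeasurable (by fun_prop)).smul
      (((hω.mono Ioo_subset_Icc_self).sub continuousOn_const).aestronglyMeasurable
        measurableSet_Ioo)
  · exact (aestronglyMeasurable_integral_right (fun x => (x ^ (2 - α))⁻¹) (by fun_prop)
      hω ht).const_smul _

/-! ### Hölder bounds -/

/-- The increments of `v` on `[0, T]` are bounded by `W` times the `γ`-th power of the length. -/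
def HolderBound {G : Type*} [NormedAddCommGroup G] (γ T W : ℝ) (v : ℝ → G) : Prop :=
  ∀ s t, 0 ≤ s → s ≤ t → t ≤ T → ‖v t - v s‖ ≤ W * (t - s) ^ γ

theorem HolderBound.mono_right {G : Type*} [NormedAddCommGroup G] {γ T T' W : ℝ} {v : ℝ → G}
    (h : HolderBound γ T W v) (hT : T' ≤ T) : HolderBound γ T' W v :=
  fun s t h0 hst ht => h s t h0 hst (ht.trans hT)

theorem HolderBound.continuousOn {G : Type*} [NormedAddCommGroup G] {γ T W : ℝ} {v : ℝ → G}
    (h : HolderBound γ T W v) (hγ : 0 < γ) : ContinuousOn v (Icc 0 T) := by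
  intro s hs
  rw [ContinuousWithinAt, tendsto_iff_norm_sub_tendsto_zero]
  have hlim : Filter.Tendsto (fun t => W * |t - s| ^ γ) (nhdsWithin s (Icc 0 T)) (nhds 0) := by
    have hc : Continuous fun t : ℝ => W * |t - s| ^ γ :=
      continuous_const.mul ((continuous_id.sub continuous_const).abs.rpow_const
        fun _ => Or.inr hγ.le)
    have := (hc.tendsto s).mono_left (nhdsWithin_le_nhds (s := Icc 0 T))
    simpa [Real.zero_rpow hγ.ne'] using this
  refine squeeze_zero' (.of_forall fun _ => norm_nonneg _) ?_ hlim
  filter_upwards [self_mem_nhdsWithin] with t ht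
  rcases le_total s t with hst | hst
  · rw [abs_of_nonneg (sub_nonneg.2 hst)]
    exact h s t hs.1 hst ht.2
  · rw [norm_sub_rev, abs_of_nonpos (sub_nonpos.2 hst), neg_sub]
    exact h t s ht.1 hst hs.2

/-- Bounds with exponential weight `exp (ρ t)` for the supremum and the Hölder seminorm of
exponent `β` on `[0, T]`. -/
structure WeightedHolder {G : Type*} [NormedAddCommGroup G] (β T ρ K : ℝ) (v : ℝ → G) :
    Prop where
  bound : ∀ t, 0 ≤ t → t ≤ T → ‖v t‖ ≤ K * Real.exp (ρ * t)
  holder : ∀ s t, 0 ≤ s → s ≤ t → t ≤ T → ‖v t - v s‖ ≤ K * Real.exp (ρ * t) * (t - s) ^ β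

section WeightedHolder

variable {G : Type*} [NormedAddCommGroup G] {β T ρ K : ℝ} {v w : ℝ → G}

theorem WeightedHolder.nonneg (h : WeightedHolder β T ρ K v) (hT : 0 ≤ T) : 0 ≤ K := by
  have := (norm_nonneg _).trans (h.bound 0 le_rfl hT)
  simpa using this

theorem WeightedHolder.mono {K' : ℝ} (h : WeightedHolder β T ρ K v) (hK : K ≤ K') :
    WeightedHolder β T ρ K' v where
  bound t h0 hT := (h.bound t h0 hT).trans (by gcongr)
  holder s t h0 hst hT := (h.holder s t h0 hst hT).trans (by
    have := sub_nonneg.2 hst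
    gcongr)

theorem WeightedHolder.mono_weight {ρ' : ℝ} (h : WeightedHolder β T ρ K v) (hT : 0 ≤ T)
    (hρ : ρ ≤ ρ') : WeightedHolder β T ρ' K v where
  bound t h0 hT' := (h.bound t h0 hT').trans (by
    have := h.nonneg hT
    gcongr)
  holder s t h0 hst hT' := (h.holder s t h0 hst hT').trans (by
    have := h.nonneg hT
    have := sub_nonneg.2 hst
    have := h0.trans hst
    gcongr)

theorem WeightedHolder.holderBound (h : WeightedHolder β T ρ K v) (hT : 0 ≤ T) (hρ : 0 ≤ ρ) :
    HolderBound β T (K * Real.exp (ρ * T)) v := fun s t h0 hst ht =>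
  (h.holder s t h0 hst ht).trans (by
    have := h.nonneg hT
    have := sub_nonneg.2 hst
    gcongr)

/-- Converts the radius of a weighted ball into a weight-free one, so that a second weight can be
chosen afterwards. -/
theorem WeightedHolder.unweight (h : WeightedHolder β T ρ K v) (hT : 0 ≤ T) (hρ : 0 ≤ ρ) :
    WeightedHolder β T 0 (K * Real.exp (ρ * T)) v where
  bound t h0 ht := by
    rw [zero_mul, Real.exp_zero, mul_one]
    exact (h.bound t h0 ht).trans (by
      have := h.nonneg hT
      gcongr)
  holder s t h0 hst ht := by
    rw [zero_mul, Real.exp_zero, mul_one]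
    exact h.holderBound hT hρ s t h0 hst ht

theorem WeightedHolder.continuousOn (h : WeightedHolder β T ρ K v) (hT : 0 ≤ T) (hρ : 0 ≤ ρ)
    (hβ : 0 < β) : ContinuousOn v (Icc 0 T) :=
  (h.holderBound hT hρ).continuousOn hβ

theorem WeightedHolder.add {K' : ℝ} (h : WeightedHolder β T ρ K v)
    (h' : WeightedHolder β T ρ K' w) : WeightedHolder β T ρ (K + K') (fun t => v t + w t) where
  bound t h0 ht := (norm_add_le _ _).trans (by
    rw [add_mul]; exact add_le_add (h.bound t h0 ht) (h'.bound t h0 ht))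
  holder s t h0 hst ht := by
    rw [add_sub_add_comm]
    refine (norm_add_le _ _).trans ?_
    rw [add_mul, add_mul]
    exact add_le_add (h.holder s t h0 hst ht) (h'.holder s t h0 hst ht)

theorem WeightedHolder.congr (h : WeightedHolder β T ρ K v) (hvw : EqOn w v (Icc 0 T)) :
    WeightedHolder β T ρ K w where
  bound t h0 ht := by rw [hvw ⟨h0, ht⟩]; exact h.bound t h0 ht
  holder s t h0 hst ht := by
    rw [hvw ⟨h0, hst.trans ht⟩, hvw ⟨h0.trans hst, ht⟩]; exact h.holder s t h0 hst ht

/-- For a function vanishing at zero the supremum is controlled by the increments from zero, at the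
price of a factor `T ^ β`. -/
theorem weightedHolder_of_holder_of_zero (h0 : v 0 = 0) (hβ : 0 ≤ β) (hK : 0 ≤ K)
    (h : ∀ s t, 0 ≤ s → s ≤ t → t ≤ T → ‖v t - v s‖ ≤ K * Real.exp (ρ * t) * (t - s) ^ β) :
    WeightedHolder β T ρ (K * (1 + T ^ β)) v where
  bound t ht hT := by
    have h1 := h 0 t le_rfl ht hT
    rw [h0, sub_zero, sub_zero] at h1
    refine h1.trans ?_
    have : t ^ β ≤ T ^ β := Real.rpow_le_rpow ht hT hβ
    have h3 : 0 ≤ K * Real.exp (ρ * t) := by positivity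
    nlinarith
  holder s t hs hst hT := by
    have h1 := h s t hs hst hT
    refine h1.trans ?_
    have h3 : 0 ≤ K * Real.exp (ρ * t) := by positivity
    have h4 : 0 ≤ T ^ β := Real.rpow_nonneg (hs.trans (hst.trans hT)) _
    have h5 : 0 ≤ (t - s) ^ β := Real.rpow_nonneg (sub_nonneg.2 hst) _
    have := mul_nonneg (mul_nonneg h3 h4) h5
    nlinarith

end WeightedHolder

/-! ### Bounds for the fractional derivatives -/

/-- The constant in the bound for the left-sided fractional derivative. -/
def leftBound (α β T : ℝ) : ℝ := 1 / Real.Gamma (1 - α) * (1 + α * (T ^ β / (β - α)))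

theorem leftBound_nonneg {α β T : ℝ} (h0 : 0 < α) (h1 : α < 1) (hαβ : α < β) (hT : 0 ≤ T) :
    0 ≤ leftBound α β T := by
  have := Real.Gamma_pos_of_pos (sub_pos.2 h1)
  have := sub_pos.2 hαβ
  unfold leftBound
  positivity

theorem norm_left_kernel_le {Z : ℝ → E} {α β M r q : ℝ} (hq : q < r)
    (h : ‖Z r - Z q‖ ≤ M * (r - q) ^ β) :
    ‖((r - q) ^ (1 + α))⁻¹ • (Z r - Z q)‖ ≤ M * (r - q) ^ (β - (1 + α)) := by
  have hp : 0 < r - q := sub_pos.2 hq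
  rw [norm_smul, norm_inv, Real.norm_of_nonneg (by positivity), Real.rpow_sub hp, inv_mul_eq_div,
    ← mul_div_assoc]
  gcongr

theorem intervalIntegrable_left {Z : ℝ → E} {α β M r : ℝ} (hαβ : α < β) (hr : 0 ≤ r)
    (hZ : ContinuousOn Z (Icc 0 r))
    (h : ∀ q, 0 ≤ q → q ≤ r → ‖Z r - Z q‖ ≤ M * (r - q) ^ β) :
    IntervalIntegrable (fun q => ((r - q) ^ (1 + α))⁻¹ • (Z r - Z q)) volume 0 r := by
  refine intervalIntegrable_of_norm_le_Ioo hr ?_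
    ((intervalIntegrable_rpow_sub_right (p := β - (1 + α)) (by linarith) r 0 r).const_mul M)
    (fun q hq => norm_left_kernel_le hq.2 (h q hq.1.le hq.2.le))
  exact (Measurable.aestronglyMeasurable (by fun_prop)).smul
    ((continuousOn_const.sub (hZ.mono Ioo_subset_Icc_self)).aestronglyMeasurable
      measurableSet_Ioo)

/-- The weight in `WeightedHolder` sits at the right end point of an increment, so `exp (ρ r)`
factors out of the whole derivative. The remaining kernel has exponent `β - 1 - α > -1`, and its
integral is of order `r ^ (β - α) ≤ r ^ (-α) T ^ β`. -/
theorem norm_fracDerivLeft_le {Z : ℝ → E} {α β T ρ K r : ℝ} (h0 : 0 < α) (h1 : α < 1)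
    (hαβ : α < β) (hr : 0 < r) (hrT : r ≤ T) (hZ : WeightedHolder β T ρ K Z) :
    ‖fracDerivLeft α Z r‖ ≤ leftBound α β T * K * Real.exp (ρ * r) * r ^ (-α) := by
  have hΓ := Real.Gamma_pos_of_pos (sub_pos.2 h1)
  have hβα := sub_pos.2 hαβ
  have hT : 0 < T := hr.trans_le hrT
  have hK := hZ.nonneg hT.le
  have hint : ‖∫ q in (0 : ℝ)..r, ((r - q) ^ (1 + α))⁻¹ • (Z r - Z q)‖ ≤
      K * Real.exp (ρ * r) * (r ^ (-α) * T ^ β / (β - α)) := by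
    refine (norm_integral_le_of_norm_le_Ioo hr.le
      ((intervalIntegrable_rpow_sub_right (p := β - (1 + α)) (by linarith) r 0 r).const_mul
        (K * Real.exp (ρ * r)))
      (fun q hq => norm_left_kernel_le hq.2 (hZ.holder q r hq.1.le hq.2.le hrT))).trans ?_
    rw [intervalIntegral.integral_const_mul, integral_rpow_sub_right (by linarith), sub_zero]
    have e : β - (1 + α) + 1 = -α + β := by ring
    rw [e, Real.rpow_add hr]
    have e' : -α + β = β - α := by ring
    rw [e']
    gcongr
    linarith
  have hb : ‖(r ^ α)⁻¹ • Z r‖ ≤ K * Real.exp (ρ * r) * r ^ (-α) := by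
    rw [norm_smul, norm_inv, Real.norm_of_nonneg (by positivity), Real.rpow_neg hr.le, mul_comm]
    exact mul_le_mul_of_nonneg_right (hZ.bound r hr.le hrT) (by positivity)
  rw [fracDerivLeft, norm_smul, Real.norm_of_nonneg (by positivity)]
  calc _ ≤ 1 / Real.Gamma (1 - α) * (K * Real.exp (ρ * r) * r ^ (-α)
        + α * (K * Real.exp (ρ * r) * (r ^ (-α) * T ^ β / (β - α)))) := by
        gcongr
        refine (norm_add_le _ _).trans (add_le_add hb ?_)
        rw [norm_smul, Real.norm_of_nonneg h0.le]
        gcongr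
    _ = _ := by unfold leftBound; ring

/-- The constant in the bound for the right-sided fractional derivative. -/
def rightBound (α γ : ℝ) : ℝ := 1 / Real.Gamma α * (1 + (1 - α) * (1 / (γ + α - 1)))

theorem rightBound_nonneg {α γ : ℝ} (h0 : 0 < α) (h1 : α < 1) (hγ : 1 - α < γ) :
    0 ≤ rightBound α γ := by
  have := Real.Gamma_pos_of_pos h0
  have := sub_pos.2 h1
  have : 0 < γ + α - 1 := by linarith
  unfold rightBound
  positivity

theorem norm_right_kernel_le {ω : ℝ → E} {α γ W r q : ℝ} (hq : r < q)
    (h : ‖ω q - ω r‖ ≤ W * (q - r) ^ γ) :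
    ‖((q - r) ^ (2 - α))⁻¹ • (ω r - ω q)‖ ≤ W * (q - r) ^ (γ - (2 - α)) := by
  have hp : 0 < q - r := sub_pos.2 hq
  rw [norm_smul, norm_inv, Real.norm_of_nonneg (by positivity), Real.rpow_sub hp γ,
    inv_mul_eq_div, ← mul_div_assoc, norm_sub_rev]
  gcongr

theorem intervalIntegrable_right {ω : ℝ → E} {α γ W r t : ℝ} (hγ : 1 - α < γ) (hr : r ≤ t)
    (hω : ContinuousOn ω (Icc r t))
    (h : ∀ q, r ≤ q → q ≤ t → ‖ω q - ω r‖ ≤ W * (q - r) ^ γ) :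
    IntervalIntegrable (fun q => ((q - r) ^ (2 - α))⁻¹ • (ω r - ω q)) volume r t := by
  refine intervalIntegrable_of_norm_le_Ioo hr ?_
    ((intervalIntegrable_rpow_sub_left (p := γ - (2 - α)) (by linarith) r r t).const_mul W)
    (fun q hq => norm_right_kernel_le hq.1 (h q hq.1.le hq.2.le))
  exact (Measurable.aestronglyMeasurable (by fun_prop)).smul
    ((continuousOn_const.sub (hω.mono Ioo_subset_Icc_self)).aestronglyMeasurable
      measurableSet_Ioo)

/-- The kernel exponent `γ - (2 - α)` exceeds `-1` exactly when `1 - α < γ`; the boundary term and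
the integral then scale alike. -/
theorem norm_fracDerivRight_le {ω : ℝ → E} {α γ W T r t : ℝ} (h0 : 0 < α) (h1 : α < 1)
    (hγ : 1 - α < γ) (hr : 0 ≤ r) (hrt : r < t) (ht : t ≤ T) (hω : HolderBound γ T W ω) :
    ‖fracDerivRight α t ω r‖ ≤ rightBound α γ * W * (t - r) ^ (γ + α - 1) := by
  have hΓ := Real.Gamma_pos_of_pos h0
  have hα := sub_pos.2 h1
  have hγ' : 0 < γ + α - 1 := by linarith
  have hp : 0 < t - r := sub_pos.2 hrt
  have hint : ‖∫ q in r..t, ((q - r) ^ (2 - α))⁻¹ • (ω r - ω q)‖ ≤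
      W * ((t - r) ^ (γ + α - 1) / (γ + α - 1)) := by
    refine (norm_integral_le_of_norm_le_Ioo hrt.le
      ((intervalIntegrable_rpow_sub_left (p := γ - (2 - α)) (by linarith) r r t).const_mul W)
      (fun q hq => norm_right_kernel_le hq.1
        (hω r q hr hq.1.le (hq.2.le.trans ht)))).trans (le_of_eq ?_)
    rw [intervalIntegral.integral_const_mul, integral_rpow_sub_left (by linarith)]
    have e : γ - (2 - α) + 1 = γ + α - 1 := by ring
    rw [e]
  have hb : ‖((t - r) ^ (1 - α))⁻¹ • (ω r - ω t)‖ ≤ W * (t - r) ^ (γ + α - 1) := by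
    have e : γ + α - 1 = γ - (1 - α) := by ring
    rw [norm_smul, norm_inv, Real.norm_of_nonneg (by positivity), e, Real.rpow_sub hp γ,
      inv_mul_eq_div, ← mul_div_assoc, norm_sub_rev]
    gcongr
    exact hω r t hr hrt.le ht
  rw [fracDerivRight, norm_smul, Real.norm_of_nonneg (by positivity)]
  calc _ ≤ 1 / Real.Gamma α * (W * (t - r) ^ (γ + α - 1)
        + (1 - α) * (W * ((t - r) ^ (γ + α - 1) / (γ + α - 1)))) := by
        gcongr
        refine (norm_add_le _ _).trans (add_le_add hb ?_)
        rw [norm_smul, Real.norm_of_nonneg hα.le]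
        gcongr
    _ = _ := by unfold rightBound; ring

/-- Moving the end point changes the boundary term and adds an integral over `[s, t]`. Splitting `ω
r - ω q` there at `ω s` and integrating the kernel explicitly cancels every occurrence of `ω r`. -/
theorem fracDerivRight_sub {ω : ℝ → E} [CompleteSpace E] {α γ W T r s t : ℝ} (h1 : α < 1)
    (hγ : 1 - α < γ) (hγ0 : 0 < γ) (hr : 0 ≤ r) (hrs : r < s) (hst : s ≤ t) (ht : t ≤ T)
    (hω : HolderBound γ T W ω) :
    fracDerivRight α t ω r - fracDerivRight α s ω r = (1 / Real.Gamma α) •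
      (((t - r) ^ (1 - α))⁻¹ • (ω s - ω t)
        + (1 - α) • ∫ q in s..t, ((q - r) ^ (2 - α))⁻¹ • (ω s - ω q)) := by
  have hα := sub_pos.2 h1
  have hrt := hrs.trans_le hst
  have hsr : 0 < s - r := sub_pos.2 hrs
  have htr : 0 < t - r := sub_pos.2 hrt
  have hc := hω.continuousOn hγ0
  have i0 : IntervalIntegrable (fun q => ((q - r) ^ (2 - α))⁻¹ • (ω r - ω q)) volume r t :=
    intervalIntegrable_right hγ hrt.le (hc.mono (Icc_subset_Icc hr ht))
      (fun q h2 h3 => hω r q hr h2 (h3.trans ht))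
  have i1 : IntervalIntegrable (fun q => ((q - r) ^ (2 - α))⁻¹ • (ω r - ω q)) volume r s :=
    i0.mono_set (by rw [uIcc_of_le hrs.le, uIcc_of_le hrt.le]; exact Icc_subset_Icc_right hst)
  have i2 : IntervalIntegrable (fun q => ((q - r) ^ (2 - α))⁻¹ • (ω r - ω q)) volume s t :=
    i0.mono_set (by rw [uIcc_of_le hst, uIcc_of_le hrt.le]; exact Icc_subset_Icc_left hrs.le)
  have hk : ContinuousOn (fun q : ℝ => ((q - r) ^ (2 - α))⁻¹) (uIcc s t) := by
    rw [uIcc_of_le hst]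
    have hne : ∀ q ∈ Icc s t, q - r ≠ 0 := fun q hq => (sub_pos.2 (hrs.trans_le hq.1)).ne'
    refine ContinuousOn.inv₀ (ContinuousOn.rpow_const (by fun_prop)
      fun q hq => Or.inl (hne q hq)) (fun q hq => ?_)
    exact (Real.rpow_pos_of_pos (sub_pos.2 (hrs.trans_le hq.1)) _).ne'
  have hcs : ContinuousOn ω (uIcc s t) := by
    rw [uIcc_of_le hst]
    exact hc.mono (Icc_subset_Icc (hr.trans hrs.le) ht)
  have i3 : IntervalIntegrable (fun q => ((q - r) ^ (2 - α))⁻¹ • (ω r - ω s)) volume s t :=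
    (hk.smul continuousOn_const).intervalIntegrable
  have i4 : IntervalIntegrable (fun q => ((q - r) ^ (2 - α))⁻¹ • (ω s - ω q)) volume s t :=
    (hk.smul (continuousOn_const.sub hcs)).intervalIntegrable
  have hpow : (1 - α) * ∫ q in s..t, ((q - r) ^ (2 - α))⁻¹ =
      ((s - r) ^ (1 - α))⁻¹ - ((t - r) ^ (1 - α))⁻¹ := by
    have e1 : ∫ q in s..t, ((q - r) ^ (2 - α))⁻¹ = ∫ q in s..t, (q - r) ^ (-(2 - α)) :=
      intervalIntegral_congr_Ioo hst fun q hq => by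
        rw [Real.rpow_neg (sub_pos.2 (hrs.trans hq.1)).le]
    rw [e1, intervalIntegral.integral_comp_sub_right (fun x => x ^ (-(2 - α))) r,
      integral_rpow (Or.inr ⟨by linarith, by
        rw [uIcc_of_le (by linarith)]; exact fun h => absurd h.1 (by linarith)⟩)]
    have e2 : -(2 - α) + 1 = -(1 - α) := by ring
    rw [e2, Real.rpow_neg hsr.le, Real.rpow_neg htr.le]
    field_simp
    ring
  rw [fracDerivRight, fracDerivRight, ← smul_sub,
    ← intervalIntegral.integral_add_adjacent_intervals i1 i2]
  congr 1
  have e : ∫ q in s..t, ((q - r) ^ (2 - α))⁻¹ • (ω r - ω q) =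
      (∫ q in s..t, ((q - r) ^ (2 - α))⁻¹) • (ω r - ω s)
        + ∫ q in s..t, ((q - r) ^ (2 - α))⁻¹ • (ω s - ω q) := by
    rw [← intervalIntegral.integral_smul_const, ← intervalIntegral.integral_add i3 i4]
    refine intervalIntegral.integral_congr fun q _ => ?_
    simp only [← smul_add, sub_add_sub_cancel]
  rw [e, smul_add, smul_add, smul_smul, hpow]
  module

/-- The constant in the bound for increments of the right-sided fractional derivative in the
end point. -/
def rightSubBound (α γ : ℝ) : ℝ := 1 / Real.Gamma α * (1 + (1 - α) * (1 / γ))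

theorem rightSubBound_nonneg {α γ : ℝ} (h0 : 0 < α) (h1 : α < 1) (hγ : 0 < γ) :
    0 ≤ rightSubBound α γ := by
  have := Real.Gamma_pos_of_pos h0
  have := sub_pos.2 h1
  unfold rightSubBound
  positivity

/-- Only increments of `ω` inside `[s, t]` remain, so the full power `(t - s) ^ γ` is available, and
the singularity at `r = s` stays integrable. -/
theorem norm_fracDerivRight_sub_le [CompleteSpace E] {ω : ℝ → E} {α γ W T r s t : ℝ}
    (h0 : 0 < α) (h1 : α < 1)
    (hγ : 1 - α < γ) (hr : 0 ≤ r) (hrs : r < s) (hst : s ≤ t) (ht : t ≤ T)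
    (_hW : 0 ≤ W) (hω : HolderBound γ T W ω) :
    ‖fracDerivRight α t ω r - fracDerivRight α s ω r‖ ≤
      rightSubBound α γ * W * (t - s) ^ γ * (s - r) ^ (α - 1) := by
  have hΓ := Real.Gamma_pos_of_pos h0
  have hα := sub_pos.2 h1
  have hγ0 : 0 < γ := by linarith
  have hsr : 0 < s - r := sub_pos.2 hrs
  have hts : 0 ≤ t - s := sub_nonneg.2 hst
  have hs : 0 ≤ s := hr.trans hrs.le
  have hint : ‖∫ q in s..t, ((q - r) ^ (2 - α))⁻¹ • (ω s - ω q)‖ ≤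
      (W * (s - r) ^ (α - 1)) * ((t - s) ^ γ / γ) := by
    refine (norm_integral_le_of_norm_le_Ioo hst
      ((intervalIntegrable_rpow_sub_left (p := γ - 1) (by linarith) s s t).const_mul
        (W * (s - r) ^ (α - 1))) (fun q hq => ?_)).trans (le_of_eq ?_)
    · have hqs : 0 < q - s := sub_pos.2 hq.1
      have hqr : 0 < q - r := by linarith
      -- The kernel exponent is split as `(α - 1) + (-1)`: the first part is frozen at `q = s`, and
      -- the second is absorbed by the Hölder factor `(q - s) ^ γ`.
      have e1 : ((q - r) ^ (2 - α))⁻¹ ≤ (s - r) ^ (α - 1) * (q - s)⁻¹ := by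
        have e : 2 - α = (1 - α) + 1 := by ring
        rw [e, Real.rpow_add hqr, Real.rpow_one, mul_inv, ← Real.rpow_neg hqr.le]
        have e' : -(1 - α) = α - 1 := by ring
        rw [e']
        have : (q - r) ^ (α - 1) ≤ (s - r) ^ (α - 1) :=
          Real.rpow_le_rpow_of_nonpos hsr (by linarith) (by linarith)
        gcongr
      rw [norm_smul, norm_inv, Real.norm_of_nonneg (by positivity), norm_sub_rev]
      calc _ ≤ ((s - r) ^ (α - 1) * (q - s)⁻¹) * (W * (q - s) ^ γ) := by
            gcongr
            exact hω s q hs hq.1.le (hq.2.le.trans ht)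
        _ = _ := by rw [Real.rpow_sub_one hqs.ne']; ring
    · rw [intervalIntegral.integral_const_mul, integral_rpow_sub_left (by linarith),
        sub_add_cancel]
  have hb : ‖((t - r) ^ (1 - α))⁻¹ • (ω s - ω t)‖ ≤ (W * (s - r) ^ (α - 1)) * (t - s) ^ γ := by
    have htr : 0 < t - r := by linarith
    rw [norm_smul, norm_inv, Real.norm_of_nonneg (by positivity), ← Real.rpow_neg htr.le,
      norm_sub_rev]
    have e' : -(1 - α) = α - 1 := by ring
    rw [e']
    have e1 : (t - r) ^ (α - 1) ≤ (s - r) ^ (α - 1) :=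
      Real.rpow_le_rpow_of_nonpos hsr (by linarith) (by linarith)
    calc _ ≤ (s - r) ^ (α - 1) * (W * (t - s) ^ γ) := by
          gcongr
          exact hω s t hs hst ht
      _ = _ := by ring
  rw [fracDerivRight_sub h1 hγ hγ0 hr hrs hst ht hω, norm_smul,
    Real.norm_of_nonneg (by positivity)]
  calc _ ≤ 1 / Real.Gamma α * ((W * (s - r) ^ (α - 1)) * (t - s) ^ γ
        + (1 - α) * ((W * (s - r) ^ (α - 1)) * ((t - s) ^ γ / γ))) := by
        gcongr
        refine (norm_add_le _ _).trans (add_le_add hb ?_)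
        rw [norm_smul, Real.norm_of_nonneg hα.le]
        gcongr
    _ = _ := by unfold rightSubBound; ring

/-! ### The weighted Hölder estimate for the fractional integral -/

theorem rpow_le_exp {x δ : ℝ} (hx : 0 ≤ x) (h0 : 0 ≤ δ) (h1 : δ ≤ 1) :
    x ^ δ ≤ Real.exp x := by
  have h : x ^ δ ≤ 1 + x := by
    rcases le_total x 1 with h | h
    · exact (Real.rpow_le_one hx h h0).trans (by linarith)
    · have := Real.rpow_le_rpow_of_exponent_le h h1
      rw [Real.rpow_one] at this
      linarith
  have := Real.add_one_le_exp x
  linarith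

/-- This is `x ^ δ ≤ exp x` at `x = ρ (t - r)`. It is the source of every negative power of `ρ`:
smallness in `ρ` is bought with a singularity of order `δ` at `r = t`. -/
theorem exp_weight_le {ρ r t δ : ℝ} (hρ : 0 < ρ) (hrt : r < t) (h0 : 0 ≤ δ) (h1 : δ ≤ 1) :
    Real.exp (ρ * r) ≤ Real.exp (ρ * t) * ρ ^ (-δ) * (t - r) ^ (-δ) := by
  have hp : 0 < t - r := sub_pos.2 hrt
  have h := rpow_le_exp (mul_pos hρ hp).le h0 h1
  have h2 : 0 < (ρ * (t - r)) ^ δ := by positivity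
  rw [mul_assoc, ← Real.mul_rpow hρ.le hp.le, Real.rpow_neg (by positivity),
    ← div_eq_mul_inv, le_div_iff₀ h2]
  calc _ ≤ Real.exp (ρ * r) * Real.exp (ρ * (t - r)) := by gcongr
    _ = _ := by rw [← Real.exp_add]; ring_nf

theorem norm_fracDeriv_mul_le {Z : ℝ → E →L[ℝ] F} {ω : ℝ → E} {α β γ T ρ K W r t : ℝ}
    (h0 : 0 < α) (h1 : α < 1) (hαβ : α < β) (hγ : 1 - α < γ) (hr : 0 < r) (hrt : r < t)
    (ht : t ≤ T) (hZ : WeightedHolder β T ρ K Z) (hω : HolderBound γ T W ω) :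
    ‖fracDerivLeft α Z r‖ * ‖fracDerivRight α t ω r‖ ≤
      (leftBound α β T * K * Real.exp (ρ * r) * r ^ (-α)) *
        (rightBound α γ * W * (t - r) ^ (γ + α - 1)) := by
  have a1 := norm_fracDerivLeft_le h0 h1 hαβ hr (hrt.le.trans ht) hZ
  have a2 := norm_fracDerivRight_le h0 h1 hγ hr.le hrt ht hω
  exact mul_le_mul a1 a2 (norm_nonneg _) ((norm_nonneg _).trans a1)

theorem aestronglyMeasurable_vecIntegrand {Z : ℝ → E →L[ℝ] F} {ω : ℝ → E} {α t : ℝ}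
    (ht : 0 ≤ t) (hZ : ContinuousOn Z (Icc 0 t)) (hω : ContinuousOn ω (Icc 0 t)) :
    AEStronglyMeasurable (fun r => fracDerivLeft α Z r (fracDerivRight α t ω r))
      (volume.restrict (Ioo 0 t)) := by
  have h := (aestronglyMeasurable_fracDerivLeft (α := α) hZ ht).prodMk
    (aestronglyMeasurable_fracDerivRight (α := α) hω ht)
  exact (isBoundedBilinearMap_apply (𝕜 := ℝ) (E := E) (F := F)).continuous.comp_aestronglyMeasurable
    h

/-- A crude majorant that ignores the gain in `ρ`; it serves integrability and the exchange of sum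
and integral. -/
theorem norm_fracDeriv_mul_le_beta {Z : ℝ → E →L[ℝ] F} {ω : ℝ → E} {α β γ T ρ K W r t : ℝ}
    (h0 : 0 < α) (h1 : α < 1) (hαβ : α < β) (hγ : 1 - α < γ) (hρ : 0 ≤ ρ)
    (hW : 0 ≤ W) (hr : 0 < r) (hrt : r < t)
    (ht : t ≤ T) (hZ : WeightedHolder β T ρ K Z) (hω : HolderBound γ T W ω) :
    ‖fracDerivLeft α Z r‖ * ‖fracDerivRight α t ω r‖ ≤
      (leftBound α β T * K * Real.exp (ρ * T) * rightBound α γ * W * T ^ γ) *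
        ((r - 0) ^ (-α) * (t - r) ^ (α - 1)) := by
  have hp : 0 < t - r := sub_pos.2 hrt
  have hT : 0 ≤ T := hr.le.trans (hrt.le.trans ht)
  have hK := hZ.nonneg hT
  have hl := leftBound_nonneg h0 h1 hαβ hT
  have hrb := rightBound_nonneg h0 h1 hγ
  refine (norm_fracDeriv_mul_le h0 h1 hαβ hγ hr hrt ht hZ hω).trans ?_
  have e : γ + α - 1 = γ + (α - 1) := by ring
  rw [e, Real.rpow_add hp, sub_zero]
  have b1 : (t - r) ^ γ ≤ T ^ γ := Real.rpow_le_rpow hp.le (by linarith) (by linarith)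
  have b2 : Real.exp (ρ * r) ≤ Real.exp (ρ * T) := by
    have : r ≤ T := by linarith
    gcongr
  calc _ ≤ (leftBound α β T * K * Real.exp (ρ * T) * r ^ (-α)) *
        (rightBound α γ * W * (T ^ γ * (t - r) ^ (α - 1))) := by gcongr
    _ = _ := by ring

theorem intervalIntegrable_vecIntegrand {Z : ℝ → E →L[ℝ] F} {ω : ℝ → E} {α β γ T ρ K W t : ℝ}
    (h0 : 0 < α) (h1 : α < 1) (hαβ : α < β) (hγ : 1 - α < γ) (hρ : 0 ≤ ρ) (hW : 0 ≤ W)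
    (ht0 : 0 ≤ t) (ht : t ≤ T) (hZ : WeightedHolder β T ρ K Z) (hω : HolderBound γ T W ω) :
    IntervalIntegrable (fun r => fracDerivLeft α Z r (fracDerivRight α t ω r)) volume 0 t := by
  have hT : 0 ≤ T := ht0.trans ht
  have hsub : Icc 0 t ⊆ Icc 0 T := Icc_subset_Icc_right ht
  exact intervalIntegrable_of_norm_le_Ioo ht0
    (aestronglyMeasurable_vecIntegrand ht0
      ((hZ.continuousOn hT hρ (h0.trans hαβ)).mono hsub)
      ((hω.continuousOn (by linarith)).mono hsub))
    ((intervalIntegrable_beta h0 h1 ht0).const_mul _)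
    (fun r hr => (ContinuousLinearMap.le_opNorm _ _).trans
      (norm_fracDeriv_mul_le_beta h0 h1 hαβ hγ hρ hW hr.1 hr.2 ht hZ hω))

/-- The constant in the weighted Hölder estimate for the fractional integral. -/
def fracConst (α β γ T : ℝ) : ℝ :=
  leftBound α β T * (rightSubBound α γ + rightBound α γ) * betaBound α

theorem fracConst_nonneg {α β γ T : ℝ} (h0 : 0 < α) (h1 : α < 1) (hαβ : α < β) (hγ : 1 - α < γ)
    (hT : 0 ≤ T) : 0 ≤ fracConst α β γ T :=
  mul_nonneg (mul_nonneg (leftBound_nonneg h0 h1 hαβ hT)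
    (add_nonneg (rightSubBound_nonneg h0 h1 (by linarith)) (rightBound_nonneg h0 h1 hγ)))
    (betaBound_nonneg h0 h1)

/-- The increment is an integral over `[0, s]` against the change of the right derivative, plus an
integral over `[s, t]`. In both, `exp_weight_le` with `δ = γ - β` spends the surplus regularity of
`ω`: on `[0, s]` the power `(t - s) ^ γ` drops to `(t - s) ^ β`, and on `[s, t]` the power `(t - r)
^ (γ + α - 1)` drops to `(t - r) ^ β (t - r) ^ (α - 1)`. A uniformly bounded beta integral is left.
-/
theorem norm_vecIntegral_sub_le [CompleteSpace E] {Z : ℝ → E →L[ℝ] F} {ω : ℝ → E}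
    {α β γ T ρ K W s t : ℝ}
    (h0 : 0 < α) (h1 : α < 1) (hαβ : α < β) (hγ : 1 - α < γ) (hβγ : β < γ) (hγ1 : γ ≤ 1)
    (hρ : 0 < ρ) (hW : 0 ≤ W) (hs : 0 ≤ s) (hst : s ≤ t) (ht : t ≤ T)
    (hZ : WeightedHolder β T ρ K Z) (hω : HolderBound γ T W ω) :
    ‖vecIntegral α Z ω t - vecIntegral α Z ω s‖ ≤
      fracConst α β γ T * W * K * ρ ^ (-(γ - β)) * Real.exp (ρ * t) * (t - s) ^ β := by
  have hT : 0 ≤ T := hs.trans (hst.trans ht)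
  have hK := hZ.nonneg hT
  have hl := leftBound_nonneg h0 h1 hαβ hT
  have hrb := rightBound_nonneg h0 h1 hγ
  have hsb := rightSubBound_nonneg h0 h1 (show 0 < γ by linarith)
  have hBb := betaBound_nonneg h0 h1
  rcases hst.eq_or_lt with rfl | hlt
  · have hβ0 : β ≠ 0 := by linarith
    simp [Real.zero_rpow hβ0]
  have hts : 0 < t - s := sub_pos.2 hlt
  have it := intervalIntegrable_vecIntegrand h0 h1 hαβ hγ hρ.le hW (hs.trans hst) ht hZ hω
  have is := intervalIntegrable_vecIntegrand h0 h1 hαβ hγ hρ.le hW hs (hst.trans ht) hZ hω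
  have it1 := it.mono_set (c := 0) (d := s)
    (by rw [uIcc_of_le hs, uIcc_of_le (hs.trans hst)]; exact Icc_subset_Icc_right hst)
  have it2 := it.mono_set (c := s) (d := t)
    (by rw [uIcc_of_le hst, uIcc_of_le (hs.trans hst)]; exact Icc_subset_Icc_left hs)
  have hsplit : vecIntegral α Z ω t - vecIntegral α Z ω s =
      -((∫ r in (0 : ℝ)..s, fracDerivLeft α Z r
        (fracDerivRight α t ω r - fracDerivRight α s ω r))
      + ∫ r in s..t, fracDerivLeft α Z r (fracDerivRight α t ω r)) := by
    simp only [map_sub]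
    rw [intervalIntegral.integral_sub it1 is, vecIntegral, vecIntegral,
      ← intervalIntegral.integral_add_adjacent_intervals it1 it2]
    abel
  set X := K * W * Real.exp (ρ * t) * ρ ^ (-(γ - β)) * (t - s) ^ β with hX
  have hδ0 : 0 ≤ γ - β := by linarith
  have hδ1 : γ - β ≤ 1 := by linarith
  have b1 : ‖∫ r in (0 : ℝ)..s, fracDerivLeft α Z r
      (fracDerivRight α t ω r - fracDerivRight α s ω r)‖ ≤
      leftBound α β T * rightSubBound α γ * X * betaBound α := by
    refine (norm_integral_le_of_norm_le_Ioo hs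
      ((intervalIntegrable_beta h0 h1 hs).const_mul
        (leftBound α β T * rightSubBound α γ * X)) (fun r hr => ?_)).trans ?_
    · have hsr : 0 < s - r := sub_pos.2 hr.2
      have hr0 := hr.1
      refine (ContinuousLinearMap.le_opNorm _ _).trans ?_
      have a1 := norm_fracDerivLeft_le h0 h1 hαβ hr.1 (by linarith [hr.2]) hZ
      have a2 := norm_fracDerivRight_sub_le h0 h1 hγ hr.1.le hr.2 hst ht hW hω
      -- Since `r < s`, the singularity at `t - r` is no worse than the one at `t - s`, which does
      -- not depend on `r`.
      have a3 : Real.exp (ρ * r) ≤ Real.exp (ρ * t) * ρ ^ (-(γ - β)) * (t - s) ^ (-(γ - β)) := by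
        refine (exp_weight_le hρ (hr.2.trans hlt) hδ0 hδ1).trans ?_
        have : (t - r) ^ (-(γ - β)) ≤ (t - s) ^ (-(γ - β)) :=
          Real.rpow_le_rpow_of_nonpos hts (by linarith) (by linarith)
        gcongr
      have e : (t - s) ^ (-(γ - β)) * (t - s) ^ γ = (t - s) ^ β := by
        rw [← Real.rpow_add hts]; ring_nf
      calc _ ≤ (leftBound α β T * K * (Real.exp (ρ * t) * ρ ^ (-(γ - β)) *
              (t - s) ^ (-(γ - β))) * r ^ (-α)) *
              (rightSubBound α γ * W * (t - s) ^ γ * (s - r) ^ (α - 1)) := by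
            refine (mul_le_mul a1 a2 (norm_nonneg _) ((norm_nonneg _).trans a1)).trans ?_
            gcongr
        _ = leftBound α β T * rightSubBound α γ * (K * W * Real.exp (ρ * t) * ρ ^ (-(γ - β)) *
              ((t - s) ^ (-(γ - β)) * (t - s) ^ γ)) * ((r - 0) ^ (-α) * (s - r) ^ (α - 1)) := by
            rw [sub_zero]; ring
        _ = _ := by rw [e, hX]
    · rw [intervalIntegral.integral_const_mul]
      gcongr
      exact integral_beta_le h0 h1 hs
  have b2 : ‖∫ r in s..t, fracDerivLeft α Z r (fracDerivRight α t ω r)‖ ≤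
      leftBound α β T * rightBound α γ * X * betaBound α := by
    refine (norm_integral_le_of_norm_le_Ioo hst
      ((intervalIntegrable_beta h0 h1 hst).const_mul
        (leftBound α β T * rightBound α γ * X)) (fun r hr => ?_)).trans ?_
    · have hrs : 0 < r - s := sub_pos.2 hr.1
      have htr : 0 < t - r := sub_pos.2 hr.2
      have hr0 : 0 < r := by linarith
      refine (ContinuousLinearMap.le_opNorm _ _).trans ?_
      refine (norm_fracDeriv_mul_le h0 h1 hαβ hγ hr0 hr.2 ht hZ hω).trans ?_
      have a3 := exp_weight_le (δ := γ - β) hρ hr.2 hδ0 hδ1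
      -- Moving the singularity from `0` to `s` only enlarges the integrand and produces the beta
      -- integral of `[s, t]`.
      have a4 : r ^ (-α) ≤ (r - s) ^ (-α) :=
        Real.rpow_le_rpow_of_nonpos hrs (by linarith) (by linarith)
      have e : (t - r) ^ (-(γ - β)) * (t - r) ^ (γ + α - 1) =
          (t - r) ^ β * (t - r) ^ (α - 1) := by
        rw [← Real.rpow_add htr, ← Real.rpow_add htr]; ring_nf
      have a5 : (t - r) ^ β ≤ (t - s) ^ β :=
        Real.rpow_le_rpow htr.le (by linarith) (by linarith)
      calc _ ≤ (leftBound α β T * K * (Real.exp (ρ * t) * ρ ^ (-(γ - β)) *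
              (t - r) ^ (-(γ - β))) * (r - s) ^ (-α)) *
              (rightBound α γ * W * (t - r) ^ (γ + α - 1)) := by gcongr
        _ = leftBound α β T * rightBound α γ * (K * W * Real.exp (ρ * t) * ρ ^ (-(γ - β))) *
              (r - s) ^ (-α) * ((t - r) ^ (-(γ - β)) * (t - r) ^ (γ + α - 1)) := by ring
        _ = leftBound α β T * rightBound α γ * (K * W * Real.exp (ρ * t) * ρ ^ (-(γ - β))) *
              (r - s) ^ (-α) * ((t - r) ^ β * (t - r) ^ (α - 1)) := by rw [e]
        _ ≤ leftBound α β T * rightBound α γ * (K * W * Real.exp (ρ * t) * ρ ^ (-(γ - β))) *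
              (r - s) ^ (-α) * ((t - s) ^ β * (t - r) ^ (α - 1)) := by gcongr
        _ = _ := by rw [hX]; ring
    · have hX0 : 0 ≤ X := by positivity
      rw [intervalIntegral.integral_const_mul]
      gcongr
      exact integral_beta_le h0 h1 hst
  rw [hsplit, norm_neg]
  refine (norm_add_le _ _).trans ((add_le_add b1 b2).trans (le_of_eq ?_))
  rw [hX, fracConst]
  ring

theorem weightedHolder_vecIntegral [CompleteSpace E] {Z : ℝ → E →L[ℝ] F} {ω : ℝ → E}
    {α β γ T ρ K W : ℝ}
    (h0 : 0 < α) (h1 : α < 1) (hαβ : α < β) (hγ : 1 - α < γ) (hβγ : β < γ) (hγ1 : γ ≤ 1)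
    (hρ : 0 < ρ) (hW : 0 ≤ W) (hT : 0 ≤ T)
    (hZ : WeightedHolder β T ρ K Z) (hω : HolderBound γ T W ω) :
    WeightedHolder β T ρ (fracConst α β γ T * W * K * ρ ^ (-(γ - β)) * (1 + T ^ β))
      (vecIntegral α Z ω) := by
  have hK := hZ.nonneg hT
  have hc := fracConst_nonneg h0 h1 hαβ hγ hT
  exact weightedHolder_of_holder_of_zero (by simp [vecIntegral]) (by linarith) (by positivity)
    (fun s t hs hst ht => norm_vecIntegral_sub_le h0 h1 hαβ hγ hβγ hγ1 hρ hW hs hst ht hZ hω)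

/-- The weighted Hölder estimate for Lebesgue integrals. -/
theorem weightedHolder_integral {g : ℝ → E} {β T ρ K : ℝ} (hβ0 : 0 < β) (hβ1 : β < 1)
    (hρ : 0 < ρ) (_hT : 0 ≤ T) (hK : 0 ≤ K) (hg : ContinuousOn g (Icc 0 T))
    (h : ∀ r, 0 ≤ r → r ≤ T → ‖g r‖ ≤ K * Real.exp (ρ * r)) :
    WeightedHolder β T ρ (K * ρ ^ (-(1 - β)) * (1 / β) * (1 + T ^ β))
      (fun t => ∫ r in (0 : ℝ)..t, g r) := by
  refine weightedHolder_of_holder_of_zero (by simp) hβ0.le (by positivity) ?_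
  intro s t hs hst ht
  have i (a b : ℝ) (ha : 0 ≤ a) (hab : a ≤ b) (hb : b ≤ T) : IntervalIntegrable g volume a b :=
    ContinuousOn.intervalIntegrable (by
      rw [uIcc_of_le hab]; exact hg.mono (Icc_subset_Icc ha hb))
  have hsub : (∫ r in (0 : ℝ)..t, g r) - ∫ r in (0 : ℝ)..s, g r = ∫ r in s..t, g r := by
    rw [← intervalIntegral.integral_add_adjacent_intervals (i 0 s le_rfl hs (hst.trans ht))
      (i s t hs hst ht)]
    abel
  rw [hsub]
  refine (norm_integral_le_of_norm_le_Ioo hst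
    ((intervalIntegrable_rpow_sub_right (p := β - 1) (by linarith) t s t).const_mul
      (K * (Real.exp (ρ * t) * ρ ^ (-(1 - β))))) (fun r hr => ?_)).trans (le_of_eq ?_)
  · refine (h r (hs.trans hr.1.le) (hr.2.le.trans ht)).trans ?_
    -- The power `(t - r) ^ (β - 1)` integrates to `(t - s) ^ β / β`, so this `δ` leaves precisely
    -- Hölder exponent `β`.
    have a := exp_weight_le (δ := 1 - β) hρ hr.2 (by linarith) (by linarith)
    have e : -(1 - β) = β - 1 := by ring
    rw [mul_assoc]
    rw [e] at a ⊢
    gcongr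
  · rw [intervalIntegral.integral_const_mul, integral_rpow_sub_right (by linarith),
      sub_add_cancel]
    ring

/-! ### The fractional integral in coordinates -/

theorem map_intervalIntegrable {f : ℝ → E} {a b : ℝ} (φ : E →L[ℝ] F)
    (h : IntervalIntegrable f volume a b) : IntervalIntegrable (fun r => φ (f r)) volume a b :=
  ⟨φ.integrable_comp h.1, φ.integrable_comp h.2⟩

theorem map_fracDerivLeft [CompleteSpace E] [CompleteSpace F] (φ : E →L[ℝ] F) {Z : ℝ → E}
    {α r : ℝ}
    (h : IntervalIntegrable (fun q => ((r - q) ^ (1 + α))⁻¹ • (Z r - Z q)) volume 0 r) :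
    φ (fracDerivLeft α Z r) = fracDerivLeft α (fun q => φ (Z q)) r := by
  rw [fracDerivLeft, fracDerivLeft, map_smul, map_add, map_smul, map_smul,
    ← φ.intervalIntegral_comp_comm h]
  simp only [map_smul, map_sub]

theorem map_fracDerivRight [CompleteSpace E] [CompleteSpace F] (φ : E →L[ℝ] F) {ω : ℝ → E}
    {α t r : ℝ}
    (h : IntervalIntegrable (fun q => ((q - r) ^ (2 - α))⁻¹ • (ω r - ω q)) volume r t) :
    φ (fracDerivRight α t ω r) = fracDerivRight α t (fun q => φ (ω q)) r := by
  rw [fracDerivRight, fracDerivRight, map_smul, map_add, map_smul, map_smul,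
    ← φ.intervalIntegral_comp_comm h]
  simp only [map_smul, map_sub]

theorem weylLeft_zero_eq (α : ℝ) (Z : ℝ → ℝ) (r : ℝ) :
    weylLeft α 0 Z r = fracDerivLeft α Z r := by
  simp only [weylLeft, fracDerivLeft, smul_eq_mul, sub_zero, div_eq_inv_mul]

theorem leftLim_eq_of_continuousAt {ω : ℝ → ℝ} {t : ℝ} (h : ContinuousAt ω t) :
    Function.leftLim ω t = ω t :=
  leftLim_eq_of_tendsto (h.tendsto.mono_left nhdsWithin_le_nhds)

theorem weylRight_eq {α t : ℝ} {ω : ℝ → ℝ} (h : ContinuousAt ω t) (r : ℝ) :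
    weylRight α t ω r = fracDerivRight α t ω r := by
  simp only [weylRight, fracDerivRight, smul_eq_mul, div_eq_inv_mul,
    leftLim_eq_of_continuousAt h]

/-- The `j`-th coordinate as a continuous linear functional. -/
def coordCLM (j : ℤ) : L2Z →L[ℝ] ℝ := lp.evalCLM ℝ (fun _ : ℤ => ℝ) 2 j

theorem coordCLM_apply (j : ℤ) (u : L2Z) : coordCLM j u = u j := rfl

/-- The matrix entry of an operator as a continuous linear functional. -/
def entryCLM (i j : ℤ) : (L2Z →L[ℝ] L2Z) →L[ℝ] ℝ :=
  (coordCLM j).comp (ContinuousLinearMap.apply ℝ L2Z (basisVec i))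

theorem entryCLM_apply (i j : ℤ) (A : L2Z →L[ℝ] L2Z) : entryCLM i j A = A (basisVec i) j := rfl

theorem hasSum_coord_smul_basisVec (u : L2Z) : HasSum (fun i => u i • basisVec i) u := by
  have h := lp.hasSum_single (p := 2) (by norm_num) u
  refine h.congr_fun fun i => ?_
  rw [basisVec, ← lp.single_smul, smul_eq_mul, mul_one]

theorem hasSum_entry_mul (A : L2Z →L[ℝ] L2Z) (v : L2Z) (j : ℤ) :
    HasSum (fun i => entryCLM i j A * v i) (A v j) := by
  have h := (hasSum_coord_smul_basisVec v).mapL ((coordCLM j).comp A)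
  refine h.congr_fun fun i => ?_
  rw [map_smul, smul_eq_mul, mul_comm]
  rfl

/-- Let `w` be `v` with the signs of its coordinates flipped so that every product becomes
nonnegative. Then `‖w‖ ≤ ‖v‖`, and the sum of absolute values is a partial sum of `(A w)_j`.
Boundedness of `A` thus suffices for absolute convergence of the row sums. -/
theorem sum_abs_entry_mul_le (A : L2Z →L[ℝ] L2Z) (v : L2Z) (j : ℤ) (s : Finset ℤ) :
    ∑ i ∈ s, |entryCLM i j A * v i| ≤ ‖A‖ * ‖v‖ := by
  let c : ℤ → ℝ := fun i => if 0 ≤ entryCLM i j A * v i then 1 else -1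
  have hc2 : ∀ i, (c i * v i) ^ 2 = v i ^ 2 := fun i => by
    simp only [c]; split_ifs <;> ring
  let w : L2Z := ⟨fun i => c i * v i, memlp_iff.2 (by simp only [hc2]; exact summable_sq v)⟩
  have hw : ‖w‖ ≤ 1 * ‖v‖ := norm_le_of_sq_le zero_le_one (by
    rw [one_pow, one_mul]
    exact (tsum_congr hc2).le)
  have habs : ∀ i, |entryCLM i j A * v i| = entryCLM i j A * w i := fun i => by
    change _ = entryCLM i j A * (c i * v i)
    simp only [c]
    split_ifs with h
    · rw [abs_of_nonneg h, one_mul]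
    · rw [abs_of_neg (not_le.1 h)]; ring
  have hs := hasSum_entry_mul A w j
  have h1 : ∑ i ∈ s, |entryCLM i j A * v i| ≤ A w j := by
    simp only [habs]
    exact sum_le_hasSum s (fun i _ => by rw [← habs]; exact abs_nonneg _) hs
  calc _ ≤ A w j := h1
    _ ≤ |A w j| := le_abs_self _
    _ ≤ ‖A w‖ := norm_coord_le _ _
    _ ≤ ‖A‖ * ‖w‖ := A.le_opNorm _
    _ ≤ ‖A‖ * ‖v‖ := by rw [one_mul] at hw; gcongr

section Coordinates

variable {Z : ℝ → L2Z →L[ℝ] L2Z} {ω : ℝ → L2Z} {α β γ K W t : ℝ}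

theorem weylLeft_entry (hαβ : α < β) (hβ : 0 < β) (hZ : HolderBound β t K Z) (i j : ℤ) {r : ℝ}
    (hr : r ∈ Ioo 0 t) :
    IntervalIntegrable (fun q => (Z r (basisVec i) j - Z q (basisVec i) j) / (r - q) ^ (1 + α))
      volume 0 r ∧
    weylLeft α 0 (fun r => Z r (basisVec i) j) r = entryCLM i j (fracDerivLeft α Z r) := by
  have h : IntervalIntegrable (fun q => ((r - q) ^ (1 + α))⁻¹ • (Z r - Z q)) volume 0 r :=
    intervalIntegrable_left hαβ hr.1.le
      ((hZ.continuousOn hβ).mono (Icc_subset_Icc_right hr.2.le))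
      (fun q h0 hq => hZ q r h0 hq hr.2.le)
  refine ⟨(map_intervalIntegrable (entryCLM i j) h).congr (fun q _ => ?_), ?_⟩
  · simp only [map_smul, map_sub, smul_eq_mul, entryCLM_apply, div_eq_inv_mul]
  · rw [map_fracDerivLeft _ h, weylLeft_zero_eq]
    rfl

theorem weylRight_coord (hγ : 1 - α < γ) (hγ0 : 0 < γ) (hω : HolderBound γ t W ω)
    (hωc : Continuous ω) (i : ℤ) {r : ℝ} (hr : r ∈ Ioo 0 t) :
    IntervalIntegrable (fun q => (ω r i - ω q i) / (q - r) ^ (2 - α)) volume r t ∧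
    weylRight α t (fun r => ω r i) r = fracDerivRight α t ω r i := by
  have h : IntervalIntegrable (fun q => ((q - r) ^ (2 - α))⁻¹ • (ω r - ω q)) volume r t :=
    intervalIntegrable_right hγ hr.2.le
      ((hω.continuousOn hγ0).mono (Icc_subset_Icc_left hr.1.le))
      (fun q h0 hq => hω r q hr.1.le h0 hq)
  refine ⟨(map_intervalIntegrable (coordCLM i) h).congr (fun q _ => ?_), ?_⟩
  · simp only [map_smul, map_sub, smul_eq_mul, coordCLM_apply, div_eq_inv_mul]
  · rw [← coordCLM_apply, map_fracDerivRight _ h, weylRight_eq]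
    · rfl
    · exact ((coordCLM i).continuous.comp hωc).continuousAt

theorem weyl_mul_eq (hα0 : 0 < α) (h1 : α < 1) (hαβ : α < β) (hγ : 1 - α < γ)
    (hZ : HolderBound β t K Z) (hω : HolderBound γ t W ω) (hωc : Continuous ω)
    (i j : ℤ) {r : ℝ} (hr : r ∈ Ioo 0 t) :
    weylLeft α 0 (fun r => Z r (basisVec i) j) r * weylRight α t (fun r => ω r i) r =
      entryCLM i j (fracDerivLeft α Z r) * fracDerivRight α t ω r i := by
  rw [(weylLeft_entry hαβ (hα0.trans hαβ) hZ i j hr).2,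
    (weylRight_coord hγ (by linarith) hω hωc i hr).2]

theorem intervalIntegrable_entry_mul (h0 : 0 < α) (h1 : α < 1) (hαβ : α < β) (hγ : 1 - α < γ)
    (ht : 0 ≤ t) (hW : 0 ≤ W) (hZ : WeightedHolder β t 0 K Z) (hω : HolderBound γ t W ω)
    (i j : ℤ) :
    IntervalIntegrable (fun r => entryCLM i j (fracDerivLeft α Z r) * fracDerivRight α t ω r i)
      volume 0 t := by
  refine intervalIntegrable_of_norm_le_Ioo ht ?_ ((intervalIntegrable_beta h0 h1 ht).const_mul
    (leftBound α β t * K * Real.exp (0 * t) * rightBound α γ * W * t ^ γ)) (fun r hr => ?_)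
  · exact ((entryCLM i j).continuous.comp_aestronglyMeasurable
      (aestronglyMeasurable_fracDerivLeft (hZ.continuousOn ht le_rfl (h0.trans hαβ)) ht)).mul
      ((coordCLM i).continuous.comp_aestronglyMeasurable
        (aestronglyMeasurable_fracDerivRight (hω.continuousOn (by linarith)) ht))
  · refine le_trans ?_ (norm_fracDeriv_mul_le_beta h0 h1 hαβ hγ le_rfl hW hr.1 hr.2 le_rfl hZ hω)
    simpa using sum_abs_entry_mul_le (fracDerivLeft α Z r) (fracDerivRight α t ω r) j {i}

theorem scalarIntegrable_entry (h0 : 0 < α) (h1 : α < 1) (hαβ : α < β) (hγ : 1 - α < γ)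
    (ht : 0 ≤ t) (hW : 0 ≤ W) (hZ : WeightedHolder β t 0 K Z) (hω : HolderBound γ t W ω)
    (hωc : Continuous ω) (i j : ℤ) :
    ScalarIntegrable α 0 t (fun r => Z r (basisVec i) j) (fun r => ω r i) where
  left r hr := (weylLeft_entry hαβ (h0.trans hαβ) (hZ.holderBound ht le_rfl) i j hr).1
  right r hr := (weylRight_coord hγ (by linarith) hω hωc i hr).1
  leftLim := by
    have hc : Continuous fun r => ω r i := (coordCLM i).continuous.comp hωc
    rw [leftLim_eq_of_continuousAt hc.continuousAt]
    exact hc.continuousAt.tendsto.mono_left nhdsWithin_le_nhds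
  prod := by
    have h := intervalIntegrable_entry_mul h0 h1 hαβ hγ ht hW hZ hω i j
    rw [intervalIntegrable_iff_integrableOn_Ioo_of_le ht] at h ⊢
    exact h.congr_fun
      (fun r hr => (weyl_mul_eq h0 h1 hαβ hγ (hZ.holderBound ht le_rfl) hω hωc i j hr).symm)
      measurableSet_Ioo

/-- Finite sums of the absolute integrands are dominated by one beta integrand, by
`sum_abs_entry_mul_le`, so sum and integral may be exchanged; under the integral the row sum is the
`j`-th coordinate of the operator applied to the vector. -/
theorem hasSum_scalarIntegral (h0 : 0 < α) (h1 : α < 1) (hαβ : α < β) (hγ : 1 - α < γ)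
    (ht : 0 ≤ t) (hW : 0 ≤ W) (hZ : WeightedHolder β t 0 K Z) (hω : HolderBound γ t W ω)
    (hωc : Continuous ω) (j : ℤ) :
    HasSum (fun i => scalarIntegral α 0 t (fun r => Z r (basisVec i) j) (fun r => ω r i))
      (vecIntegral α Z ω t j) := by
  have hint (i : ℤ) := (intervalIntegrable_iff_integrableOn_Ioo_of_le ht).1
    (intervalIntegrable_entry_mul h0 h1 hαβ hγ ht hW hZ hω i j)
  have hbeta := (intervalIntegrable_iff_integrableOn_Ioo_of_le ht).1
    ((intervalIntegrable_beta h0 h1 ht).const_mul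
    (leftBound α β t * K * Real.exp (0 * t) * rightBound α γ * W * t ^ γ))
  have hsum : Summable fun i => ∫ r in Ioo 0 t,
      ‖entryCLM i j (fracDerivLeft α Z r) * fracDerivRight α t ω r i‖ := by
    refine summable_of_sum_le (fun i => integral_nonneg fun r => norm_nonneg _) (fun s => ?_)
      (c := ∫ r in Ioo 0 t,
        (leftBound α β t * K * Real.exp (0 * t) * rightBound α γ * W * t ^ γ) *
        ((r - 0) ^ (-α) * (t - r) ^ (α - 1)))
    rw [← integral_finsetSum s fun i _ => (hint i).norm]
    refine setIntegral_mono_on (integrable_finsetSum s fun i _ => (hint i).norm) hbeta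
      measurableSet_Ioo (fun r hr => ?_)
    refine le_trans ?_ (norm_fracDeriv_mul_le_beta h0 h1 hαβ hγ le_rfl hW hr.1 hr.2 le_rfl hZ hω)
    exact sum_abs_entry_mul_le (fracDerivLeft α Z r) (fracDerivRight α t ω r) j s
  have h := (hasSum_integral_of_summable_integral_norm hint hsum).neg
  have hv : vecIntegral α Z ω t j = -∫ r in Ioo 0 t,
      ∑' i, entryCLM i j (fracDerivLeft α Z r) * fracDerivRight α t ω r i := by
    have hI := intervalIntegrable_vecIntegrand h0 h1 hαβ hγ le_rfl hW ht le_rfl hZ hω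
    rw [← coordCLM_apply, vecIntegral, map_neg, ← (coordCLM j).intervalIntegral_comp_comm hI,
      intervalIntegral.integral_of_le ht, integral_Ioc_eq_integral_Ioo]
    congr 2
    ext r
    exact (hasSum_entry_mul (fracDerivLeft α Z r) (fracDerivRight α t ω r) j).tsum_eq.symm
  rw [hv]
  refine h.congr_fun fun i => ?_
  rw [scalarIntegral, intervalIntegral.integral_of_le ht, integral_Ioc_eq_integral_Ioo]
  congr 1
  exact setIntegral_congr_fun measurableSet_Ioo
    (fun r hr => weyl_mul_eq h0 h1 hαβ hγ (hZ.holderBound ht le_rfl) hω hωc i j hr)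

theorem fracIntegrable_of_weightedHolder (h0 : 0 < α) (h1 : α < 1) (hαβ : α < β)
    (hγ : 1 - α < γ) (ht : 0 ≤ t) (hW : 0 ≤ W) (hZ : WeightedHolder β t 0 K Z)
    (hω : HolderBound γ t W ω) (hωc : Continuous ω) : FracIntegrable α 0 t Z ω where
  scalar i j := scalarIntegrable_entry h0 h1 hαβ hγ ht hW hZ hω hωc i j
  inner_summable j := (hasSum_scalarIntegral h0 h1 hαβ hγ ht hW hZ hω hωc j).summable
  outer_summable := by
    refine ((hasSum_coord_smul_basisVec (vecIntegral α Z ω t)).congr_fun fun j => ?_).summable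
    rw [integralCoord, (hasSum_scalarIntegral h0 h1 hαβ hγ ht hW hZ hω hωc j).tsum_eq]

theorem fracIntegral_eq_vecIntegral (h0 : 0 < α) (h1 : α < 1) (hαβ : α < β)
    (hγ : 1 - α < γ) (ht : 0 ≤ t) (hW : 0 ≤ W) (hZ : WeightedHolder β t 0 K Z)
    (hω : HolderBound γ t W ω) (hωc : Continuous ω) :
    fracIntegral α 0 t Z ω = vecIntegral α Z ω t := by
  rw [fracIntegral, ← (hasSum_coord_smul_basisVec (vecIntegral α Z ω t)).tsum_eq]
  refine tsum_congr fun j => ?_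
  rw [integralCoord, (hasSum_scalarIntegral h0 h1 hαβ hγ ht hW hZ hω hωc j).tsum_eq]

end Coordinates

/-- A fixed operator commutes with the left derivative and with the Bochner integral. This is what
pulls `S(t)` out of the noise integral. -/
theorem vecIntegral_comp [CompleteSpace E] [CompleteSpace F] {F' : Type*} [NormedAddCommGroup F']
    [NormedSpace ℝ F'] [CompleteSpace F'] (A : F →L[ℝ] F') {Z : ℝ → E →L[ℝ] F} {ω : ℝ → E}
    {α β γ K W t : ℝ} (h0 : 0 < α) (h1 : α < 1) (hαβ : α < β)
    (hγ : 1 - α < γ) (ht : 0 ≤ t) (hW : 0 ≤ W) (hZ : WeightedHolder β t 0 K Z)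
    (hω : HolderBound γ t W ω) :
    vecIntegral α (fun r => A.comp (Z r)) ω t = A (vecIntegral α Z ω t) := by
  have hI := intervalIntegrable_vecIntegrand h0 h1 hαβ hγ le_rfl hW ht le_rfl hZ hω
  rw [vecIntegral, vecIntegral, map_neg, ← A.intervalIntegral_comp_comm hI]
  congr 1
  refine intervalIntegral_congr_Ioo ht fun r hr => ?_
  have hb := hZ.holderBound ht le_rfl
  have h : IntervalIntegrable (fun q => ((r - q) ^ (1 + α))⁻¹ • (Z r - Z q)) volume 0 r :=
    intervalIntegrable_left hαβ hr.1.le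
      ((hb.continuousOn (h0.trans hαβ)).mono (Icc_subset_Icc_right hr.2.le))
      (fun q h0 hq => hb q r h0 hq hr.2.le)
  have := map_fracDerivLeft (ContinuousLinearMap.compL ℝ E F F' A) h
  exact (DFunLike.congr_fun this (fracDerivRight α t ω r)).symm

/-! ### The semigroup -/

/-- The generator is bounded, so negative times make sense. The factorisation separates `t` from
`r`, and increments in time need no comparison of two convolution kernels. -/
theorem semigroup_sub (ν lam t r : ℝ) :
    semigroup ν lam (t - r) = (semigroup ν lam t).comp (semigroup ν lam (-r)) := by
  have h : Commute ((-t) • opALam ν lam) ((-(-r)) • opALam ν lam) :=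
    ((Commute.refl (opALam ν lam)).smul_left _).smul_right _
  let _ : NormedAlgebra ℚ (L2Z →L[ℝ] L2Z) := NormedAlgebra.restrictScalars ℚ ℝ _
  change _ = semigroup ν lam t * semigroup ν lam (-r)
  rw [semigroup, semigroup, semigroup, ← NormedSpace.exp_add_of_commute h, ← add_smul]
  congr 2
  ring

theorem hasDerivAt_semigroup (ν lam t : ℝ) :
    HasDerivAt (semigroup ν lam) (-(semigroup ν lam t * opALam ν lam)) t := by
  have h := hasDerivAt_exp_smul_const (𝕂 := ℝ) (opALam ν lam) (-t)
  have h2 := h.scomp t (hasDerivAt_neg t)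
  have e : semigroup ν lam = fun r => NormedSpace.exp ((-r) • opALam ν lam) := rfl
  rw [e]
  simpa [Function.comp_def] using h2

/-! ### Lipschitz families of operators as multipliers -/

/-- `A` is bounded by `C` and Lipschitz continuous with constant `C` on `[0, T]`. -/
structure LipschitzBound {G : Type*} [NormedAddCommGroup G] (T C : ℝ) (A : ℝ → G) : Prop where
  bound : ∀ t, 0 ≤ t → t ≤ T → ‖A t‖ ≤ C
  lipschitz : ∀ s t, 0 ≤ s → s ≤ t → t ≤ T → ‖A t - A s‖ ≤ C * (t - s)

theorem lipschitzBound_const {G : Type*} [NormedAddCommGroup G] (T : ℝ) (a : G) :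
    LipschitzBound T ‖a‖ (fun _ => a) where
  bound _ _ _ := le_rfl
  lipschitz s t _ hst _ := by
    rw [sub_self, norm_zero]
    exact mul_nonneg (norm_nonneg _) (sub_nonneg.2 hst)

theorem exists_lipschitzBound_of_hasDerivAt {A A' : ℝ → E} (T : ℝ)
    (h : ∀ t, HasDerivAt A (A' t) t) (hc : Continuous A') :
    ∃ C, 0 ≤ C ∧ LipschitzBound T C A := by
  have hA : Continuous A := continuous_iff_continuousAt.2 fun t => (h t).continuousAt
  obtain ⟨C1, h1⟩ := (isCompact_Icc (a := (0 : ℝ)) (b := T)).exists_bound_of_continuousOn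
    hA.continuousOn
  obtain ⟨C2, h2⟩ := (isCompact_Icc (a := (0 : ℝ)) (b := T)).exists_bound_of_continuousOn
    hc.continuousOn
  refine ⟨max 0 (max C1 C2), le_max_left _ _, fun t h0 hT => ?_, fun s t hs hst ht => ?_⟩
  · exact (h1 t ⟨h0, hT⟩).trans ((le_max_left _ _).trans (le_max_right _ _))
  · have := (convex_Icc 0 T).norm_image_sub_le_of_norm_hasDerivWithin_le
      (f := A) (f' := A') (C := max 0 (max C1 C2)) (x := s) (y := t)
      (fun x _ => (h x).hasDerivWithinAt)
      (fun x hx => (h2 x hx).trans ((le_max_right _ _).trans (le_max_right _ _)))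
      ⟨hs, hst.trans ht⟩ ⟨hs.trans hst, ht⟩
    rwa [Real.norm_of_nonneg (sub_nonneg.2 hst)] at this

theorem exists_lipschitzBound_semigroup (ν lam T : ℝ) :
    ∃ C, 0 ≤ C ∧ LipschitzBound T C (semigroup ν lam) ∧
      LipschitzBound T C (fun r => semigroup ν lam (-r)) := by
  have hc : Continuous (semigroup ν lam) :=
    continuous_iff_continuousAt.2 fun t => (hasDerivAt_semigroup ν lam t).continuousAt
  obtain ⟨C1, h1, h1'⟩ := exists_lipschitzBound_of_hasDerivAt T (hasDerivAt_semigroup ν lam)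
    (hc.mul continuous_const).neg
  obtain ⟨C2, h2, h2'⟩ := exists_lipschitzBound_of_hasDerivAt (A := fun r => semigroup ν lam (-r)) T
    (fun t => (hasDerivAt_semigroup ν lam (-t)).scomp t (hasDerivAt_neg t))
    (((hc.comp continuous_neg).mul (continuous_const (y := opALam ν lam))).neg.const_smul (-1 : ℝ))
  refine ⟨max C1 C2, h1.trans (le_max_left _ _), ⟨fun t h0 hT => ?_, fun s t hs hst ht => ?_⟩,
    ⟨fun t h0 hT => ?_, fun s t hs hst ht => ?_⟩⟩
  · exact (h1'.bound t h0 hT).trans (le_max_left _ _)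
  · exact (h1'.lipschitz s t hs hst ht).trans
      (mul_le_mul_of_nonneg_right (le_max_left _ _) (sub_nonneg.2 hst))
  · exact (h2'.bound t h0 hT).trans (le_max_right _ _)
  · exact (h2'.lipschitz s t hs hst ht).trans
      (mul_le_mul_of_nonneg_right (le_max_right _ _) (sub_nonneg.2 hst))

/-- A Lipschitz continuous factor preserves weighted Hölder bounds. -/
theorem WeightedHolder.bilin {G : Type*} [NormedAddCommGroup G] [NormedSpace ℝ G]
    {V : Type*} [NormedAddCommGroup V] [NormedSpace ℝ V] (b : G →L[ℝ] V →L[ℝ] V)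
    (hb : ∀ a v, ‖b a v‖ ≤ ‖a‖ * ‖v‖) {β T ρ K C : ℝ} (hβ : β ≤ 1) (hT : 0 ≤ T)
    (hρ : 0 ≤ ρ) (hC : 0 ≤ C) {A : ℝ → G} {v : ℝ → V} (hA : LipschitzBound T C A)
    (hv : WeightedHolder β T ρ K v) :
    WeightedHolder β T ρ (C * (1 + T ^ (1 - β)) * K) (fun t => b (A t) (v t)) := by
  have hK := hv.nonneg hT
  have hTβ : 0 ≤ T ^ (1 - β) := Real.rpow_nonneg hT _
  refine ⟨fun t h0 ht => ?_, fun s t hs hst ht => ?_⟩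
  · calc _ ≤ ‖A t‖ * ‖v t‖ := hb _ _
      _ ≤ C * (K * Real.exp (ρ * t)) :=
        mul_le_mul (hA.bound t h0 ht) (hv.bound t h0 ht) (norm_nonneg _) hC
      _ = C * 1 * K * Real.exp (ρ * t) := by ring
      _ ≤ _ := by gcongr; linarith
  · have hts : 0 ≤ t - s := sub_nonneg.2 hst
    -- The increment of `A` is paired with the earlier value `v s`, whose weight is at most `exp (ρ
    -- t)`; the surplus `1 - β` of the Lipschitz power becomes `T ^ (1 - β)`.
    have e : b (A t) (v t) - b (A s) (v s) = b (A t) (v t - v s) + b (A t - A s) (v s) := by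
      simp only [map_sub, sub_apply]
      abel
    have h1 : ‖b (A t) (v t - v s)‖ ≤ C * (K * Real.exp (ρ * t) * (t - s) ^ β) :=
      (hb _ _).trans (mul_le_mul (hA.bound t (hs.trans hst) ht) (hv.holder s t hs hst ht)
        (norm_nonneg _) hC)
    have h2 : ‖b (A t - A s) (v s)‖ ≤ C * ((t - s) ^ β * T ^ (1 - β)) * (K * Real.exp (ρ * t)) := by
      refine (hb _ _).trans (mul_le_mul ((hA.lipschitz s t hs hst ht).trans ?_)
        ((hv.bound s hs (hst.trans ht)).trans ?_) (norm_nonneg _) (by positivity))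
      · gcongr
        rcases hts.eq_or_lt with h | h
        · rw [← h]; positivity
        · calc t - s = (t - s) ^ β * (t - s) ^ (1 - β) := by
                rw [← Real.rpow_add h]; simp
            _ ≤ _ := by
                gcongr
                linarith
      · gcongr
    rw [e]
    refine (norm_add_le _ _).trans ((add_le_add h1 h2).trans (le_of_eq ?_))
    ring

/-! ### The nonlinearities -/

theorem norm_le_of_coord_le {u v : L2Z} (h : ∀ i, |u i| ≤ |v i|) : ‖u‖ ≤ ‖v‖ := by
  have := norm_le_of_sq_le (u := u) (v := v) zero_le_one (by
    rw [one_pow, one_mul]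
    exact (summable_sq u).tsum_le_tsum (fun i => sq_le_sq.2 (h i)) (summable_sq v))
  rwa [one_mul] at this

/-- The vector of absolute values of the coordinates. -/
def absVec (u : L2Z) : L2Z :=
  ⟨fun i => |u i|, memlp_iff.2 (by simp only [sq_abs]; exact summable_sq u)⟩

theorem absVec_apply (u : L2Z) (i : ℤ) : absVec u i = |u i| := rfl

theorem norm_absVec_le (u : L2Z) : ‖absVec u‖ ≤ ‖u‖ :=
  norm_le_of_coord_le fun i => by rw [absVec_apply, abs_abs]

theorem abs_sub_le_of_abs_deriv_le {g : ℝ → ℝ} {D : ℝ} (hg : Differentiable ℝ g)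
    (h : ∀ z, |deriv g z| ≤ D) (a b : ℝ) : |g a - g b| ≤ D * |a - b| :=
  Convex.norm_image_sub_le_of_norm_deriv_le (s := univ) (fun x _ => hg x) (fun x _ => h x)
    convex_univ (mem_univ _) (mem_univ _)

/-- Mean value inequality for `θ ↦ g (b + θ (a - b)) - g (d + θ (c - d))` on `[0, 1]`. Its
derivative is `g'` times the difference of the increments, plus a difference of values of `g'` times
`c - d`; the two base points differ by a convex combination of `a - c` and `b - d`. -/
theorem abs_second_difference_le {g : ℝ → ℝ} {D M : ℝ} (hg : ContDiff ℝ 2 g)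
    (h1 : ∀ z, |deriv g z| ≤ D) (h2 : ∀ z, |deriv (deriv g) z| ≤ M) (a b c d : ℝ) :
    |(g a - g b) - (g c - g d)| ≤
      D * |(a - b) - (c - d)| + M * |c - d| * (|a - c| + |b - d|) := by
  have hd : Differentiable ℝ g := hg.differentiable (by norm_num)
  have hd' : Differentiable ℝ (deriv g) :=
    ((contDiff_succ_iff_deriv (n := 1)).1 hg).2.2.differentiable (by norm_num)
  have hM : 0 ≤ M := (abs_nonneg _).trans (h2 0)
  have hder (x : ℝ) : HasDerivAt
      (fun θ : ℝ => g (b + θ * (a - b)) - g (d + θ * (c - d)))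
      (deriv g (b + x * (a - b)) * (a - b) - deriv g (d + x * (c - d)) * (c - d)) x := by
    have e1 : HasDerivAt (fun θ : ℝ => b + θ * (a - b)) (a - b) x := by
      simpa using ((hasDerivAt_id x).mul_const (a - b)).const_add b
    have e2 : HasDerivAt (fun θ : ℝ => d + θ * (c - d)) (c - d) x := by
      simpa using ((hasDerivAt_id x).mul_const (c - d)).const_add d
    exact ((hd _).hasDerivAt.comp x e1).sub ((hd _).hasDerivAt.comp x e2)
  have hbound (x : ℝ) (hx : x ∈ Ico (0 : ℝ) 1) :
      ‖deriv g (b + x * (a - b)) * (a - b) - deriv g (d + x * (c - d)) * (c - d)‖ ≤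
      D * |(a - b) - (c - d)| + M * |c - d| * (|a - c| + |b - d|) := by
    set p := b + x * (a - b) with hp
    set q := d + x * (c - d) with hq
    have e : deriv g p * (a - b) - deriv g q * (c - d) =
        deriv g p * ((a - b) - (c - d)) + (deriv g p - deriv g q) * (c - d) := by ring
    have hpq : |p - q| ≤ |a - c| + |b - d| := by
      have e3 : p - q = x * (a - c) + (1 - x) * (b - d) := by rw [hp, hq]; ring
      rw [e3]
      refine (abs_add_le _ _).trans ?_
      rw [abs_mul, abs_mul, abs_of_nonneg hx.1, abs_of_nonneg (sub_nonneg.2 hx.2.le)]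
      have := abs_nonneg (a - c)
      have := abs_nonneg (b - d)
      have := hx.1
      have := hx.2
      nlinarith
    rw [e, Real.norm_eq_abs]
    refine (abs_add_le _ _).trans (add_le_add ?_ ?_)
    · rw [abs_mul]
      gcongr
      exact h1 p
    · rw [abs_mul]
      calc _ ≤ (M * |p - q|) * |c - d| := by
            gcongr
            exact abs_sub_le_of_abs_deriv_le hd' h2 p q
        _ ≤ (M * (|a - c| + |b - d|)) * |c - d| := by gcongr
        _ = _ := by ring
  have := norm_image_sub_le_of_norm_deriv_le_segment_01'
    (fun x _ => (hder x).hasDerivWithinAt) hbound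
  simp only [one_mul, zero_mul, add_zero, add_sub_cancel, Real.norm_eq_abs] at this
  calc _ = |g a - g c - (g b - g d)| := by congr 1; ring
    _ ≤ _ := this

theorem norm_superposition_sub_le {f : ℤ → ℝ → ℝ} (hf : DriftAssumption f) {D : ℝ} (hD : 0 ≤ D)
    (hfD : ∀ i z, |deriv (f i) z| ≤ D) (u v : L2Z) :
    ‖superposition hf u - superposition hf v‖ ≤ D * ‖u - v‖ := by
  calc _ ≤ ‖D • (u - v)‖ := norm_le_of_coord_le fun i => by
        change |f i (u i) - f i (v i)| ≤ |D * (u i - v i)|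
        rw [abs_mul, abs_of_nonneg hD]
        exact abs_sub_le_of_abs_deriv_le ((hf.contDiff i).differentiable (by norm_num)) (hfD i) _ _
    _ = _ := by rw [norm_smul, Real.norm_of_nonneg hD]

theorem norm_superposition_second_difference_le {h : ℤ → ℝ → ℝ} (hh : DiffusionAssumption h)
    {D M : ℝ} (hD : 0 ≤ D) (hM : 0 ≤ M) (h1 : ∀ i z, |deriv (h i) z| ≤ D)
    (h2 : ∀ i z, |deriv (deriv (h i)) z| ≤ M) (a b c d : L2Z) :
    ‖(superposition hh.toDrift a - superposition hh.toDrift b) -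
      (superposition hh.toDrift c - superposition hh.toDrift d)‖ ≤
      D * ‖(a - b) - (c - d)‖ + M * ‖c - d‖ * (‖a - c‖ + ‖b - d‖) := by
  have hMc : 0 ≤ M * ‖c - d‖ := by positivity
  calc _ ≤ ‖D • absVec ((a - b) - (c - d)) +
        (M * ‖c - d‖) • (absVec (a - c) + absVec (b - d))‖ := norm_le_of_coord_le fun i => by
        change |(h i (a i) - h i (b i)) - (h i (c i) - h i (d i))| ≤
          |D * |(a i - b i) - (c i - d i)| + (M * ‖c - d‖) * (|a i - c i| + |b i - d i|)|
        refine le_trans ?_ (le_abs_self _)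
        refine (abs_second_difference_le (hh.contDiff i) (h1 i) (h2 i) _ _ _ _).trans ?_
        -- The product of two increments is estimated in the supremum norm for one factor and in the
        -- square sum norm for the other.
        have : |c i - d i| ≤ ‖c - d‖ := norm_coord_le (c - d) i
        gcongr
    _ ≤ _ := by
        refine (norm_add_le _ _).trans ?_
        rw [norm_smul, norm_smul, Real.norm_of_nonneg hD, Real.norm_of_nonneg hMc]
        have := norm_absVec_le ((a - b) - (c - d))
        have := (norm_add_le (absVec (a - c)) (absVec (b - d))).trans
          (add_le_add (norm_absVec_le _) (norm_absVec_le _))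
        gcongr

/-- Superposition operators preserve weighted Hölder bounds, with linear growth. -/
theorem weightedHolder_superposition {f : ℤ → ℝ → ℝ} (hf : DriftAssumption f) {D : ℝ} (hD : 0 ≤ D)
    (hfD : ∀ i z, |deriv (f i) z| ≤ D) {β T ρ K : ℝ} (hT : 0 ≤ T) (hρ : 0 ≤ ρ) {u : ℝ → L2Z}
    (hu : WeightedHolder β T ρ K u) :
    WeightedHolder β T ρ (‖superposition hf 0‖ + D * K) (fun t => superposition hf (u t)) := by
  have hK := hu.nonneg hT
  refine ⟨fun t h0 ht => ?_, fun s t hs hst ht => ?_⟩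
  · have h1 := norm_superposition_sub_le hf hD hfD (u t) 0
    rw [sub_zero] at h1
    have h2 : ‖superposition hf (u t)‖ ≤ ‖superposition hf 0‖ + D * ‖u t‖ := by
      have := norm_le_norm_add_norm_sub' (superposition hf (u t)) (superposition hf 0)
      linarith
    have h3 : 1 ≤ Real.exp (ρ * t) := Real.one_le_exp (by positivity)
    have h4 := mul_le_mul_of_nonneg_left (hu.bound t h0 ht) hD
    have h5 := le_mul_of_one_le_right (norm_nonneg (superposition hf 0)) h3
    rw [add_mul]
    linarith
  · have hts : 0 ≤ t - s := sub_nonneg.2 hst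
    calc _ ≤ D * ‖u t - u s‖ := norm_superposition_sub_le hf hD hfD _ _
      _ ≤ D * (K * Real.exp (ρ * t) * (t - s) ^ β) := by
        gcongr; exact hu.holder s t hs hst ht
      _ = (0 + D * K) * Real.exp (ρ * t) * (t - s) ^ β := by ring
      _ ≤ _ := by gcongr; exact norm_nonneg _

/-- The second difference bound is applied to `u t`, `v t`, `u s`, `v s`. Its quadratic term
multiplies `u s - v s` by increments of `u` and `v`; measuring the latter without weight keeps a
single exponential and puts `R` into the constant. -/
theorem weightedHolder_superposition_sub {h : ℤ → ℝ → ℝ} (hh : DiffusionAssumption h)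
    {D M : ℝ} (hD : 0 ≤ D) (hM : 0 ≤ M) (h1 : ∀ i z, |deriv (h i) z| ≤ D)
    (h2 : ∀ i z, |deriv (deriv (h i)) z| ≤ M) {β T ρ K R : ℝ} (hT : 0 ≤ T) (hρ : 0 ≤ ρ)
    {u v : ℝ → L2Z} (hu : WeightedHolder β T 0 R u) (hv : WeightedHolder β T 0 R v)
    (huv : WeightedHolder β T ρ K (fun t => u t - v t)) :
    WeightedHolder β T ρ ((D + 2 * M * R) * K)
      (fun t => superposition hh.toDrift (u t) - superposition hh.toDrift (v t)) := by
  have hK := huv.nonneg hT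
  have hR := hu.nonneg hT
  refine ⟨fun t h0 ht => ?_, fun s t hs hst ht => ?_⟩
  · calc _ ≤ D * ‖u t - v t‖ := norm_superposition_sub_le _ hD h1 _ _
      _ ≤ D * (K * Real.exp (ρ * t)) := by gcongr; exact huv.bound t h0 ht
      _ = (D + 0) * K * Real.exp (ρ * t) := by ring
      _ ≤ _ := by gcongr; positivity
  · have hts : 0 ≤ t - s := sub_nonneg.2 hst
    have b1 := huv.holder s t hs hst ht
    have b2 := hu.holder s t hs hst ht
    have b3 := hv.holder s t hs hst ht
    have b4 : ‖u s - v s‖ ≤ K * Real.exp (ρ * t) :=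
      (huv.bound s hs (hst.trans ht)).trans (by gcongr)
    simp only [zero_mul, Real.exp_zero, mul_one] at b2 b3
    calc _ ≤ _ := norm_superposition_second_difference_le hh hD hM h1 h2 _ _ _ _
      _ ≤ D * (K * Real.exp (ρ * t) * (t - s) ^ β) + M * (K * Real.exp (ρ * t)) *
          (R * (t - s) ^ β + R * (t - s) ^ β) := by gcongr
      _ = _ := by ring

theorem norm_diagOp_le (a : L2Z) : ‖diagOp a‖ ≤ ‖a‖ :=
  LinearMap.mkContinuous_norm_le _ (norm_nonneg a) _

theorem diagOp_sub (a b : L2Z) : diagOp a - diagOp b = diagOp (a - b) := by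
  ext v i
  exact (sub_mul (a i) (b i) (v i)).symm

theorem WeightedHolder.diagOp {β T ρ K : ℝ} {a : ℝ → L2Z} (h : WeightedHolder β T ρ K a) :
    WeightedHolder β T ρ K (fun t => diagOp (a t)) where
  bound t h0 ht := (norm_diagOp_le _).trans (h.bound t h0 ht)
  holder s t hs hst ht := by
    rw [diagOp_sub]
    exact (norm_diagOp_le _).trans (h.holder s t hs hst ht)

/-! ### Picard iteration in weighted Hölder bounds -/

section Picard

variable {G : Type*} [NormedAddCommGroup G] {β T : ℝ}

/-- Closedness of the bounds under pointwise limits takes the place of completeness of a Hölder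
space. -/
theorem WeightedHolder.of_tendsto {ρ K : ℝ} {v : ℕ → ℝ → G} {w : ℝ → G}
    (h : ∀ᶠ n in Filter.atTop, WeightedHolder β T ρ K (v n))
    (hlim : ∀ t, 0 ≤ t → t ≤ T → Filter.Tendsto (fun n => v n t) Filter.atTop (nhds (w t))) :
    WeightedHolder β T ρ K w where
  bound t h0 ht := le_of_tendsto (hlim t h0 ht).norm (h.mono fun _ hn => hn.bound t h0 ht)
  holder s t hs hst ht := le_of_tendsto
    ((hlim t (hs.trans hst) ht).sub (hlim s hs (hst.trans ht))).norm
    (h.mono fun _ hn => hn.holder s t hs hst ht)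

theorem WeightedHolder.neg {ρ K : ℝ} {v : ℝ → G} (h : WeightedHolder β T ρ K v) :
    WeightedHolder β T ρ K (fun t => -v t) where
  bound t h0 ht := by rw [norm_neg]; exact h.bound t h0 ht
  holder s t hs hst ht := by
    rw [neg_sub_neg, norm_sub_rev]; exact h.holder s t hs hst ht

theorem WeightedHolder.sub {ρ K K' : ℝ} {v w : ℝ → G} (h : WeightedHolder β T ρ K v)
    (h' : WeightedHolder β T ρ K' w) : WeightedHolder β T ρ (K + K') (fun t => v t - w t) := by
  simpa only [sub_eq_add_neg] using h.add h'.neg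

theorem weightedHolder_zero {ρ K : ℝ} (hK : 0 ≤ K) :
    WeightedHolder β T ρ K (fun _ => (0 : G)) where
  bound t _ _ := by rw [norm_zero]; positivity
  holder s t _ hst _ := by
    have := sub_nonneg.2 hst
    rw [sub_zero, norm_zero]; positivity

theorem eq_zero_of_weightedHolder_pow {ρ K : ℝ} {v : ℝ → G}
    (h : ∀ n : ℕ, WeightedHolder β T ρ (K / 2 ^ n) v) {t : ℝ} (h0 : 0 ≤ t) (ht : t ≤ T) :
    v t = 0 := by
  have hlim : Filter.Tendsto (fun n : ℕ => K / 2 ^ n * Real.exp (ρ * t)) Filter.atTop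
      (nhds 0) := by
    have h1 := tendsto_pow_atTop_nhds_zero_of_lt_one (r := (1 / 2 : ℝ)) (by norm_num) (by norm_num)
    have h2 := (h1.const_mul K).mul_const (Real.exp (ρ * t))
    simp only [mul_zero, zero_mul] at h2
    refine h2.congr fun n => ?_
    rw [one_div, inv_pow, div_eq_mul_inv]
  exact norm_le_zero_iff.1 (ge_of_tendsto' hlim fun n => (h n).bound t h0 ht)

/-- Banach's fixed point argument with two weights: the ball is invariant for `ρ₀`, while
differences are halved in the possibly larger weight `ρ`. The iterates starting at zero converge
pointwise on `[0, T]`, and both kinds of bounds pass to the limit. -/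
theorem exists_fixedPoint_of_weightedHolder [CompleteSpace G] {ρ₀ ρ R : ℝ} (hT : 0 ≤ T)
    (hρ : ρ₀ ≤ ρ) (hR : 0 ≤ R)
    (Φ : (ℝ → G) → ℝ → G)
    (hinv : ∀ u, WeightedHolder β T ρ₀ R u → WeightedHolder β T ρ₀ R (Φ u))
    (hcontr : ∀ u v K, WeightedHolder β T ρ₀ R u → WeightedHolder β T ρ₀ R v →
      WeightedHolder β T ρ K (fun t => u t - v t) →
      WeightedHolder β T ρ (K / 2) (fun t => Φ u t - Φ v t)) :
    ∃ u, WeightedHolder β T ρ₀ R u ∧ EqOn u (Φ u) (Icc 0 T) := by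
  let U : ℕ → ℝ → G := fun n => Φ^[n] (fun _ => 0)
  have hU0 : U 0 = fun _ => 0 := rfl
  have hUs (n : ℕ) : U (n + 1) = Φ (U n) := Function.iterate_succ_apply' Φ n _
  have hball (n : ℕ) : WeightedHolder β T ρ₀ R (U n) := by
    induction n with
    | zero => exact weightedHolder_zero hR
    | succ n ih => rw [hUs]; exact hinv _ ih
  have hstep (n : ℕ) : WeightedHolder β T ρ (R / 2 ^ n) (fun t => U (n + 1) t - U n t) := by
    induction n with
    | zero =>
      have := (hball 1).mono_weight hT hρ
      simpa [hU0] using this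
    | succ n ih =>
      have := hcontr _ _ _ (hball (n + 1)) (hball n) ih
      rw [← hUs, ← hUs, div_div, ← pow_succ] at this
      exact this
  -- The constant is the exact geometric sum of `R / 2 ^ m` over `n ≤ m < n + k`.
  have htele (n k : ℕ) : WeightedHolder β T ρ (R * (2 - 2 / 2 ^ k) / 2 ^ n)
      (fun t => U (n + k) t - U n t) := by
    induction k with
    | zero => simpa using weightedHolder_zero (G := G) (β := β) (T := T) (ρ := ρ) le_rfl
    | succ k ih =>
      have := (hstep (n + k)).add ih
      simp only [sub_add_sub_cancel] at this
      have e : R / 2 ^ (n + k) + R * (2 - 2 / 2 ^ k) / 2 ^ n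
          = R * (2 - 2 / 2 ^ (k + 1)) / 2 ^ n := by
        rw [pow_add, pow_succ]
        field_simp
        ring
      rw [e] at this
      exact this
  have hcauchy (t : ℝ) (h0 : 0 ≤ t) (ht : t ≤ T) : CauchySeq fun n => U n t := by
    refine cauchySeq_of_le_geometric_two (C := 2 * (R * Real.exp (ρ * t))) fun n => ?_
    rw [dist_comm, dist_eq_norm]
    refine ((hstep n).bound t h0 ht).trans (le_of_eq ?_)
    ring
  have hex (t : ℝ) : ∃ y, 0 ≤ t → t ≤ T → Filter.Tendsto (fun n => U n t) Filter.atTop (nhds y) := by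
    by_cases h : 0 ≤ t ∧ t ≤ T
    · obtain ⟨y, hy⟩ := cauchySeq_tendsto_of_complete (hcauchy t h.1 h.2)
      exact ⟨y, fun _ _ => hy⟩
    · exact ⟨0, fun h0 ht => absurd ⟨h0, ht⟩ h⟩
  choose u hu using hex
  have huball : WeightedHolder β T ρ₀ R u := .of_tendsto (.of_forall hball) hu
  have hdist (n : ℕ) : WeightedHolder β T ρ (2 * R / 2 ^ n) (fun t => u t - U n t) := by
    refine .of_tendsto (v := fun k t => U (n + k) t - U n t) (.of_forall fun k => ?_) ?_
    · refine (htele n k).mono ?_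
      have : (0 : ℝ) ≤ 2 / 2 ^ k := by positivity
      refine div_le_div_of_nonneg_right ?_ (by positivity)
      nlinarith [mul_nonneg hR this]
    · intro t h0 ht
      refine Filter.Tendsto.sub_const ?_ _
      simp only [add_comm n]
      exact (Filter.tendsto_add_atTop_iff_nat n).2 (hu t h0 ht)
  refine ⟨u, huball, fun t ht => ?_⟩
  -- The defect `u - Φ u` is split at `U (n + 1) = Φ (U n)`: the first part is the distance of an
  -- iterate from the limit, the second is controlled by contraction. The bound holds for every `n`,
  -- so the defect vanishes.
  have h2 (n : ℕ) : WeightedHolder β T ρ (4 * R / 2 ^ n) (fun t => u t - Φ u t) := by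
    have a := hcontr _ _ _ (hball n) huball (by
      simpa only [neg_sub] using (hdist n).neg)
    rw [← hUs] at a
    have b := (hdist (n + 1)).add a
    simp only [sub_add_sub_cancel] at b
    refine b.mono ?_
    have : 2 * R / 2 ^ (n + 1) + 2 * R / 2 ^ n / 2 = 2 * R / 2 ^ n := by
      rw [pow_succ]; field_simp; ring
    rw [this]
    gcongr
    linarith
  exact sub_eq_zero.1 (eq_zero_of_weightedHolder_pow h2 ht.1 ht.2)

end Picard

/-! ### The mild solution map -/

theorem vecIntegral_sub [CompleteSpace E] [CompleteSpace F] {Z Z' : ℝ → E →L[ℝ] F} {ω : ℝ → E}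
    {α β γ ρ K K' W t : ℝ} (h0 : 0 < α) (h1 : α < 1) (hαβ : α < β) (hγ : 1 - α < γ)
    (ht : 0 ≤ t) (hρ : 0 ≤ ρ) (hW : 0 ≤ W) (hZ : WeightedHolder β t ρ K Z)
    (hZ' : WeightedHolder β t ρ K' Z') (hω : HolderBound γ t W ω) :
    vecIntegral α (fun r => Z r - Z' r) ω t = vecIntegral α Z ω t - vecIntegral α Z' ω t := by
  have i1 := intervalIntegrable_vecIntegrand h0 h1 hαβ hγ hρ hW ht le_rfl hZ hω
  have i2 := intervalIntegrable_vecIntegrand h0 h1 hαβ hγ hρ hW ht le_rfl hZ' hω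
  rw [vecIntegral, vecIntegral, vecIntegral, neg_sub_neg, ← intervalIntegral.integral_sub i2 i1,
    ← intervalIntegral.integral_neg]
  refine intervalIntegral_congr_Ioo ht fun r hr => ?_
  have hint {Y : ℝ → E →L[ℝ] F} {M : ℝ} (hY : WeightedHolder β t ρ M Y) :
      IntervalIntegrable (fun q => ((r - q) ^ (1 + α))⁻¹ • (Y r - Y q)) volume 0 r :=
    intervalIntegrable_left hαβ hr.1.le
      ((hY.continuousOn ht hρ (h0.trans hαβ)).mono (Icc_subset_Icc_right hr.2.le))
      (fun q h0 hq => hY.holderBound ht hρ q r h0 hq hr.2.le)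
  have e : fracDerivLeft α (fun r => Z r - Z' r) r = fracDerivLeft α Z r - fracDerivLeft α Z' r := by
    have e1 : ∫ q in (0 : ℝ)..r, ((r - q) ^ (1 + α))⁻¹ • ((Z r - Z' r) - (Z q - Z' q)) =
        (∫ q in (0 : ℝ)..r, ((r - q) ^ (1 + α))⁻¹ • (Z r - Z q)) -
          ∫ q in (0 : ℝ)..r, ((r - q) ^ (1 + α))⁻¹ • (Z' r - Z' q) := by
      rw [← intervalIntegral.integral_sub (hint hZ) (hint hZ')]
      refine intervalIntegral.integral_congr fun q _ => ?_
      simp only [← smul_sub]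
      congr 1
      abel
    rw [fracDerivLeft, fracDerivLeft, fracDerivLeft, e1]
    module
  rw [e, sub_apply, neg_sub]

/-- The parameters and the path of a fractional integral over subintervals of `[0, T]`. -/
structure YoungSetting {G : Type*} [NormedAddCommGroup G] (α β γ T W : ℝ) (ω : ℝ → G) : Prop where
  α_pos : 0 < α
  α_lt_one : α < 1
  α_lt_β : α < β
  β_lt_γ : β < γ
  γ_gt : 1 - α < γ
  γ_lt_one : γ < 1
  T_nonneg : 0 ≤ T
  W_nonneg : 0 ≤ W
  holder : HolderBound γ T W ω
  continuous : Continuous ω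

theorem YoungSetting.β_pos {G : Type*} [NormedAddCommGroup G] {α β γ T W : ℝ}
    {ω : ℝ → G} (h : YoungSetting α β γ T W ω) : 0 < β :=
  h.α_pos.trans h.α_lt_β

theorem YoungSetting.β_lt_one {G : Type*} [NormedAddCommGroup G] {α β γ T W : ℝ}
    {ω : ℝ → G} (h : YoungSetting α β γ T W ω) :
    β < 1 := h.β_lt_γ.trans h.γ_lt_one

/-- The sum of the two convolution integrals with the semigroup. -/
def convolution (ν lam α : ℝ) (ω : ℝ → L2Z) (f : ℝ → L2Z) (Z : ℝ → L2Z →L[ℝ] L2Z) (t : ℝ) : L2Z :=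
  semigroup ν lam t ((∫ r in (0 : ℝ)..t, semigroup ν lam (-r) (f r)) +
    vecIntegral α (fun r => (semigroup ν lam (-r)).comp (Z r)) ω t)

section Convolution

variable {ν lam α β γ T W : ℝ} {ω : ℝ → L2Z}

theorem continuous_semigroup (ν lam : ℝ) : Continuous (semigroup ν lam) :=
  continuous_iff_continuousAt.2 fun t => (hasDerivAt_semigroup ν lam t).continuousAt

theorem continuousOn_semigroup_neg_apply (ν lam : ℝ) {f : ℝ → L2Z} {s : Set ℝ}
    (hf : ContinuousOn f s) : ContinuousOn (fun r => semigroup ν lam (-r) (f r)) s :=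
  ((continuous_semigroup ν lam).comp continuous_neg).continuousOn.clm_apply hf

theorem WeightedHolder.semigroup_comp (hβ : β ≤ 1) (hT : 0 ≤ T) {ρ K C : ℝ} (hρ : 0 ≤ ρ)
    (hC : 0 ≤ C) {A : ℝ → L2Z →L[ℝ] L2Z} (hA : LipschitzBound T C A)
    {Z : ℝ → L2Z →L[ℝ] L2Z} (hZ : WeightedHolder β T ρ K Z) :
    WeightedHolder β T ρ (C * (1 + T ^ (1 - β)) * K) (fun r => (A r).comp (Z r)) :=
  hZ.bilin (ContinuousLinearMap.compL ℝ L2Z L2Z L2Z)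
    (fun a v => ContinuousLinearMap.opNorm_comp_le a v) hβ hT hρ hC hA

theorem WeightedHolder.mono_right {G : Type*} [NormedAddCommGroup G] {ρ K T' : ℝ} {v : ℝ → G}
    (h : WeightedHolder β T ρ K v) (hT : T' ≤ T) : WeightedHolder β T' ρ K v where
  bound t h0 ht := h.bound t h0 (ht.trans hT)
  holder s t hs hst ht := h.holder s t hs hst (ht.trans hT)

/-- The constant is fixed before `ρ`, so the gain `ρ ^ (-(γ - β))` can later be made as small as
desired. The drift needs only a supremum bound, since time integration supplies its Hölder
regularity. -/
theorem exists_weightedHolder_convolution (ν lam : ℝ) (hS : YoungSetting α β γ T W ω) :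
    ∃ C, 0 ≤ C ∧ ∀ ρ K f Z, 1 ≤ ρ → ContinuousOn f (Icc 0 T) →
      (∀ r, 0 ≤ r → r ≤ T → ‖f r‖ ≤ K * Real.exp (ρ * r)) → WeightedHolder β T ρ K Z →
      WeightedHolder β T ρ (C * ρ ^ (-(γ - β)) * K) (convolution ν lam α ω f Z) := by
  obtain ⟨C, hC, hC1, hC2⟩ := exists_lipschitzBound_semigroup ν lam T
  have hT := hS.T_nonneg
  have hβ0 := hS.β_pos
  have hβ1 := hS.β_lt_one
  have hc := fracConst_nonneg hS.α_pos hS.α_lt_one hS.α_lt_β hS.γ_gt hT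
  have hW := hS.W_nonneg
  refine ⟨C * (1 + T ^ (1 - β)) * (C * (1 / β) * (1 + T ^ β) +
    fracConst α β γ T * W * (C * (1 + T ^ (1 - β))) * (1 + T ^ β)), by positivity, ?_⟩
  intro ρ K f Z hρ hf hfK hZ
  have hK := hZ.nonneg hT
  have hρ0 : 0 < ρ := by linarith
  have a1 : WeightedHolder β T ρ (C * K * ρ ^ (-(1 - β)) * (1 / β) * (1 + T ^ β))
      (fun t => ∫ r in (0 : ℝ)..t, semigroup ν lam (-r) (f r)) := by
    refine weightedHolder_integral hβ0 hβ1 hρ0 hT (by positivity)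
      (continuousOn_semigroup_neg_apply ν lam hf) fun r h0 hr => ?_
    refine (ContinuousLinearMap.le_opNorm _ _).trans ?_
    rw [mul_assoc]
    exact mul_le_mul (hC2.bound r h0 hr) (hfK r h0 hr) (norm_nonneg _) hC
  -- The Lebesgue integral gains `ρ ^ (-(1 - β))`, which is at least as good because `γ < 1` and `1
  -- ≤ ρ`.
  have a1' := a1.mono (K' := C * K * ρ ^ (-(γ - β)) * (1 / β) * (1 + T ^ β)) (by
    have := hS.γ_lt_one
    gcongr)
  have a2 := weightedHolder_vecIntegral hS.α_pos hS.α_lt_one hS.α_lt_β hS.γ_gt hS.β_lt_γ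
    hS.γ_lt_one.le hρ0 hW hT (hZ.semigroup_comp hβ1.le hT hρ0.le hC hC2) hS.holder
  have a3 := (a1'.add a2).bilin (ContinuousLinearMap.id ℝ (L2Z →L[ℝ] L2Z))
    (fun a v => a.le_opNorm v) hβ1.le hT hρ0.le hC hC1
  refine (a3.mono (le_of_eq ?_))
  ring

theorem convolution_sub (hS : YoungSetting α β γ T W ω) {ρ K K' : ℝ} (hρ : 0 ≤ ρ)
    {f f' : ℝ → L2Z} {Z Z' : ℝ → L2Z →L[ℝ] L2Z} (hf : ContinuousOn f (Icc 0 T))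
    (hf' : ContinuousOn f' (Icc 0 T)) (hZ : WeightedHolder β T ρ K Z)
    (hZ' : WeightedHolder β T ρ K' Z') {t : ℝ} (h0 : 0 ≤ t) (ht : t ≤ T) :
    convolution ν lam α ω (fun r => f r - f' r) (fun r => Z r - Z' r) t =
      convolution ν lam α ω f Z t - convolution ν lam α ω f' Z' t := by
  obtain ⟨C, hC, hC1, hC2⟩ := exists_lipschitzBound_semigroup ν lam T
  have hsub : uIcc 0 t ⊆ Icc 0 T := by
    rw [uIcc_of_le h0]; exact Icc_subset_Icc_right ht
  have e1 := vecIntegral_sub hS.α_pos hS.α_lt_one hS.α_lt_β hS.γ_gt h0 hρ hS.W_nonneg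
    ((hZ.semigroup_comp hS.β_lt_one.le hS.T_nonneg hρ hC hC2).mono_right ht)
    ((hZ'.semigroup_comp hS.β_lt_one.le hS.T_nonneg hρ hC hC2).mono_right ht)
    (hS.holder.mono_right ht)
  have e2 := intervalIntegral.integral_sub
    ((continuousOn_semigroup_neg_apply ν lam hf).mono hsub).intervalIntegrable
    ((continuousOn_semigroup_neg_apply ν lam hf').mono hsub).intervalIntegrable
    (μ := volume)
  rw [convolution, convolution, convolution, ← map_sub]
  simp only [map_sub, ContinuousLinearMap.comp_sub]
  rw [e1, e2, ← map_sub]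
  congr 1
  abel

end Convolution

/-- The right hand side of the mild equation, with the semigroup at the final time pulled out of
the integrals. -/
def mildMap (ν lam α : ℝ) {f h : ℤ → ℝ → ℝ} (hf : DriftAssumption f)
    (hh : DiffusionAssumption h) (ω : ℝ → L2Z) (x : L2Z) (u : ℝ → L2Z) (t : ℝ) : L2Z :=
  semigroup ν lam t x + convolution ν lam α ω (fun r => superposition hf (u r))
    (fun r => diffusionOp hh (u r)) t

section MildMap

variable {ν lam α β γ T W : ℝ} {ω : ℝ → L2Z} {f h : ℤ → ℝ → ℝ} (hf : DriftAssumption f)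
  (hh : DiffusionAssumption h)

/-- The growth in `K` is affine, and only the part coming from the integrals carries the small
factor; the initial value enters the additive constant alone. Hence an invariant ball exists on all
of `[0, T]`, with no restriction to short times. -/
theorem exists_weightedHolder_mildMap (ν lam : ℝ) (hS : YoungSetting α β γ T W ω) (x : L2Z) :
    ∃ C, 0 ≤ C ∧ ∀ ρ K u, 1 ≤ ρ → WeightedHolder β T ρ K u →
      WeightedHolder β T ρ (C + C * ρ ^ (-(γ - β)) * (1 + K)) (mildMap ν lam α hf hh ω x u) := by
  obtain ⟨C, hC, hconv⟩ := exists_weightedHolder_convolution ν lam hS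
  obtain ⟨C', hC', hC1, -⟩ := exists_lipschitzBound_semigroup ν lam T
  obtain ⟨Df, hDf, hf1⟩ := hf.deriv_bdd
  obtain ⟨Dh, hDh, hh1⟩ := hh.deriv_bdd
  have hT := hS.T_nonneg
  set a := ‖superposition hf 0‖ with ha
  set b := ‖superposition hh.toDrift 0‖ with hb
  have ha0 : 0 ≤ a := norm_nonneg _
  have hb0 : 0 ≤ b := norm_nonneg _
  refine ⟨C' * (1 + T ^ (1 - β)) * ‖x‖ + C * (a + Df + b + Dh), by positivity, ?_⟩
  intro ρ K u hρ hu
  have hρ0 : 0 ≤ ρ := by linarith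
  have hK := hu.nonneg hT
  have h1 := (weightedHolder_superposition hf hDf hf1 hT hρ0 hu).mono
    (K' := (a + Df + b + Dh) * (1 + K)) (by rw [← ha]; nlinarith)
  have h2 := ((weightedHolder_superposition hh.toDrift hDh hh1 hT hρ0 hu).mono
    (K' := (a + Df + b + Dh) * (1 + K)) (by rw [← hb]; nlinarith)).diagOp
  have h3 := hconv ρ _ _ _ hρ (h1.continuousOn hT hρ0 hS.β_pos) h1.bound h2
  have h4 : WeightedHolder β T ρ ‖x‖ (fun _ => x) := by
    refine ⟨fun t h0 ht => ?_, fun s t hs hst ht => ?_⟩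
    · exact le_mul_of_one_le_right (norm_nonneg x) (Real.one_le_exp (by positivity))
    · have := sub_nonneg.2 hst
      rw [sub_self, norm_zero]; positivity
  have h5 := h4.bilin (ContinuousLinearMap.id ℝ (L2Z →L[ℝ] L2Z))
    (fun a v => a.le_opNorm v) hS.β_lt_one.le hT hρ0 hC' hC1
  refine (h5.add h3).mono ?_
  have hp : 0 ≤ ρ ^ (-(γ - β)) * (1 + K) := by positivity
  have h6 : 0 ≤ C' * (1 + T ^ (1 - β)) * ‖x‖ * (ρ ^ (-(γ - β)) * (1 + K)) := by positivity
  have h7 : 0 ≤ C * (a + Df + b + Dh) := by positivity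
  linarith

/-- The radius `R` is unweighted and chosen before `ρ`, so the constant depends on `R` but not on
the weight used for the difference. The initial terms cancel. -/
theorem exists_weightedHolder_mildMap_sub (ν lam : ℝ) (hS : YoungSetting α β γ T W ω) (x : L2Z)
    {R : ℝ} (hR : 0 ≤ R) :
    ∃ C, 0 ≤ C ∧ ∀ ρ K u v, 1 ≤ ρ → WeightedHolder β T 0 R u → WeightedHolder β T 0 R v →
      WeightedHolder β T ρ K (fun t => u t - v t) →
      WeightedHolder β T ρ (C * ρ ^ (-(γ - β)) * K)
        (fun t => mildMap ν lam α hf hh ω x u t - mildMap ν lam α hf hh ω x v t) := by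
  obtain ⟨C, hC, hconv⟩ := exists_weightedHolder_convolution ν lam hS
  obtain ⟨Df, hDf, hf1⟩ := hf.deriv_bdd
  obtain ⟨Dh, hDh, hh1⟩ := hh.deriv_bdd
  obtain ⟨M, hM, hh2⟩ := hh.deriv2_bdd
  have hT := hS.T_nonneg
  refine ⟨C * (Df + (Dh + 2 * M * R)), by positivity, ?_⟩
  intro ρ K u v hρ hu hv huv
  have hρ0 : 0 ≤ ρ := by linarith
  have hK := huv.nonneg hT
  have fu := weightedHolder_superposition hf hDf hf1 hT le_rfl hu
  have fv := weightedHolder_superposition hf hDf hf1 hT le_rfl hv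
  have zu := (weightedHolder_superposition hh.toDrift hDh hh1 hT le_rfl hu).diagOp
  have zv := (weightedHolder_superposition hh.toDrift hDh hh1 hT le_rfl hv).diagOp
  have cu := fu.continuousOn hT le_rfl hS.β_pos
  have cv := fv.continuousOn hT le_rfl hS.β_pos
  have h2 := ((weightedHolder_superposition_sub hh hDh hM hh1 hh2 hT hρ0 hu hv huv).mono
    (K' := (Df + (Dh + 2 * M * R)) * K) (by
      have := mul_nonneg hDf hK
      linarith)).diagOp
  simp only [← diagOp_sub] at h2
  have h3 := hconv ρ ((Df + (Dh + 2 * M * R)) * K) _ _ hρ (cu.sub cv) (fun r h0 hr => by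
    calc _ ≤ Df * ‖u r - v r‖ := norm_superposition_sub_le hf hDf hf1 _ _
      _ ≤ Df * (K * Real.exp (ρ * r)) := by gcongr; exact huv.bound r h0 hr
      _ = (Df + 0) * K * Real.exp (ρ * r) := by ring
      _ ≤ _ := by gcongr; positivity) h2
  refine (h3.mono (le_of_eq (by ring))).congr fun t ht => ?_
  simp only [mildMap, add_sub_add_left_eq_sub]
  exact (convolution_sub hS le_rfl cu cv zu zv ht.1 ht.2).symm

/-! ### Choice of the weights, existence and uniqueness -/

theorem exists_weight (C c δ : ℝ) (hδ : 0 < δ) (hc : 0 < c) :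
    ∃ ρ₁ : ℝ, 1 ≤ ρ₁ ∧ ∀ ρ, ρ₁ ≤ ρ → C * ρ ^ (-δ) ≤ c := by
  have h := (tendsto_rpow_neg_atTop hδ).const_mul C
  rw [mul_zero] at h
  obtain ⟨ρ₁, h1⟩ := Filter.eventually_atTop.1 (h.eventually (ge_mem_nhds hc))
  exact ⟨max 1 ρ₁, le_max_left _ _, fun ρ hρ => h1 ρ ((le_max_right _ _).trans hρ)⟩

theorem exists_fixedPoint_mildMap (ν lam : ℝ) (hS : YoungSetting α β γ T W ω) (x : L2Z) :
    ∃ u R, WeightedHolder β T 0 R u ∧ EqOn u (mildMap ν lam α hf hh ω x u) (Icc 0 T) := by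
  have hδ : 0 < γ - β := sub_pos.2 hS.β_lt_γ
  have hT := hS.T_nonneg
  obtain ⟨C, hC, hgrow⟩ := exists_weightedHolder_mildMap hf hh ν lam hS x
  obtain ⟨ρ₀, h1, hρ₀⟩ := exists_weight C (1 / 2) _ hδ (by norm_num)
  have hρ₀0 : 0 ≤ ρ₀ := by linarith
  -- The radius `R = 2 C + 1` solves `C + (1 + R) / 2 = R`, the invariance condition once `C * ρ₀ ^
  -- (-(γ - β)) ≤ 1 / 2`.
  have hR : 0 ≤ 2 * C + 1 := by linarith
  -- The contraction constant depends on the unweighted radius of the ball just fixed, so the second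
  -- weight can be chosen only now.
  obtain ⟨C', hC', hcontr⟩ := exists_weightedHolder_mildMap_sub hf hh ν lam hS x
    (R := (2 * C + 1) * Real.exp (ρ₀ * T)) (by positivity)
  obtain ⟨ρ₁, h2, hρ₁⟩ := exists_weight C' (1 / 2) _ hδ (by norm_num)
  obtain ⟨u, hu, hfix⟩ := exists_fixedPoint_of_weightedHolder (β := β) hT (le_max_left ρ₀ ρ₁) hR
    (mildMap ν lam α hf hh ω x) (fun u hu => (hgrow ρ₀ _ u h1 hu).mono (by
      have := mul_le_mul_of_nonneg_right (hρ₀ ρ₀ le_rfl) (show 0 ≤ 1 + (2 * C + 1) by linarith)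
      linarith))
    (fun u v K hu hv huv => (hcontr _ K u v (h2.trans (le_max_right _ _)) (hu.unweight hT hρ₀0)
      (hv.unweight hT hρ₀0) huv).mono (by
        have := mul_le_mul_of_nonneg_right (hρ₁ _ (le_max_right ρ₀ ρ₁)) (huv.nonneg hT)
        linarith))
  exact ⟨u, _, hu.unweight hT hρ₀0, hfix⟩

/-- No invariant ball is needed: both solutions lie in the ball of radius `max R R'`, and their
difference, being its own image, can be halved indefinitely. -/
theorem fixedPoint_mildMap_unique (hS : YoungSetting α β γ T W ω) {x : L2Z}
    {u v : ℝ → L2Z} {R R' : ℝ} (hu : WeightedHolder β T 0 R u) (hv : WeightedHolder β T 0 R' v)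
    (hfu : EqOn u (mildMap ν lam α hf hh ω x u) (Icc 0 T))
    (hfv : EqOn v (mildMap ν lam α hf hh ω x v) (Icc 0 T)) : EqOn v u (Icc 0 T) := by
  have hδ : 0 < γ - β := sub_pos.2 hS.β_lt_γ
  have hT := hS.T_nonneg
  have hu' := hu.mono (le_max_left R R')
  have hv' := hv.mono (le_max_right R R')
  obtain ⟨C, hC, hcontr⟩ := exists_weightedHolder_mildMap_sub hf hh ν lam hS x (hu'.nonneg hT)
  obtain ⟨ρ, h1, hρ⟩ := exists_weight C (1 / 2) _ hδ (by norm_num)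
  have hpow (n : ℕ) : WeightedHolder β T ρ ((R' + R) / 2 ^ n) (fun t => v t - u t) := by
    induction n with
    | zero => simpa using (hv.sub hu).mono_weight hT (by linarith : (0 : ℝ) ≤ ρ)
    | succ n ih =>
      refine ((hcontr ρ _ v u h1 hv' hu' ih).mono ?_).congr fun t ht => ?_
      · have := mul_le_mul_of_nonneg_right (hρ ρ le_rfl) (ih.nonneg hT)
        rw [pow_succ, ← div_div]
        linarith
      · simp only
        rw [← hfu ht, ← hfv ht]
  exact fun t ht => sub_eq_zero.1 (eq_zero_of_weightedHolder_pow hpow ht.1 ht.2)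

theorem noiseIntegrand_eq (u : ℝ → L2Z) (t : ℝ) :
    noiseIntegrand ν lam hh u t = fun r => (semigroup ν lam t).comp
      ((semigroup ν lam (-r)).comp (diffusionOp hh (u r))) := by
  ext r : 1
  rw [noiseIntegrand, semigroup_sub, ContinuousLinearMap.comp_assoc]

theorem driftIntegrand_eq (u : ℝ → L2Z) (t : ℝ) :
    driftIntegrand ν lam hf u t = fun r => semigroup ν lam t
      (semigroup ν lam (-r) (superposition hf (u r))) := by
  ext r : 1
  rw [driftIntegrand, semigroup_sub, ContinuousLinearMap.comp_apply]

theorem mildIntegrable_and_mildMap_eq (ν lam : ℝ) (hS : YoungSetting α β γ T W ω) {R : ℝ}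
    {u : ℝ → L2Z} (hu : WeightedHolder β T 0 R u) :
    MildIntegrable ν lam α T hf hh ω u ∧ ∀ x, ∀ t ∈ Icc 0 T,
      semigroup ν lam t x + (∫ r in (0 : ℝ)..t, driftIntegrand ν lam hf u t r)
        + fracIntegral α 0 t (noiseIntegrand ν lam hh u t) ω = mildMap ν lam α hf hh ω x u t := by
  obtain ⟨C, hC, hC1, hC2⟩ := exists_lipschitzBound_semigroup ν lam T
  obtain ⟨Df, hDf, hf1⟩ := hf.deriv_bdd
  obtain ⟨Dh, hDh, hh1⟩ := hh.deriv_bdd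
  have hT := hS.T_nonneg
  have cf := (weightedHolder_superposition hf hDf hf1 hT le_rfl hu).continuousOn hT le_rfl hS.β_pos
  have hY : WeightedHolder β T 0 _ (fun r => (semigroup ν lam (-r)).comp (diffusionOp hh (u r))) :=
    ((weightedHolder_superposition hh.toDrift hDh hh1 hT le_rfl hu).diagOp).semigroup_comp
    hS.β_lt_one.le hT le_rfl hC hC2
  have hdrift (t : ℝ) (ht : t ∈ Icc 0 T) : IntervalIntegrable
      (fun r => semigroup ν lam (-r) (superposition hf (u r))) volume 0 t :=
    ((continuousOn_semigroup_neg_apply ν lam cf).mono (by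
      rw [uIcc_of_le ht.1]; exact Icc_subset_Icc_right ht.2)).intervalIntegrable
  -- For fixed `t` the factor `S(t)` is a constant family in `r`, hence trivially Lipschitz.
  have hZ (t : ℝ) (ht : t ∈ Icc 0 T) := (hY.mono_right ht.2).semigroup_comp hS.β_lt_one.le ht.1
    le_rfl (norm_nonneg _) (lipschitzBound_const t (semigroup ν lam t))
  refine ⟨fun t ht => ⟨?_, ?_⟩, fun x t ht => ?_⟩
  · rw [driftIntegrand_eq]
    exact map_intervalIntegrable _ (hdrift t ht)
  · rw [noiseIntegrand_eq]
    exact fracIntegrable_of_weightedHolder hS.α_pos hS.α_lt_one hS.α_lt_β hS.γ_gt ht.1 hS.W_nonneg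
      (hZ t ht) (hS.holder.mono_right ht.2) hS.continuous
  · rw [driftIntegrand_eq, noiseIntegrand_eq, fracIntegral_eq_vecIntegral hS.α_pos hS.α_lt_one
      hS.α_lt_β hS.γ_gt ht.1 hS.W_nonneg (hZ t ht) (hS.holder.mono_right ht.2) hS.continuous,
      ContinuousLinearMap.intervalIntegral_comp_comm _ (hdrift t ht), mildMap, convolution,
      map_add, add_assoc]
    congr 2
    exact vecIntegral_comp (semigroup ν lam t) hS.α_pos hS.α_lt_one hS.α_lt_β hS.γ_gt ht.1
      hS.W_nonneg (hY.mono_right ht.2) (hS.holder.mono_right ht.2)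

end MildMap

/-! ### Hölder spaces -/

theorem norm_sub_le_of_holderOnWith {G : Type*} [NormedAddCommGroup G] {β C : ℝ≥0} {a b : ℝ}
    {u : ℝ → G}
    (h : HolderOnWith C β u (Icc a b)) {s t : ℝ} (hs : a ≤ s) (hst : s ≤ t) (ht : t ≤ b) :
    ‖u t - u s‖ ≤ C * (t - s) ^ (β : ℝ) := by
  have := h.dist_le ⟨hs.trans hst, ht⟩ ⟨hs, hst.trans ht⟩
  rwa [dist_eq_norm, Real.dist_eq, abs_of_nonneg (sub_nonneg.2 hst)] at this

theorem holderOnWith_of_norm_sub_le {G : Type*} [NormedAddCommGroup G] {β C : ℝ≥0} {a b : ℝ}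
    {u : ℝ → G}
    (h : ∀ s t, a ≤ s → s ≤ t → t ≤ b → ‖u t - u s‖ ≤ C * (t - s) ^ (β : ℝ)) :
    HolderOnWith C β u (Icc a b) := by
  intro x hx y hy
  rw [edist_dist, edist_dist, ENNReal.ofReal_rpow_of_nonneg dist_nonneg β.coe_nonneg,
    ← ENNReal.ofReal_coe_nnreal, ← ENNReal.ofReal_mul C.coe_nonneg]
  refine ENNReal.ofReal_le_ofReal ?_
  rcases le_total x y with hxy | hxy
  · rw [dist_comm, dist_comm x, dist_eq_norm, Real.dist_eq, abs_of_nonneg (sub_nonneg.2 hxy)]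
    exact h x y hx.1 hxy hy.2
  · rw [dist_eq_norm, Real.dist_eq, abs_of_nonneg (sub_nonneg.2 hxy)]
    exact h y x hy.1 hxy hx.2

theorem isHolderOn_iff_weightedHolder {β : ℝ≥0} {T : ℝ} (hT : 0 ≤ T) {u : ℝ → L2Z} :
    IsHolderOn β 0 T u ↔ ∃ R, WeightedHolder β T 0 R u := by
  constructor
  · rintro ⟨C, hC⟩
    have hu0 := norm_nonneg (u 0)
    have hTβ : 0 ≤ T ^ (β : ℝ) := Real.rpow_nonneg hT _
    refine ⟨‖u 0‖ + C * (1 + T ^ (β : ℝ)), fun t h0 ht => ?_, fun s t hs hst ht => ?_⟩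
    · have h1 := norm_sub_le_of_holderOnWith hC le_rfl h0 ht
      rw [sub_zero] at h1
      have h2 : (C : ℝ) * t ^ (β : ℝ) ≤ C * T ^ (β : ℝ) := by gcongr
      have h3 := norm_le_norm_add_norm_sub' (u t) (u 0)
      have h4 := C.coe_nonneg
      simp only [zero_mul, Real.exp_zero, mul_one]
      linarith
    · simp only [zero_mul, Real.exp_zero, mul_one]
      refine (norm_sub_le_of_holderOnWith hC hs hst ht).trans ?_
      have := sub_nonneg.2 hst
      have h4 := C.coe_nonneg
      have := mul_nonneg h4 hTβ
      gcongr
      linarith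
  · rintro ⟨R, hR⟩
    refine ⟨R.toNNReal, holderOnWith_of_norm_sub_le fun s t hs hst ht => ?_⟩
    rw [Real.coe_toNNReal _ (hR.nonneg hT)]
    simpa using hR.holder s t hs hst ht

theorem exists_youngSetting {α T : ℝ} {β γ : ℝ≥0} {ω : ℝ → L2Z} (hω : ω ∈ holderPaths γ)
    (hα1 : 1 - (γ : ℝ) < α) (hα2 : α < β) (hβγ : (β : ℝ) < γ) (hγ1 : (γ : ℝ) < 1) (hT : 0 ≤ T) :
    ∃ W, YoungSetting α β γ T W ω := by
  obtain ⟨W, hW⟩ := hω.2 0 T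
  refine ⟨W, by linarith, by linarith, hα2, hβγ, by linarith, hγ1, hT, W.coe_nonneg,
    fun s t hs hst ht => norm_sub_le_of_holderOnWith hW hs hst ht, ?_⟩
  have hγ0 : 0 < γ := by
    have : (0 : ℝ) < γ := β.coe_nonneg.trans_lt hβγ
    exact_mod_cast this
  refine continuous_iff_continuousAt.2 fun t => ?_
  -- Two-sided neighbourhoods are needed: integrability over `[0, 0]` already asks for the left
  -- limit of the path at zero.
  obtain ⟨C, hC⟩ := hω.2 (t - 1) (t + 1)
  exact (hC.continuousOn hγ0).continuousAt (Icc_mem_nhds (by linarith) (by linarith))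

theorem existsUnique_mild_solution {α : ℝ} {β γ : ℝ≥0} (hβγ : (β : ℝ) < γ) (hγ1 : (γ : ℝ) < 1)
    (hα1 : 1 - (γ : ℝ) < α) (hα2 : α < β) (ν lam : ℝ) {f h : ℤ → ℝ → ℝ}
    (hf : DriftAssumption f) (hh : DiffusionAssumption h) {ω : ℝ → L2Z} (hω : ω ∈ holderPaths γ)
    {T : ℝ} (hT : 0 ≤ T) (x : L2Z) :
    (∀ u : ℝ → L2Z, IsHolderOn β 0 T u → MildIntegrable ν lam α T hf hh ω u) ∧
    ∃ u : ℝ → L2Z, (IsHolderOn β 0 T u ∧ MildEquation ν lam α T hf hh ω x u) ∧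
      ∀ v : ℝ → L2Z, IsHolderOn β 0 T v ∧ MildEquation ν lam α T hf hh ω x v →
        EqOn v u (Icc 0 T) := by
  obtain ⟨W, hS⟩ := exists_youngSetting hω hα1 hα2 hβγ hγ1 hT
  refine ⟨fun u hu => ?_, ?_⟩
  · obtain ⟨R, hR⟩ := (isHolderOn_iff_weightedHolder hT).1 hu
    exact (mildIntegrable_and_mildMap_eq hf hh ν lam hS hR).1
  · obtain ⟨u, R, hu, hfix⟩ := exists_fixedPoint_mildMap hf hh ν lam hS x
    refine ⟨u, ⟨(isHolderOn_iff_weightedHolder hT).2 ⟨R, hu⟩, fun t ht => ?_⟩, ?_⟩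
    · rw [(mildIntegrable_and_mildMap_eq hf hh ν lam hS hu).2 x t ht]
      exact hfix ht
    · rintro v ⟨hv, hve⟩
      obtain ⟨R', hR'⟩ := (isHolderOn_iff_weightedHolder hT).1 hv
      refine fixedPoint_mildMap_unique hf hh hS hu hR' hfix fun t ht => ?_
      rw [← (mildIntegrable_and_mildMap_eq hf hh ν lam hS hR').2 x t ht]
      exact hve t ht

/-! ### Hölder continuity from dyadic increments -/

section Dyadic

variable {G : Type*} [NormedAddCommGroup G] {f : ℝ → G} {C q : ℝ} {N : ℕ}

/-- The largest dyadic point of level `n` below `t`. -/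
def dyadicFloor (n : ℕ) (t : ℝ) : ℝ := (⌊(2 : ℝ) ^ n * t⌋ : ℝ) / 2 ^ n

theorem abs_dyadicFloor_sub_le (n : ℕ) (t : ℝ) : |dyadicFloor n t - t| ≤ (1 / 2) ^ n := by
  have h2 : (0 : ℝ) < 2 ^ n := by positivity
  have e : dyadicFloor n t - t = ((⌊(2 : ℝ) ^ n * t⌋ : ℝ) - 2 ^ n * t) / 2 ^ n := by
    rw [dyadicFloor]; field_simp
  have h3 := Int.floor_le ((2 : ℝ) ^ n * t)
  have h4 := Int.lt_floor_add_one ((2 : ℝ) ^ n * t)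
  rw [e, abs_div, abs_of_pos h2, one_div, inv_pow, ← one_div]
  gcongr
  rw [abs_le]
  constructor <;> linarith

theorem tendsto_dyadicFloor (t : ℝ) :
    Filter.Tendsto (fun n => dyadicFloor n t) Filter.atTop (nhds t) := by
  rw [tendsto_iff_norm_sub_tendsto_zero]
  exact squeeze_zero (fun _ => norm_nonneg _) (fun n => abs_dyadicFloor_sub_le n t)
    (tendsto_pow_atTop_nhds_zero_of_lt_one (by norm_num) (by norm_num))

theorem neg_le_floor_dyadic {t : ℝ} (ht : -(N : ℝ) ≤ t) (n : ℕ) :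
    -((N : ℤ) * 2 ^ n) ≤ ⌊(2 : ℝ) ^ n * t⌋ := by
  rw [Int.le_floor]
  push_cast
  have h2 : (0 : ℝ) < 2 ^ n := by positivity
  nlinarith

theorem floor_dyadic_le {t : ℝ} (ht : t ≤ N) (n : ℕ) :
    ⌊(2 : ℝ) ^ n * t⌋ ≤ (N : ℤ) * 2 ^ n := by
  have h : ((⌊(2 : ℝ) ^ n * t⌋ : ℤ) : ℝ) ≤ (((N : ℤ) * 2 ^ n : ℤ) : ℝ) := by
    refine (Int.floor_le _).trans ?_
    push_cast
    have h2 : (0 : ℝ) < 2 ^ n := by positivity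
    nlinarith
  exact_mod_cast h

/-- The floor `m'` at level `n + 1` is `2 m` or `2 m + 1`, where `m` is the floor at level `n`. The
two dyadic points thus coincide or are neighbours at the finer level. -/
theorem norm_dyadicFloor_succ_sub_le (hq : 0 ≤ C * q)
    (hq0 : 0 ≤ q)
    (h : ∀ (n : ℕ) (k : ℤ), -((N : ℤ) * 2 ^ n) ≤ k → k < (N : ℤ) * 2 ^ n →
      ‖f (((k + 1 : ℤ) : ℝ) / 2 ^ n) - f ((k : ℝ) / 2 ^ n)‖ ≤ C * q ^ n)
    {t : ℝ} (ht0 : -(N : ℝ) ≤ t) (ht1 : t ≤ N) (n : ℕ) :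
    ‖f (dyadicFloor (n + 1) t) - f (dyadicFloor n t)‖ ≤ C * q * q ^ n := by
  have hm0 := neg_le_floor_dyadic ht0 n
  have hm1' := floor_dyadic_le ht1 (n + 1)
  unfold dyadicFloor
  set m := ⌊(2 : ℝ) ^ n * t⌋ with hm
  set m' := ⌊(2 : ℝ) ^ (n + 1) * t⌋ with hm'
  have h1 : 2 * m ≤ m' := by
    rw [hm', Int.le_floor]
    push_cast
    have := Int.floor_le ((2 : ℝ) ^ n * t)
    rw [pow_succ]
    linarith
  have h2 : m' < 2 * m + 2 := by
    rw [hm', Int.floor_lt]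
    push_cast
    have := Int.lt_floor_add_one ((2 : ℝ) ^ n * t)
    rw [pow_succ]
    linarith
  have e : ((2 * m : ℤ) : ℝ) / 2 ^ (n + 1) = (m : ℝ) / 2 ^ n := by
    push_cast
    rw [pow_succ]
    field_simp
  obtain h3 | h3 : m' = 2 * m ∨ m' = 2 * m + 1 := by lia
  · rw [h3, e, sub_self, norm_zero]
    positivity
  · rw [h3, ← e]
    refine (h (n + 1) (2 * m) ?_ ?_).trans (le_of_eq (by rw [pow_succ]; ring))
    · rw [pow_succ]; linarith
    · lia

/-- Points at distance at most `2 ^ (-n)` have equal or adjacent floors at level `n`. -/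
theorem norm_dyadicFloor_sub_le (hC : 0 ≤ C) (hq0 : 0 ≤ q)
    (h : ∀ (n : ℕ) (k : ℤ), -((N : ℤ) * 2 ^ n) ≤ k → k < (N : ℤ) * 2 ^ n →
      ‖f (((k + 1 : ℤ) : ℝ) / 2 ^ n) - f ((k : ℝ) / 2 ^ n)‖ ≤ C * q ^ n)
    {s t : ℝ} (hs : -(N : ℝ) ≤ s) (hst : s ≤ t) (ht : t ≤ N) (n : ℕ)
    (hn : t - s ≤ (1 / 2) ^ n) :
    ‖f (dyadicFloor n t) - f (dyadicFloor n s)‖ ≤ C * q ^ n := by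
  have h2 : (0 : ℝ) < 2 ^ n := by positivity
  have hm0 := neg_le_floor_dyadic hs n
  have hm1' := floor_dyadic_le ht n
  have hts : (2 : ℝ) ^ n * t ≤ 2 ^ n * s + 1 := by
    rw [one_div, inv_pow] at hn
    have := mul_le_mul_of_nonneg_left hn h2.le
    rw [mul_inv_cancel₀ h2.ne'] at this
    linarith
  unfold dyadicFloor
  set m := ⌊(2 : ℝ) ^ n * s⌋ with hm
  set m' := ⌊(2 : ℝ) ^ n * t⌋ with hm'
  have h3 : m ≤ m' := Int.floor_le_floor (by gcongr)
  have h4 : m' ≤ m + 1 := by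
    rw [hm, ← Int.floor_add_one]
    exact Int.floor_le_floor hts
  obtain h5 | h5 : m' = m ∨ m' = m + 1 := by lia
  · rw [h5, sub_self, norm_zero]
    positivity
  · rw [h5]
    exact h n m hm0 (by lia)

/-- Chaining: `f t` is the limit of `f` along the dyadic floors of `t`, by continuity, with a
geometric tail. At the level matching `t - s` one compares the two floors and adds both tails;
distances above one are handled by the maximum of `f`. -/
theorem exists_holder_of_dyadic (hf : Continuous f) {γ : ℝ} (hγ : 0 < γ) (hC : 0 ≤ C)
    (h : ∀ (n : ℕ) (k : ℤ), -((N : ℤ) * 2 ^ n) ≤ k → k < (N : ℤ) * 2 ^ n →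
      ‖f (((k + 1 : ℤ) : ℝ) / 2 ^ n) - f ((k : ℝ) / 2 ^ n)‖ ≤ C * ((1 / 2 : ℝ) ^ γ) ^ n) :
    ∃ C' : ℝ≥0, ∀ s t, -(N : ℝ) ≤ s → s ≤ t → t ≤ N → ‖f t - f s‖ ≤ C' * (t - s) ^ γ := by
  set q : ℝ := (1 / 2 : ℝ) ^ γ with hq
  have hq0 : 0 < q := by positivity
  have hq1 : q < 1 := Real.rpow_lt_one (by norm_num) (by norm_num) hγ
  have hq1' : 0 < 1 - q := by linarith
  have hlim (t : ℝ) (h0 : -(N : ℝ) ≤ t) (h1 : t ≤ N) (n : ℕ) :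
      ‖f (dyadicFloor n t) - f t‖ ≤ C * q * q ^ n / (1 - q) := by
    have := dist_le_of_le_geometric_of_tendsto q (C * q) hq1 (f := fun n => f (dyadicFloor n t))
      (fun n => by
        rw [dist_comm, dist_eq_norm]
        exact norm_dyadicFloor_succ_sub_le (by positivity) hq0.le h h0 h1 n)
      ((hf.tendsto t).comp (tendsto_dyadicFloor t)) n
    rwa [dist_eq_norm] at this
  obtain ⟨M, hM⟩ := (isCompact_Icc (a := -(N : ℝ)) (b := N)).exists_bound_of_continuousOn
    hf.continuousOn
  have hM0 : 0 ≤ M := (norm_nonneg _).trans (hM 0 ⟨by simp, by simp⟩)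
  have hK : 0 ≤ (2 * (C * q) / (1 - q) + C) / q := by positivity
  refine ⟨((2 * (C * q) / (1 - q) + C) / q + 2 * M).toNNReal, fun s t hs hst ht => ?_⟩
  rw [Real.coe_toNNReal _ (by positivity)]
  rcases hst.eq_or_lt with rfl | hlt
  · simp [Real.zero_rpow hγ.ne']
  have hts : 0 < t - s := sub_pos.2 hlt
  rcases le_total (t - s) 1 with h1 | h1
  · obtain ⟨n, hn1, hn2⟩ := exists_nat_pow_near_of_lt_one hts h1
      (show (0 : ℝ) < 1 / 2 by norm_num) (by norm_num)
    have a1 := hlim t (hs.trans hst) ht n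
    have a2 := hlim s hs (hst.trans ht) n
    have a3 := norm_dyadicFloor_sub_le hC hq0.le h hs hst ht n hn2
    have a4 : q ^ (n + 1) ≤ (t - s) ^ γ := by
      rw [hq, ← Real.rpow_natCast, ← Real.rpow_mul (by norm_num), mul_comm,
        Real.rpow_mul (by norm_num), Real.rpow_natCast]
      exact Real.rpow_le_rpow (by positivity) hn1.le hγ.le
    have e : f t - f s = -(f (dyadicFloor n t) - f t) + (f (dyadicFloor n t) - f (dyadicFloor n s))
        + (f (dyadicFloor n s) - f s) := by abel
    have a5 : ‖f t - f s‖ ≤ C * q * q ^ n / (1 - q) + C * q ^ n + C * q * q ^ n / (1 - q) := by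
      rw [e]
      refine (norm_add_le _ _).trans (add_le_add ((norm_add_le _ _).trans (add_le_add ?_ a3)) a2)
      rwa [norm_neg]
    calc _ ≤ _ := a5
      _ = (2 * (C * q) / (1 - q) + C) / q * q ^ (n + 1) := by
        rw [pow_succ]; field_simp; ring
      _ ≤ (2 * (C * q) / (1 - q) + C) / q * (t - s) ^ γ := by gcongr
      _ ≤ _ := by gcongr; linarith
  · have a1 := hM t ⟨hs.trans hst, ht⟩
    have a2 := hM s ⟨hs, hst.trans ht⟩
    have a3 : 1 ≤ (t - s) ^ γ := Real.one_le_rpow h1 hγ.le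
    calc _ ≤ ‖f t‖ + ‖f s‖ := norm_sub_le _ _
      _ ≤ (0 + 2 * M) * 1 := by linarith
      _ ≤ _ := by gcongr

end Dyadic

/-! ### Moments of the increments -/

theorem lintegral_finsetSum_rpow_le {Ω ι : Type*} [MeasurableSpace Ω] {P : Measure Ω} {p : ℝ}
    (hp : 1 ≤ p) {a : ι → Ω → ℝ≥0∞} (ha : ∀ i, AEMeasurable (a i) P) (s : Finset ι) :
    (∫⁻ w, (∑ i ∈ s, a i w) ^ p ∂P) ^ (1 / p) ≤ ∑ i ∈ s, (∫⁻ w, a i w ^ p ∂P) ^ (1 / p) := by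
  classical
  have hp0 : 0 < p := by linarith
  induction s using Finset.induction_on with
  | empty => simp [hp0]
  | insert i s hi ih =>
    simp only [Finset.sum_insert hi]
    refine (ENNReal.lintegral_Lp_add_le (ha i)
      (Finset.aemeasurable_fun_sum s fun i _ => ha i) hp).trans ?_
    gcongr

/-- Minkowski's inequality for countable sums of nonnegative functions. -/
theorem lintegral_tsum_rpow_le {Ω ι : Type*} [Countable ι] [MeasurableSpace Ω] {P : Measure Ω}
    {p : ℝ} (hp : 1 ≤ p) {a : ι → Ω → ℝ≥0∞} (ha : ∀ i, AEMeasurable (a i) P) :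
    ∫⁻ w, (∑' i, a i w) ^ p ∂P ≤ (∑' i, (∫⁻ w, a i w ^ p ∂P) ^ (1 / p)) ^ p := by
  have hp0 : 0 < p := by linarith
  have e (w : Ω) : (∑' i, a i w) ^ p = ⨆ s : Finset ι, (∑ i ∈ s, a i w) ^ p := by
    rw [ENNReal.tsum_eq_iSup_sum]
    exact (ENNReal.orderIsoRpow p hp0).map_iSup _
  simp only [e]
  rw [lintegral_iSup_directed
    (fun s => (Finset.aemeasurable_fun_sum s fun i _ => ha i).pow_const p)]
  · refine iSup_le fun s => ?_
    rw [← ENNReal.rpow_le_rpow_iff (show 0 < 1 / p by positivity), ← ENNReal.rpow_mul,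
      mul_one_div_cancel hp0.ne', ENNReal.rpow_one]
    exact (lintegral_finsetSum_rpow_le hp ha s).trans (ENNReal.sum_le_tsum s)
  · refine Monotone.directed_le fun s t hst w => ?_
    exact ENNReal.rpow_le_rpow (Finset.sum_le_sum_of_subset hst) hp0.le

/-- Exposes the norm as a sum of squares: Minkowski's inequality in `L^p` then applies to the
squared coordinates, and measurability of the norm follows from that of the coordinates. -/
theorem enorm_rpow_two_mul (v : L2Z) (p : ℝ) :
    ‖v‖ₑ ^ (2 * p) = (∑' i, ‖v i‖ₑ ^ (2 : ℝ)) ^ p := by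
  rw [ENNReal.rpow_mul]
  congr 1
  have h (x : ℝ) : ‖x‖ₑ ^ (2 : ℝ) = ENNReal.ofReal (x ^ 2) := by
    rw [Real.enorm_eq_ofReal_abs, ENNReal.ofReal_rpow_of_nonneg (abs_nonneg _) (by norm_num)]
    norm_num
  simp only [h]
  rw [← ENNReal.ofReal_tsum_of_nonneg (fun i => sq_nonneg _) (summable_sq v), ← norm_sq_eq,
    ← ofReal_norm, ENNReal.ofReal_rpow_of_nonneg (norm_nonneg _) (by norm_num)]
  norm_num

theorem tsum_enorm_rpow_two_lt_top (v : L2Z) : ∑' i, ‖v i‖ₑ ^ (2 : ℝ) < ∞ := by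
  have h := enorm_rpow_two_mul v 1
  rw [ENNReal.rpow_one] at h
  rw [← h]
  exact ENNReal.rpow_lt_top_of_nonneg (by norm_num) enorm_ne_top

theorem measurable_enorm_rpow {Ω : Type*} [MeasurableSpace Ω] {X : Ω → L2Z}
    (hX : ∀ i, Measurable fun w => X w i) (p : ℝ) : Measurable fun w => ‖X w‖ₑ ^ (2 * p) := by
  simp only [enorm_rpow_two_mul]
  exact (Measurable.tsum fun i => ((hX i).enorm).pow_const _).pow_const _

/-- The absolute moment of order `p` of the standard normal distribution. -/
def gaussianMoment (p : ℝ) : ℝ≥0∞ := ∫⁻ x, ‖x‖ₑ ^ p ∂(gaussianReal 0 1)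

theorem gaussianMoment_lt_top {p : ℝ} (hp : 0 < p) : gaussianMoment p < ∞ := by
  have h := (memLp_id_gaussianReal (μ := 0) (v := 1) p.toNNReal).2
  have := lintegral_rpow_enorm_lt_top_of_eLpNorm_lt_top
    (by simpa using hp) (by simp) h
  simpa [Real.coe_toNNReal _ hp.le, gaussianMoment] using this

/-- The law of `X` is that of `c` times a standard normal variable, whatever the sign of `c`. -/
theorem lintegral_enorm_rpow_gaussian {Ω : Type*} [MeasurableSpace Ω] {P : Measure Ω} {X : Ω → ℝ}
    (hX : HasGaussianLaw X P) (hm : Measurable X) (h0 : ∫ w, X w ∂P = 0) {c : ℝ}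
    (hv : Var[X; P] = c ^ 2) {p : ℝ} (hp : 0 ≤ p) :
    ∫⁻ w, ‖X w‖ₑ ^ p ∂P = ‖c‖ₑ ^ p * gaussianMoment p := by
  have h1 := hX.map_eq_gaussianReal
  have h2 := gaussianReal_map_const_mul (μ := 0) (v := 1) c
  have h3 : P.map X = (gaussianReal 0 1).map (fun x => c * x) := by
    rw [h1, h2, h0, hv, mul_zero, mul_one]
    congr 1
    ext
    simp [sq_nonneg]
  have hmeas : Measurable fun x : ℝ => ‖x‖ₑ ^ p := by fun_prop
  calc _ = ∫⁻ x, ‖x‖ₑ ^ p ∂(P.map X) := (lintegral_map hmeas hm).symm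
    _ = ∫⁻ x, ‖c * x‖ₑ ^ p ∂(gaussianReal 0 1) := by
      rw [h3, lintegral_map hmeas (by fun_prop)]
    _ = _ := by
      simp only [enorm_mul, ENNReal.mul_rpow_of_nonneg _ _ hp]
      rw [lintegral_const_mul _ hmeas, gaussianMoment]

section FBM

variable {Ω : Type*} [MeasurableSpace Ω] {P : Measure Ω} {H : ℝ} {σ : L2Z} {B : ℝ → Ω → L2Z}

theorem IsFBM.variance_sub [IsProbabilityMeasure P] (hB : IsFBM H σ B P) (hH : 0 < H)
    (s t : ℝ) (i : ℤ) :
    Var[fun w => B t w i - B s w i; P] = (σ i * |t - s| ^ H) ^ 2 := by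
  have hL (r : ℝ) : MemLp (fun w => B r w i) 2 P := ((hB.gaussian i).hasGaussianLaw_eval r).memLp_two
  have hvar (r : ℝ) : Var[fun w => B r w i; P] = σ i ^ 2 * |r| ^ (2 * H) := by
    rw [← covariance_self (hB.measurable r i).aemeasurable, hB.covariance, sub_self, abs_zero,
      Real.zero_rpow (by positivity)]
    ring
  rw [variance_fun_sub (hL t) (hL s), hvar, hvar, hB.covariance, mul_pow, ← Real.rpow_natCast,
    ← Real.rpow_natCast (|t - s| ^ H), ← Real.rpow_mul (abs_nonneg _), abs_sub_comm s t]
  norm_num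
  rw [mul_comm H 2]
  ring

/-- By Gaussian scaling, the `L^p` norm of the `i`-th squared increment is `σ_i ^ 2` times a
quantity common to all coordinates. Minkowski's sum therefore factorises and converges because `σ`
is square summable. -/
theorem IsFBM.lintegral_enorm_sub_le [IsProbabilityMeasure P] (hB : IsFBM H σ B P) (hH : 0 < H)
    {p : ℝ} (hp : 1 ≤ p) :
    ∃ M : ℝ≥0∞, M < ∞ ∧ ∀ s t, ∫⁻ w, ‖B t w - B s w‖ₑ ^ (2 * p) ∂P ≤
      M * ENNReal.ofReal (|t - s| ^ (H * (2 * p))) := by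
  have hp0 : 0 < p := by linarith
  set m := gaussianMoment (2 * p) with hm
  have hm_top : m < ∞ := gaussianMoment_lt_top (by positivity)
  set S := ∑' i, ‖σ i‖ₑ ^ (2 : ℝ) with hS
  refine ⟨S ^ p * m, ENNReal.mul_lt_top
    (ENNReal.rpow_lt_top_of_nonneg hp0.le (tsum_enorm_rpow_two_lt_top σ).ne) hm_top,
    fun s t => ?_⟩
  have hmeas (i : ℤ) : Measurable fun w => (B t w - B s w) i :=
    (hB.measurable t i).sub (hB.measurable s i)
  have hcoord (i : ℤ) : (∫⁻ w, (‖(B t w - B s w) i‖ₑ ^ (2 : ℝ)) ^ p ∂P) ^ (1 / p) =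
      ‖σ i‖ₑ ^ (2 : ℝ) * (ENNReal.ofReal (|t - s| ^ (H * 2)) * m ^ (1 / p)) := by
    have hint (r : ℝ) : Integrable (fun w => B r w i) P :=
      ((hB.gaussian i).hasGaussianLaw_eval r).memLp_two.integrable (by norm_num)
    have h0 : ∫ w, (B t w - B s w) i ∂P = 0 := by
      have := integral_sub (hint t) (hint s)
      rw [hB.centered, hB.centered, sub_zero] at this
      exact this
    have h1 := lintegral_enorm_rpow_gaussian (p := 2 * p)
      (hB.gaussian i).hasGaussianLaw_fun_sub (hmeas i) h0 (hB.variance_sub hH s t i) (by positivity)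
    simp only [← ENNReal.rpow_mul]
    refine (congrArg (· ^ (1 / p)) h1).trans ?_
    simp only
    rw [ENNReal.mul_rpow_of_nonneg _ _ (by positivity), ← ENNReal.rpow_mul, mul_assoc 2 p,
      mul_one_div_cancel hp0.ne', mul_one, enorm_mul, ENNReal.mul_rpow_of_nonneg _ _ (by norm_num),
      mul_assoc, Real.enorm_of_nonneg (by positivity : (0 : ℝ) ≤ |t - s| ^ H),
      ENNReal.ofReal_rpow_of_nonneg (by positivity) (by norm_num), ← Real.rpow_mul (abs_nonneg _)]
  simp only [enorm_rpow_two_mul]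
  refine (lintegral_tsum_rpow_le hp
    (fun i => ((hmeas i).enorm.pow_const _).aemeasurable)).trans (le_of_eq ?_)
  simp only [hcoord]
  rw [ENNReal.tsum_mul_right, ENNReal.mul_rpow_of_nonneg _ _ hp0.le,
    ENNReal.mul_rpow_of_nonneg _ _ hp0.le, ← ENNReal.rpow_mul, one_div_mul_cancel hp0.ne',
    ENNReal.rpow_one, ENNReal.ofReal_rpow_of_nonneg (by positivity) hp0.le,
    ← Real.rpow_mul (abs_nonneg _), mul_assoc H 2 p, mul_comm (ENNReal.ofReal _) m, ← mul_assoc]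

end FBM

/-! ### Hölder continuity of fractional Brownian motion -/

section FBM

variable {Ω : Type*} [MeasurableSpace Ω] {P : Measure Ω} {H : ℝ} {σ : L2Z} {B : ℝ → Ω → L2Z}

/-- The weighted sum of the powers of all dyadic increments in `[-N, N]`. -/
def dyadicSum {Ω : Type*} (B : ℝ → Ω → L2Z) (γ p : ℝ) (N : ℕ) (w : Ω) : ℝ≥0∞ :=
  ∑' n : ℕ, ∑ k ∈ Finset.Ico (-((N : ℤ) * 2 ^ n)) ((N : ℤ) * 2 ^ n),
    ENNReal.ofReal (((2 : ℝ) ^ n) ^ (γ * (2 * p))) *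
      ‖B (((k + 1 : ℤ) : ℝ) / 2 ^ n) w - B ((k : ℝ) / 2 ^ n) w‖ₑ ^ (2 * p)

theorem IsFBM.measurable_enorm_sub (hB : IsFBM H σ B P) (s t p : ℝ) :
    Measurable fun w => ‖B t w - B s w‖ₑ ^ (2 * p) :=
  measurable_enorm_rpow (fun i => (hB.measurable t i).sub (hB.measurable s i)) p

theorem IsFBM.measurable_dyadicSum (hB : IsFBM H σ B P) (γ p : ℝ) (N : ℕ) :
    Measurable (dyadicSum B γ p N) :=
  Measurable.tsum fun _ => Finset.measurable_fun_sum _ fun _ _ =>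
    (hB.measurable_enorm_sub _ _ p).const_mul _

theorem IsFBM.lintegral_dyadicSum_lt_top [IsProbabilityMeasure P] (hB : IsFBM H σ B P)
    {γ : ℝ} (hγ : 0 < γ) (hγH : γ < H) (hH : H < 1) (N : ℕ) :
    ∫⁻ w, dyadicSum B γ (1 / (H - γ)) N w ∂P < ∞ := by
  have hd : 0 < H - γ := sub_pos.2 hγH
  -- With this choice `2 p (γ - H) = -2`: each of the `2 N 2 ^ n` increments at level `n`
  -- contributes a multiple of `2 ^ (-2 n)`, and the levels sum geometrically. Moreover `1 ≤ p`, as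
  -- Minkowski's inequality requires.
  set p := 1 / (H - γ) with hp
  have hp1 : 1 ≤ p := by
    rw [hp, le_div_iff₀ hd]; linarith
  obtain ⟨M, hM, hmom⟩ := hB.lintegral_enorm_sub_le (hγ.trans hγH) hp1
  have hterm (n : ℕ) : ∫⁻ w, ∑ k ∈ Finset.Ico (-((N : ℤ) * 2 ^ n)) ((N : ℤ) * 2 ^ n),
      ENNReal.ofReal (((2 : ℝ) ^ n) ^ (γ * (2 * p))) *
      ‖B (((k + 1 : ℤ) : ℝ) / 2 ^ n) w - B ((k : ℝ) / 2 ^ n) w‖ₑ ^ (2 * p) ∂P ≤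
      M * ENNReal.ofReal (2 * N * (1 / 2) ^ n) := by
    have h2 : (0 : ℝ) < 2 ^ n := by positivity
    rw [lintegral_finsetSum _ fun k _ => (hB.measurable_enorm_sub _ _ p).const_mul _]
    have hk (k : ℤ) : ∫⁻ w, ENNReal.ofReal (((2 : ℝ) ^ n) ^ (γ * (2 * p))) *
        ‖B (((k + 1 : ℤ) : ℝ) / 2 ^ n) w - B ((k : ℝ) / 2 ^ n) w‖ₑ ^ (2 * p) ∂P ≤
        M * ENNReal.ofReal (((2 : ℝ) ^ n) ^ (-2 : ℝ)) := by
      rw [lintegral_const_mul _ (hB.measurable_enorm_sub _ _ p)]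
      have e1 : |((k + 1 : ℤ) : ℝ) / 2 ^ n - (k : ℝ) / 2 ^ n| = ((2 : ℝ) ^ n)⁻¹ := by
        rw [← sub_div]
        push_cast
        rw [add_sub_cancel_left, one_div, abs_of_pos (by positivity)]
      have h1 := hmom ((k : ℝ) / 2 ^ n) (((k + 1 : ℤ) : ℝ) / 2 ^ n)
      rw [e1] at h1
      have e2 : ((2 : ℝ) ^ n) ^ (γ * (2 * p)) * (((2 : ℝ) ^ n)⁻¹) ^ (H * (2 * p)) =
          ((2 : ℝ) ^ n) ^ (-2 : ℝ) := by
        rw [← Real.rpow_neg_one, ← Real.rpow_mul h2.le, ← Real.rpow_add h2]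
        congr 1
        rw [hp]
        field_simp
        ring
      calc _ ≤ ENNReal.ofReal (((2 : ℝ) ^ n) ^ (γ * (2 * p))) *
            (M * ENNReal.ofReal ((((2 : ℝ) ^ n)⁻¹) ^ (H * (2 * p)))) := by gcongr
        _ = M * (ENNReal.ofReal (((2 : ℝ) ^ n) ^ (γ * (2 * p))) *
            ENNReal.ofReal ((((2 : ℝ) ^ n)⁻¹) ^ (H * (2 * p)))) := by ring
        _ = _ := by rw [← ENNReal.ofReal_mul (by positivity), e2]
    refine (Finset.sum_le_sum fun k _ => hk k).trans (le_of_eq ?_)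
    have e3 : (N : ℤ) * 2 ^ n - -((N : ℤ) * 2 ^ n) = ((2 * N * 2 ^ n : ℕ) : ℤ) := by
      push_cast; ring
    rw [Finset.sum_const, Int.card_Ico, e3, Int.toNat_natCast, nsmul_eq_mul,
      ← ENNReal.ofReal_natCast, mul_left_comm, ← ENNReal.ofReal_mul (by positivity)]
    congr 2
    push_cast
    rw [Real.rpow_neg h2.le, one_div, inv_pow, Real.rpow_two]
    field_simp
  have hmeas (n : ℕ) : AEMeasurable (fun w =>
      ∑ k ∈ Finset.Ico (-((N : ℤ) * 2 ^ n)) ((N : ℤ) * 2 ^ n),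
      ENNReal.ofReal (((2 : ℝ) ^ n) ^ (γ * (2 * p))) *
      ‖B (((k + 1 : ℤ) : ℝ) / 2 ^ n) w - B ((k : ℝ) / 2 ^ n) w‖ₑ ^ (2 * p)) P :=
    (Finset.measurable_fun_sum _ fun _ _ => (hB.measurable_enorm_sub _ _ p).const_mul _).aemeasurable
  simp only [dyadicSum]
  rw [lintegral_tsum hmeas]
  refine (ENNReal.tsum_le_tsum hterm).trans_lt ?_
  rw [ENNReal.tsum_mul_left]
  refine ENNReal.mul_lt_top hM ?_
  rw [← ENNReal.ofReal_tsum_of_nonneg (fun n => by positivity)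
    ((summable_geometric_of_lt_one (by norm_num) (by norm_num)).mul_left _)]
  exact ENNReal.ofReal_lt_top

/-- A single nonnegative term is at most the whole sum; the bound is its root of order `2 p`. -/
theorem norm_increment_le_of_dyadicSum {Ω : Type*} {B : ℝ → Ω → L2Z} {γ p : ℝ} (hp : 0 < p) {N : ℕ} {w : Ω}
    (hY : dyadicSum B γ p N w < ∞) (n : ℕ) (k : ℤ) (hk0 : -((N : ℤ) * 2 ^ n) ≤ k)
    (hk1 : k < (N : ℤ) * 2 ^ n) :
    ‖B (((k + 1 : ℤ) : ℝ) / 2 ^ n) w - B ((k : ℝ) / 2 ^ n) w‖ ≤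
      (dyadicSum B γ p N w).toReal ^ (1 / (2 * p)) * ((1 / 2 : ℝ) ^ γ) ^ n := by
  set d := ‖B (((k + 1 : ℤ) : ℝ) / 2 ^ n) w - B ((k : ℝ) / 2 ^ n) w‖ with hd
  have hd0 : 0 ≤ d := norm_nonneg _
  have h2 : (0 : ℝ) < 2 ^ n := by positivity
  have h1 : ENNReal.ofReal (((2 : ℝ) ^ n) ^ (γ * (2 * p))) *
      ‖B (((k + 1 : ℤ) : ℝ) / 2 ^ n) w - B ((k : ℝ) / 2 ^ n) w‖ₑ ^ (2 * p) ≤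
      dyadicSum B γ p N w :=
    (Finset.single_le_sum (f := fun k : ℤ => ENNReal.ofReal (((2 : ℝ) ^ n) ^ (γ * (2 * p))) *
      ‖B (((k + 1 : ℤ) : ℝ) / 2 ^ n) w - B ((k : ℝ) / 2 ^ n) w‖ₑ ^ (2 * p))
      (fun _ _ => zero_le) (Finset.mem_Ico.2 ⟨hk0, hk1⟩)).trans (ENNReal.le_tsum n)
  rw [← ofReal_norm, ← hd, ENNReal.ofReal_rpow_of_nonneg hd0 (by positivity),
    ← ENNReal.ofReal_mul (by positivity), ENNReal.ofReal_le_iff_le_toReal hY.ne,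
    Real.rpow_mul h2.le, ← Real.mul_rpow (by positivity) hd0] at h1
  have h3 := Real.rpow_le_rpow (by positivity) h1 (show 0 ≤ 1 / (2 * p) by positivity)
  rw [← Real.rpow_mul (by positivity), mul_one_div_cancel (by positivity), Real.rpow_one] at h3
  have e : ((1 / 2 : ℝ) ^ γ) ^ n = (((2 : ℝ) ^ n) ^ γ)⁻¹ := by
    rw [← Real.rpow_natCast, ← Real.rpow_natCast, ← Real.rpow_mul (by norm_num),
      ← Real.rpow_mul (by norm_num), ← Real.rpow_neg (by norm_num), one_div,
      Real.inv_rpow (by norm_num), ← Real.rpow_neg (by norm_num)]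
    ring_nf
  rw [e, ← div_eq_mul_inv, le_div_iff₀ (by positivity), mul_comm]
  exact h3

/-- Almost all paths of a fractional Brownian motion are locally Hölder continuous of every
exponent below the Hurst parameter. -/
theorem IsFBM.ae_mem_holderPaths [IsProbabilityMeasure P] (hB : IsFBM H σ B P)
    {γ : ℝ≥0} (hγ : 0 < γ) (hγH : (γ : ℝ) < H) (hH : H < 1) :
    ∀ᵐ w ∂P, (fun t => B t w) ∈ holderPaths γ := by
  have hγ' : (0 : ℝ) < γ := by exact_mod_cast hγ
  have hall : ∀ᵐ w ∂P, ∀ N : ℕ, dyadicSum B γ (1 / (H - γ)) N w < ∞ :=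
    ae_all_iff.2 fun N => ae_lt_top (hB.measurable_dyadicSum _ _ N)
      (hB.lintegral_dyadicSum_lt_top hγ' hγH hH N).ne
  filter_upwards [hall] with w hw
  refine ⟨hB.zero w, fun a b => ?_⟩
  obtain ⟨N, hN⟩ := exists_nat_ge (max (-a) b)
  have hp : 0 < 1 / (H - (γ : ℝ)) := one_div_pos.2 (sub_pos.2 hγH)
  obtain ⟨C, hC⟩ := exists_holder_of_dyadic (hB.continuous w) hγ' (N := N) (by positivity)
    (norm_increment_le_of_dyadicSum hp (hw N))
  have ha := (le_max_left (-a) b).trans hN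
  have hb := (le_max_right (-a) b).trans hN
  exact ⟨C, holderOnWith_of_norm_sub_le fun s t hs hst ht =>
    hC s t (by linarith) hst (by linarith)⟩

end FBM

end LatticeSDE

end

/-! ### The main theorem -/

open LatticeSDE in
theorem theorem3p2
    {Ω : Type*} [MeasurableSpace Ω] (P : Measure Ω) [IsProbabilityMeasure P]
    (H : ℝ) (hH1 : H < 1) (σ : L2Z) (B : ℝ → Ω → L2Z) (hB : IsFBM H σ B P)
    (β β' : ℝ≥0) (hβ : 1 / 2 < (β : ℝ)) (hββ' : (β : ℝ) < β') (hβ'H : (β' : ℝ) < H)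
    (α : ℝ) (hα1 : 1 - (β' : ℝ) < α) (hα2 : α < β)
    (ν lam : ℝ) (hν : 0 < ν) (hlam : 0 < lam)
    (f h : ℤ → ℝ → ℝ) (hf : DriftAssumption f) (hh : DiffusionAssumption h) :
    (∀ᵐ w ∂P, (fun t => B t w) ∈ holderPaths β') ∧
    ∀ ω ∈ holderPaths β', ∀ T : ℝ, 0 < T → ∀ x : L2Z,
      (∀ u : ℝ → L2Z, IsHolderOn β 0 T u → MildIntegrable ν lam α T hf hh ω u) ∧
      ∃ u : ℝ → L2Z, (IsHolderOn β 0 T u ∧ MildEquation ν lam α T hf hh ω x u) ∧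
        ∀ v : ℝ → L2Z, IsHolderOn β 0 T v ∧ MildEquation ν lam α T hf hh ω x v →
          EqOn v u (Icc 0 T) := by
  have hβ'0 : 0 < β' := by
    have : (0 : ℝ) < β' := by linarith
    exact_mod_cast this
  exact ⟨hB.ae_mem_holderPaths hβ'0 hβ'H hH1, fun ω hω T hT x =>
    existsUnique_mild_solution hββ' (hβ'H.trans hH1) hα1 hα2 ν lam hf hh hω hT.le x⟩
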